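/- Let $A:\mathbb R\to\mathbb C$ be Lipschitz, so that $a=A'\in L^\infty(\mathbb R)$, and for $f:\mathbb R\to\mathbb C$ define the first Calderón commutator by $$C_1(f,a)(x)=\lim_{\epsilon\to0^+}\int_{\epsilon<|x-y|<1/\epsilon}\frac{A(x)-A(y)}{(x-y)^2}\,f(y)\,dy$$ at the points $x$ at which the limit exists; if $a$ and $f$ are Schwartz functions, it exists for every $x$. **Theorem (Calderón).** Let $1<p<\infty$ and $1/p+1/p'=1$. For every $a=A'\in L^\infty(\mathbb R)$ the operator $f\mapsto C_1(f,a)$ extends naturally to a bounded linear operator from $L^p(\mathbb R)$ into $L^p(\mathbb R)$ with $$\|C_1(f,a)\|_p\le C_p\,\|a\|_\infty\,\|f\|_p\qquad(f\in L^p(\mathbb R),\ a\in L^\infty(\mathbb R)),$$ where $C_p$ depends only on $p$. Precisely, there are bounded bilinear maps $$T:L^\infty(\mathbb R)\times L^p(\mathbb R)\to L^p(\mathbb R),\qquad S:L^p(\mathbb R)\times L^{p'}(\mathbb R)\to L^1(\mathbb R)$$ with $\|T(a,f)\|_p\le C_p\|a\|_\infty\|f\|_p$ and $\|S(f,g)\|_1\le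 C_p\|f\|_p\|g\|_{p'}$ such that: 1. for every Lipschitz $A$ with $A'=a$ almost everywhere and every $f\in L^p(\mathbb R)$, $T(a,f)(x)=C_1(f,a)(x)$ for almost every $x$ at which the limit defining $C_1(f,a)(x)$ exists; in particular $T(a,f)=C_1(f,a)$ almost everywhere if $a$ and $f$ are Schwartz functions; 2. for all $a\in L^\infty(\mathbb R)$ and $f\in L^p(\mathbb R)$, $T(a,f)$ is the unique $h\in L^p(\mathbb R)$ with $\int h\,g\,dx=\int S(f,g)\,a\,dx$ for every $g\in L^{p'}(\mathbb R)$. -/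

import Mathlib

open MeasureTheory Filter Topology
open scoped ENNReal SchwartzMap

/-- The truncated integral of the first commutator at the point `x`:
`∫_{ε < |x - y| < 1/ε} (A(x) - A(y)) / (x - y)² f(y) dy`. -/
noncomputable def commutatorTrunc (A f : ℝ → ℂ) (x ε : ℝ) : ℂ :=
  ∫ y in {y : ℝ | ε < |x - y| ∧ |x - y| < 1 / ε}, (A x - A y) / ((x : ℂ) - (y : ℂ)) ^ 2 * f y

/-- The principal value `p.v. ∫ (A(x) - A(y)) / (x - y)² f(y) dy` exists at `x` and equals `l`. -/
def HasCommutatorPV (A f : ℝ → ℂ) (x : ℝ) (l : ℂ) : Prop :=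
  Tendsto (commutatorTrunc A f x) (𝓝[>] 0) (𝓝 l)

/-- `A` is a Lipschitz function on the line with `A' = a` almost everywhere. -/
def IsLipschitzPrimitive (A a : ℝ → ℂ) : Prop :=
  (∃ K, LipschitzWith K A) ∧ ∀ᵐ x : ℝ, HasDerivAt A (a x) x

/-! On test functions, the principal value form `p.v. ∬ (A(x) - A(y)) / (x - y)² f(y) g(x)` is half
the integral of the antisymmetrized kernel `commKer`, which converges absolutely because `f(y) g(x)
- f(x) g(y)` vanishes on the diagonal. After Poisson regularization, `A`, `f`, `g` are the boundary
values of `2 Re V`, `2 Re F`, `2 Re G` with `V`, `F`, `G` holomorphic slightly beyond the upper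
half-plane. Cauchy's formula reduces the double integral to `∫ A (g Im F' - f Im G')`
(`HardyPlus.integral_commKer`). Modulo total derivatives, which integrate by parts onto the bounded
function `a = A'`, the integrand is the imaginary part of `2 A F' G`. As `V F' G` is holomorphic
with zero integral, only `∫ V̄ F' G` is left to bound.

That bound is `HardyPlus.norm_integral_conj_mul_deriv_mul_le`, a Carleson measure argument carried
out with explicit subharmonic functions. By Green's inequality (`LaplacePair.integral_nonneg`) a
decaying function whose Laplacian is nonnegative modulo horizontal derivatives has nonnegative
boundary integral. The Laplacian of `V̄ F' G` is `-4 V̄'' F' G` in this sense. For `p ≤ 2` the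
arithmetic-geometric mean inequality bounds it by `|F|^(p-2) |F'|²` plus `4 |V''|² |F|^(2-p) |G|²`.
The first term is controlled by the Laplacian of `|F|^p`, the second by that of `exp(u²) |F|^(2-p)
|G|²` with `u = 2 Re V'`. On the boundary `u = a` is bounded, so that weight costs only a constant
there, and Young's inequality leaves `∫ |F|^p + ∫ |G|^q`. M. Riesz' inequalities (directly for `p ≤
2`, by duality for `q ≥ 2`) return from `F`, `G` to `f`, `g`; antisymmetry removes the restriction
`p ≤ 2`.

Modulating `f` and `g` by cosines and sines multiplies the kernel by `cos(ξ(x - y))`. Gaussian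
averages in `ξ` then bound smooth truncations, and the sharp truncation differs from a smooth one by
an operator dominated by convolution with kernels of bounded `L¹` norm.

Norming functionals carry the estimate to Lipschitz functions with values in any Banach space. The
choice of the curve `x ↦ 1_(0,x]` in `L¹` (`intervalLp`), whose increments pair with `a` to give
`A(x) - A(y)`, produces `S(f, g) ∈ L¹` in one stroke. Then `T(a, f)` is the function representing `g
↦ ∫ S(f, g) a`. The truncated operators converge to `T(a, f)` when integrated over sets of finite
measure, which identifies their pointwise limits almost everywhere. -/

/-! ### Half-planes and functions of polynomial decay. -/

/-- The open half-plane `Im z > -s`. -/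
def halfPlane (s : ℝ) : Set ℂ := {z | -s < z.im}

lemma isOpen_halfPlane (s : ℝ) : IsOpen (halfPlane s) :=
  isOpen_lt continuous_const Complex.continuous_im

/-- Continuous functions on the half-plane `Im z > -s` that are `O((1 + |z|)⁻ᵏ)`. -/
structure Dec {E : Type*} [NormedAddCommGroup E] (s : ℝ) (k : ℕ) (φ : ℂ → E) : Prop where
  cont : ContinuousOn φ (halfPlane s)
  bound : ∃ C, 0 ≤ C ∧ ∀ z ∈ halfPlane s, ‖φ z‖ ≤ C / (1 + ‖z‖) ^ k

section Dec
variable {E : Type*} [NormedAddCommGroup E] {s : ℝ} {j k : ℕ} {φ ψ : ℂ → E}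

lemma one_add_norm_pow_pos (z : ℂ) (k : ℕ) : 0 < (1 + ‖z‖) ^ k := by positivity

lemma Dec.add (h : Dec s k φ) (h' : Dec s k ψ) : Dec s k (fun z => φ z + ψ z) := by
  obtain ⟨C, hC, hb⟩ := h.bound
  obtain ⟨C', hC', hb'⟩ := h'.bound
  refine ⟨h.cont.add h'.cont, C + C', add_nonneg hC hC', fun z hz => ?_⟩
  rw [add_div]
  exact (norm_add_le _ _).trans (add_le_add (hb z hz) (hb' z hz))

lemma Dec.neg (h : Dec s k φ) : Dec s k (fun z => -φ z) := by
  obtain ⟨C, hC, hb⟩ := h.bound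
  exact ⟨h.cont.neg, C, hC, fun z hz => by rw [norm_neg]; exact hb z hz⟩

lemma Dec.sub (h : Dec s k φ) (h' : Dec s k ψ) : Dec s k (fun z => φ z - ψ z) := by
  simpa only [sub_eq_add_neg] using h.add h'.neg

lemma Dec.mono (h : Dec s k φ) (hjk : j ≤ k) : Dec s j φ := by
  obtain ⟨C, hC, hb⟩ := h.bound
  refine ⟨h.cont, C, hC, fun z hz => (hb z hz).trans ?_⟩
  apply div_le_div_of_nonneg_left hC (one_add_norm_pow_pos z j)
  exact pow_le_pow_right₀ (by linarith [norm_nonneg z]) hjk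

lemma Dec.of_le {F : Type*} [NormedAddCommGroup F] {χ : ℂ → F} (h : Dec s k φ)
    (hc : ContinuousOn χ (halfPlane s)) (hle : ∀ z ∈ halfPlane s, ‖χ z‖ ≤ ‖φ z‖) :
    Dec s k χ := by
  obtain ⟨C, hC, hb⟩ := h.bound
  exact ⟨hc, C, hC, fun z hz => (hle z hz).trans (hb z hz)⟩

lemma Dec.mul {R : Type*} [NormedRing R] {φ ψ : ℂ → R} (h : Dec s j φ) (h' : Dec s k ψ) :
    Dec s (j + k) (fun z => φ z * ψ z) := by
  obtain ⟨C, hC, hb⟩ := h.bound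
  obtain ⟨C', hC', hb'⟩ := h'.bound
  refine ⟨h.cont.mul h'.cont, C * C', mul_nonneg hC hC', fun z hz => ?_⟩
  have := (norm_mul_le (φ z) (ψ z)).trans
    (mul_le_mul (hb z hz) (hb' z hz) (norm_nonneg _)
      (div_nonneg hC (one_add_norm_pow_pos z j).le))
  rwa [div_mul_div_comm, ← pow_add] at this

lemma Dec.const (c : E) : Dec s 0 (fun _ => c) :=
  ⟨continuousOn_const, ‖c‖, norm_nonneg c, fun z _ => by simp⟩

lemma Dec.const_mul {R : Type*} [NormedRing R] {φ : ℂ → R} (h : Dec s k φ) (c : R) :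
    Dec s k (fun z => c * φ z) := by
  simpa using (Dec.const (s := s) c).mul h

lemma Dec.of_bdd (hc : ContinuousOn φ (halfPlane s)) {C : ℝ}
    (hb : ∀ z ∈ halfPlane s, ‖φ z‖ ≤ C) : Dec s 0 φ :=
  ⟨hc, max C 0, le_max_right _ _, fun z hz => by simpa using Or.inl (hb z hz)⟩

lemma Dec.exists_bound (h : Dec s k φ) : ∃ C, 0 ≤ C ∧ ∀ z ∈ halfPlane s, ‖φ z‖ ≤ C := by
  obtain ⟨C, hC, hb⟩ := (h.mono (Nat.zero_le k)).bound
  exact ⟨C, hC, fun z hz => by simpa using hb z hz⟩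

lemma Dec.re {φ : ℂ → ℂ} (h : Dec s k φ) : Dec s k (fun z => (φ z).re) :=
  h.of_le (Complex.continuous_re.comp_continuousOn h.cont)
    fun z _ => by simpa using Complex.abs_re_le_norm (φ z)

lemma Dec.im {φ : ℂ → ℂ} (h : Dec s k φ) : Dec s k (fun z => (φ z).im) :=
  h.of_le (Complex.continuous_im.comp_continuousOn h.cont)
    fun z _ => by simpa using Complex.abs_im_le_norm (φ z)

lemma Dec.conj {φ : ℂ → ℂ} (h : Dec s k φ) : Dec s k (fun z => starRingEnd ℂ (φ z)) :=
  h.of_le (Complex.continuous_conj.comp_continuousOn h.cont) fun z _ => by simp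

lemma Dec.anti {s' : ℝ} (h : Dec s k φ) (hs : s' ≤ s) : Dec s' k φ := by
  have hsub : halfPlane s' ⊆ halfPlane s := fun z (hz : -s' < z.im) =>
    show -s < z.im by linarith
  obtain ⟨C, hC, hb⟩ := h.bound
  exact ⟨h.cont.mono hsub, C, hC, fun z hz => hb z (hsub hz)⟩

lemma mem_halfPlane_line {s x y : ℝ} (hy : -s < y) : (x + y * Complex.I : ℂ) ∈ halfPlane s := by
  simpa [halfPlane] using hy

lemma abs_re_le_norm_line (x y : ℝ) : |x| ≤ ‖(x + y * Complex.I : ℂ)‖ := by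
  simpa using Complex.abs_re_le_norm (x + y * Complex.I : ℂ)

lemma abs_im_le_norm_line (x y : ℝ) : |y| ≤ ‖(x + y * Complex.I : ℂ)‖ := by
  simpa using Complex.abs_im_le_norm (x + y * Complex.I : ℂ)

lemma Dec.continuous_line (h : Dec s k φ) {y : ℝ} (hy : -s < y) :
    Continuous fun x : ℝ => φ (x + y * Complex.I) :=
  h.cont.comp_continuous (by fun_prop) fun _ => mem_halfPlane_line hy

/-- Quadratic decay gives one integrable majorant for all horizontal lines; it is the dominating
function both for differentiating line integrals in the height and for letting the height tend to
infinity. -/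
lemma Dec.bound_line (h : Dec s 2 φ) :
    ∃ C, 0 ≤ C ∧ ∀ x y : ℝ, -s < y → ‖φ (x + y * Complex.I)‖ ≤ C * (1 + x ^ 2)⁻¹ := by
  obtain ⟨C, hC, hb⟩ := h.bound
  refine ⟨C, hC, fun x y hy => (hb _ (mem_halfPlane_line hy)).trans ?_⟩
  rw [div_eq_mul_inv]
  gcongr
  have h1 := abs_re_le_norm_line x y
  nlinarith [abs_nonneg x, sq_abs x, pow_le_pow_left₀ (abs_nonneg x) h1 2]

lemma Dec.integrable_line (h : Dec s 2 φ) {y : ℝ} (hy : -s < y) :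
    Integrable fun x : ℝ => φ (x + y * Complex.I) := by
  obtain ⟨C, hC, hb⟩ := h.bound_line
  exact (integrable_inv_one_add_sq.const_mul C).mono'
    (h.continuous_line hy).aestronglyMeasurable (Eventually.of_forall fun x => hb x y hy)

lemma Dec.tendsto_integral_line [NormedSpace ℝ E] (h : Dec s 2 φ) :
    Tendsto (fun y : ℝ => ∫ x : ℝ, φ (x + y * Complex.I)) atTop (𝓝 0) := by
  obtain ⟨C, hC, hb⟩ := h.bound_line
  obtain ⟨C', hC', hb'⟩ := h.bound
  have key := tendsto_integral_filter_of_dominated_convergence (μ := (volume : Measure ℝ))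
    (l := (atTop : Filter ℝ)) (F := fun y x => φ (x + y * Complex.I)) (f := fun _ => (0 : E))
    (fun x => C * (1 + x ^ 2)⁻¹) ?_ ?_ (integrable_inv_one_add_sq.const_mul C) ?_
  · simpa using key
  · filter_upwards [eventually_gt_atTop (-s)] with y hy
    exact (h.continuous_line hy).aestronglyMeasurable
  · filter_upwards [eventually_gt_atTop (-s)] with y hy
    exact Eventually.of_forall fun x => hb x y hy
  · refine Eventually.of_forall fun x => ?_
    rw [tendsto_zero_iff_norm_tendsto_zero]
    have hlim : Tendsto (fun y : ℝ => C' / (1 + |y|) ^ 2) atTop (𝓝 0) := by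
      apply Tendsto.const_div_atTop
      have h1 : Tendsto (fun y : ℝ => 1 + |y|) atTop atTop :=
        tendsto_atTop_add_const_left _ _ tendsto_abs_atTop_atTop
      exact (tendsto_pow_atTop two_ne_zero).comp h1
    refine squeeze_zero' (Eventually.of_forall fun y => norm_nonneg _) ?_ hlim
    filter_upwards [eventually_gt_atTop (-s)] with y hy
    refine (hb' _ (mem_halfPlane_line hy)).trans ?_
    have := abs_im_le_norm_line x y
    gcongr

end Dec

/-! ### Laplacians modulo horizontal derivatives, and Green's inequality. -/

lemma HasDerivAt.line_shift {E : Type*} [NormedAddCommGroup E] [NormedSpace ℝ E]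
    {φ : ℂ → E} {w e : ℂ} {y : ℝ} {d : E}
    (h : HasDerivAt (fun t : ℝ => φ (w + y * e + t * e)) d 0) :
    HasDerivAt (fun t : ℝ => φ (w + t * e)) d y := by
  have h2 : HasDerivAt (fun t : ℝ => φ (w + y * e + t * e)) d (y - y) := by simpa using h
  have := HasDerivAt.comp_sub_const y y h2
  refine this.congr_of_eventuallyEq (Eventually.of_forall fun t => ?_)
  simp only
  congr 1
  push_cast
  ring

lemma Dec.hasDerivAt_integral {s : ℝ} {φ φ' : ℂ → ℝ} (h : Dec s 2 φ) (h' : Dec s 2 φ')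
    (hd : ∀ z ∈ halfPlane s, HasDerivAt (fun t : ℝ => φ (z + t * Complex.I)) (φ' z) 0)
    {y : ℝ} (hy : -s < y) :
    HasDerivAt (fun y : ℝ => ∫ x : ℝ, φ (x + y * Complex.I))
      (∫ x : ℝ, φ' (x + y * Complex.I)) y := by
  obtain ⟨C, hC, hb⟩ := h'.bound_line
  refine (hasDerivAt_integral_of_dominated_loc_of_deriv_le (s := Set.Ioi (-s))
    (F := fun (y x : ℝ) => φ (x + y * Complex.I)) (F' := fun (y x : ℝ) => φ' (x + y * Complex.I))
    (bound := fun x => C * (1 + x ^ 2)⁻¹) (Ioi_mem_nhds hy) ?_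
    (h.integrable_line hy) (h'.continuous_line hy).aestronglyMeasurable ?_
    (integrable_inv_one_add_sq.const_mul C) ?_).2
  · filter_upwards [Ioi_mem_nhds hy] with y hy
    exact (h.continuous_line hy).aestronglyMeasurable
  · exact Eventually.of_forall fun x y hy => hb x y hy
  · exact Eventually.of_forall fun x y hy => (hd _ (mem_halfPlane_line hy)).line_shift

/-- `L` is a Laplacian of `Φ` on the half-plane up to a horizontal derivative: `L = Φ_yy + E_x`. -/
def LaplacePair (s : ℝ) (Φ L : ℂ → ℝ) : Prop :=
  ∃ Φy Φyy E Ex : ℂ → ℝ, Dec s 2 Φ ∧ Dec s 2 Φy ∧ Dec s 2 Φyy ∧ Dec s 2 E ∧ Dec s 2 Ex ∧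
    (∀ z ∈ halfPlane s, HasDerivAt (fun t : ℝ => Φ (z + t * Complex.I)) (Φy z) 0) ∧
    (∀ z ∈ halfPlane s, HasDerivAt (fun t : ℝ => Φy (z + t * Complex.I)) (Φyy z) 0) ∧
    (∀ z ∈ halfPlane s, HasDerivAt (fun t : ℝ => E (z + t * (1 : ℂ))) (Ex z) 0) ∧
    ∀ z ∈ halfPlane s, L z = Φyy z + Ex z

lemma LaplacePair.add {s : ℝ} {Φ L Φ' L' : ℂ → ℝ} (h : LaplacePair s Φ L)
    (h' : LaplacePair s Φ' L') :
    LaplacePair s (fun z => Φ z + Φ' z) (fun z => L z + L' z) := by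
  obtain ⟨a, b, c, d, h1, h2, h3, h4, h5, h6, h7, h8, h9⟩ := h
  obtain ⟨a', b', c', d', h1', h2', h3', h4', h5', h6', h7', h8', h9'⟩ := h'
  refine ⟨_, _, _, _, h1.add h1', h2.add h2', h3.add h3', h4.add h4', h5.add h5',
    fun z hz => (h6 z hz).add (h6' z hz), fun z hz => (h7 z hz).add (h7' z hz),
    fun z hz => (h8 z hz).add (h8' z hz), fun z hz => ?_⟩
  change L z + L' z = _
  rw [h9 z hz, h9' z hz]
  ring

lemma LaplacePair.const_mul {s : ℝ} {Φ L : ℂ → ℝ} (h : LaplacePair s Φ L) (c : ℝ) :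
    LaplacePair s (fun z => c * Φ z) (fun z => c * L z) := by
  obtain ⟨_, _, _, _, h1, h2, h3, h4, h5, h6, h7, h8, h9⟩ := h
  refine ⟨_, _, _, _, h1.const_mul c, h2.const_mul c, h3.const_mul c, h4.const_mul c,
    h5.const_mul c, fun z hz => (h6 z hz).const_mul c, fun z hz => (h7 z hz).const_mul c,
    fun z hz => (h8 z hz).const_mul c, fun z hz => ?_⟩
  change c * L z = _
  rw [h9 z hz]
  ring

lemma Dec.integral_deriv_eq_zero {s : ℝ} {E Ex : ℂ → ℝ} (hE : Dec s 2 E) (hEx : Dec s 2 Ex)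
    (hd : ∀ z ∈ halfPlane s, HasDerivAt (fun t : ℝ => E (z + t * (1 : ℂ))) (Ex z) 0)
    {y : ℝ} (hy : -s < y) : ∫ x : ℝ, Ex (x + y * Complex.I) = 0 := by
  refine integral_eq_zero_of_hasDerivAt_of_integrable
    (f := fun x : ℝ => E (x + y * Complex.I)) (fun x => ?_) (hEx.integrable_line hy)
    (hE.integrable_line hy)
  have h1 := hd _ (mem_halfPlane_line (x := x) hy)
  have h2 : HasDerivAt (fun t : ℝ => E ((y * Complex.I : ℂ) + t * (1 : ℂ)))
      (Ex (x + y * Complex.I)) x := by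
    apply HasDerivAt.line_shift
    rwa [mul_one, add_comm ((y : ℂ) * Complex.I) (x : ℂ)]
  refine h2.congr_of_eventuallyEq (Eventually.of_forall fun t => ?_)
  simp only
  congr 1
  ring

/-- A function on a half line that has nonnegative second derivative and tends to `0` at infinity
is nonnegative. -/
lemma nonneg_of_convex_of_tendsto_zero {s : ℝ} {I I' I'' : ℝ → ℝ}
    (h1 : ∀ y, -s < y → HasDerivAt I (I' y) y) (h2 : ∀ y, -s < y → HasDerivAt I' (I'' y) y)
    (h3 : ∀ y, -s < y → 0 ≤ I'' y) (hlim : Tendsto I atTop (𝓝 0)) {y₀ : ℝ} (hy₀ : -s < y₀) :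
    0 ≤ I y₀ := by
  have hmono : MonotoneOn I' (Set.Ioi (-s)) := by
    apply monotoneOn_of_deriv_nonneg (convex_Ioi _)
    · exact fun y hy => (h2 y hy).continuousAt.continuousWithinAt
    · intro y hy
      rw [interior_Ioi] at hy
      exact (h2 y hy).differentiableAt.differentiableWithinAt
    · intro y hy
      rw [interior_Ioi] at hy
      rw [(h2 y hy).deriv]
      exact h3 y hy
  -- A convex function with positive slope somewhere grows at least linearly, which contradicts the
  -- limit `0`.
  have hneg : ∀ y, -s < y → I' y ≤ 0 := by
    intro y hy
    by_contra! hpos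
    have hgrow : ∀ z, y ≤ z → I y + I' y * (z - y) ≤ I z := by
      intro z hz
      have hconv := (convex_Ici y).mul_sub_le_image_sub_of_le_deriv (f := I)
        (fun w hw => (h1 w (hy.trans_le hw)).continuousAt.continuousWithinAt)
        (fun w hw => (h1 w (hy.trans_le (interior_subset hw))).differentiableAt.differentiableWithinAt)
        (C := I' y) (fun w hw => by
          have hw' := interior_subset hw
          rw [(h1 w (hy.trans_le hw')).deriv]
          exact hmono hy (hy.trans_le hw') hw') y (Set.self_mem_Ici) z hz hz
      linarith
    have htop : Tendsto (fun z => I y + I' y * (z - y)) atTop atTop :=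
      tendsto_atTop_add_const_left _ _
        ((tendsto_atTop_add_const_right _ (-y) tendsto_id).const_mul_atTop hpos)
    have : Tendsto I atTop atTop := by
      refine tendsto_atTop_mono' _ ?_ htop
      filter_upwards [eventually_ge_atTop y] with z hz using hgrow z hz
    exact not_tendsto_nhds_of_tendsto_atTop this 0 hlim
  have hanti : AntitoneOn I (Set.Ioi (-s)) := by
    apply antitoneOn_of_deriv_nonpos (convex_Ioi _)
    · exact fun y hy => (h1 y hy).continuousAt.continuousWithinAt
    · intro y hy
      rw [interior_Ioi] at hy
      exact (h1 y hy).differentiableAt.differentiableWithinAt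
    · intro y hy
      rw [interior_Ioi] at hy
      rw [(h1 y hy).deriv]
      exact hneg y hy
  refine le_of_tendsto hlim ?_
  filter_upwards [eventually_ge_atTop y₀] with z hz
  exact hanti hy₀ (hy₀.trans_le hz) hz

/-- Green's inequality on the half-plane. -/
theorem LaplacePair.integral_nonneg {s : ℝ} {Φ L : ℂ → ℝ} (h : LaplacePair s Φ L) (hs : 0 < s)
    (hL : ∀ z ∈ halfPlane s, 0 ≤ L z) : 0 ≤ ∫ x : ℝ, Φ x := by
  obtain ⟨Φy, Φyy, E, Ex, h1, h2, h3, h4, h5, h6, h7, h8, h9⟩ := h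
  have := nonneg_of_convex_of_tendsto_zero (s := s) (y₀ := 0)
    (fun y hy => h1.hasDerivAt_integral h2 h6 hy) (fun y hy => h2.hasDerivAt_integral h3 h7 hy)
    (fun y hy => ?_) h1.tendsto_integral_line (by linarith)
  · simpa using this
  · have h0 := h4.integral_deriv_eq_zero h5 h8 hy
    -- The horizontal derivative integrates to zero on each line, so the second derivative of the
    -- line integral of `Φ` is the integral of `L`.
    have h10 : ∫ x : ℝ, L (x + y * Complex.I) = ∫ x : ℝ, Φyy (x + y * Complex.I) := by
      have : ∀ x : ℝ, L (x + y * Complex.I) = Φyy (x + y * Complex.I) + Ex (x + y * Complex.I) :=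
        fun x => h9 _ (mem_halfPlane_line hy)
      simp_rw [this]
      rw [integral_add (h3.integrable_line hy) (h5.integrable_line hy), h0, add_zero]
    rw [← h10]
    exact MeasureTheory.integral_nonneg fun x => hL _ (mem_halfPlane_line hy)

/-! ### Jets along lines, holomorphic functions and Cauchy's theorem. -/

/-- The first and second derivatives of `Φ` along lines in the half-plane are `D` and `DD`. -/
def Jet (s : ℝ) (Φ : ℂ → ℝ) (D DD : ℂ → ℂ → ℝ) : Prop :=
  ∀ e : ℂ, ∀ z ∈ halfPlane s, HasDerivAt (fun t : ℝ => Φ (z + t * e)) (D e z) 0 ∧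
    HasDerivAt (fun t : ℝ => D e (z + t * e)) (DD e z) 0

lemma Jet.laplacePair {s : ℝ} {Φ : ℂ → ℝ} {D DD : ℂ → ℂ → ℝ} (h : Jet s Φ D DD)
    (h0 : Dec s 2 Φ) (h1 : ∀ e, Dec s 2 (D e)) (h2 : ∀ e, Dec s 2 (DD e)) :
    LaplacePair s Φ (fun z => DD 1 z + DD Complex.I z) :=
  ⟨D Complex.I, DD Complex.I, D 1, DD 1, h0, h1 _, h2 _, h1 _, h2 _,
    fun z hz => (h _ z hz).1, fun z hz => (h _ z hz).2, fun z hz => (h 1 z hz).2,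
    fun z _ => by ring⟩

lemma HasDerivAt.complex_line {F : ℂ → ℂ} {F' z : ℂ} (h : HasDerivAt F F' z) (e : ℂ) :
    HasDerivAt (fun t : ℝ => F (z + t * e)) (F' * e) 0 := by
  have h1 : HasDerivAt (fun t : ℂ => z + t * e) e 0 := by
    simpa using ((hasDerivAt_id (0 : ℂ)).mul_const e).const_add z
  have h2 : HasDerivAt F F' (z + (0 : ℂ) * e) := by simpa using h
  have h3 := (h2.comp (0 : ℂ) h1)
  have h4 : HasDerivAt (fun t : ℂ => F (z + t * e)) (F' * e) ((0 : ℝ) : ℂ) := by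
    rw [Complex.ofReal_zero]
    exact h3
  exact h4.comp_ofReal

lemma HasDerivAt.complex_re {f : ℝ → ℂ} {f' : ℂ} {t : ℝ} (h : HasDerivAt f f' t) :
    HasDerivAt (fun t => (f t).re) f'.re t :=
  (Complex.reCLM.hasFDerivAt.comp_hasDerivAt t h)

lemma HasDerivAt.complex_im {f : ℝ → ℂ} {f' : ℂ} {t : ℝ} (h : HasDerivAt f f' t) :
    HasDerivAt (fun t => (f t).im) f'.im t :=
  (Complex.imCLM.hasFDerivAt.comp_hasDerivAt t h)

/-- Holomorphic functions on `Im z > -s` with decay `O(1 / (1 + |z|))`. -/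
structure Hardy (s : ℝ) (F : ℂ → ℂ) : Prop where
  diff : DifferentiableOn ℂ F (halfPlane s)
  dec : Dec s 1 F

lemma DifferentiableOn.hasDerivAt_halfPlane {s : ℝ} {F : ℂ → ℂ}
    (h : DifferentiableOn ℂ F (halfPlane s)) {z : ℂ} (hz : z ∈ halfPlane s) :
    HasDerivAt F (_root_.deriv F z) z :=
  (h.differentiableAt ((isOpen_halfPlane s).mem_nhds hz)).hasDerivAt

/-- Cauchy's estimate on discs of radius `(s - s') / 2`, on which `1 + |z|` changes by a bounded
factor. Each derivative costs a little of the half-plane, which is why `HardyPlus` keeps a margin.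
-/
lemma Dec.deriv {s s' : ℝ} {k : ℕ} {F : ℂ → ℂ} (h : DifferentiableOn ℂ F (halfPlane s))
    (hd : Dec s k F) (hs : s' < s) : Dec s' k (_root_.deriv F) := by
  obtain ⟨C, hC, hb⟩ := hd.bound
  set r : ℝ := (s - s') / 2 with hr
  have hr0 : 0 < r := by rw [hr]; linarith
  have hsub : halfPlane s' ⊆ halfPlane s := fun z (hz : -s' < z.im) =>
    show -s < z.im by linarith
  refine ⟨((h.deriv (isOpen_halfPlane s)).continuousOn).mono hsub, C * (1 + r) ^ k / r,
    by positivity, fun z hz => ?_⟩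
  have hball : Metric.closedBall z r ⊆ halfPlane s := by
    intro w hw
    have h1 : |(w - z).im| ≤ r :=
      (Complex.abs_im_le_norm _).trans (by simpa [dist_eq_norm] using hw)
    have h2 : -s' < z.im := hz
    rw [Complex.sub_im, abs_le] at h1
    change -s < w.im
    linarith
  have := Complex.norm_deriv_le_of_forall_mem_sphere_norm_le (c := z) (R := r) (f := F)
    (C := C * (1 + r) ^ k / (1 + ‖z‖) ^ k) hr0
    (DifferentiableOn.diffContOnCl (by
      rw [closure_ball z hr0.ne']
      exact h.mono hball)) (fun w hw => ?_)
  · refine this.trans (le_of_eq ?_)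
    field_simp
  · refine (hb w (hball (Metric.sphere_subset_closedBall hw))).trans ?_
    have hzw : 1 + ‖z‖ ≤ (1 + r) * (1 + ‖w‖) := by
      have h1 : ‖z‖ ≤ ‖w‖ + r := by
        have : ‖w - z‖ = r := by simpa [dist_eq_norm] using hw
        calc ‖z‖ = ‖w - (w - z)‖ := by ring_nf
          _ ≤ ‖w‖ + ‖w - z‖ := norm_sub_le _ _
          _ = _ := by rw [this]
      nlinarith [norm_nonneg w]
    rw [div_le_div_iff₀ (one_add_norm_pow_pos w k) (one_add_norm_pow_pos z k), mul_assoc, ← mul_pow]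
    gcongr

lemma Hardy.anti {s s' : ℝ} {F : ℂ → ℂ} (h : Hardy s F) (hs : s' ≤ s) : Hardy s' F :=
  ⟨h.diff.mono fun z (hz : -s' < z.im) => show -s < z.im by linarith, h.dec.anti hs⟩

lemma Hardy.deriv {s s' : ℝ} {F : ℂ → ℂ} (h : Hardy s F) (hs : s' < s) : Hardy s' (_root_.deriv F) :=
  ⟨(h.diff.deriv (isOpen_halfPlane s)).mono fun z (hz : -s' < z.im) =>
    show -s < z.im by linarith, Dec.deriv h.diff h.dec hs⟩

/-- The real part of a holomorphic function is harmonic, so Green's inequality applies with zero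
Laplacian. Applied to all multiples `c G`, this one-sided statement already forces the integral to
vanish. -/
lemma integral_re_nonneg_of_holomorphic {s : ℝ} (hs : 0 < s) {G : ℂ → ℂ}
    (h : DifferentiableOn ℂ G (halfPlane s)) (hd : Dec s 2 G) : 0 ≤ ∫ x : ℝ, (G x).re := by
  set s' := s / 2
  have hsub : halfPlane s' ⊆ halfPlane s := fun z (hz : -s' < z.im) =>
    show -s < z.im by linarith [show s' = s / 2 from rfl]
  have hd1 : Dec (3 * s / 4) 2 (_root_.deriv G) := Dec.deriv h hd (by linarith)
  have h1 : DifferentiableOn ℂ (_root_.deriv G) (halfPlane s) := h.deriv (isOpen_halfPlane s)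
  have hd2 : Dec s' 2 (_root_.deriv (_root_.deriv G)) :=
    Dec.deriv (s := 3 * s / 4) (h1.mono fun z (hz : -(3 * s / 4) < z.im) =>
      show -s < z.im by linarith) hd1 (by linarith [show s' = s / 2 from rfl])
  have hjet : Jet s' (fun z => (G z).re) (fun e z => (_root_.deriv G z * e).re)
      (fun e z => (_root_.deriv (_root_.deriv G) z * e * e).re) := by
    intro e z hz
    refine ⟨((h.hasDerivAt_halfPlane (hsub hz)).complex_line e).complex_re, ?_⟩
    exact (((h1.hasDerivAt_halfPlane (hsub hz)).complex_line e).mul_const e).complex_re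
  have hmul : ∀ (e : ℂ) {φ : ℂ → ℂ}, Dec s' 2 φ → Dec s' 2 (fun z => φ z * e) := by
    intro e φ hφ
    simpa using hφ.mul (Dec.const e)
  refine (hjet.laplacePair (hd.anti (by linarith [show s' = s / 2 from rfl])).re
    (fun e => (hmul e (hd1.anti (by linarith [show s' = s / 2 from rfl]))).re)
    (fun e => (hmul e (hmul e hd2)).re)).integral_nonneg (by positivity) fun z _ => ?_
  simp [mul_assoc]

/-- Cauchy's theorem on the half-plane. -/
theorem integral_eq_zero_of_holomorphic {s : ℝ} (hs : 0 < s) {G : ℂ → ℂ}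
    (h : DifferentiableOn ℂ G (halfPlane s)) (hd : Dec s 2 G) : ∫ x : ℝ, G x = 0 := by
  have hint : Integrable fun x : ℝ => G x := by
    simpa using hd.integrable_line (y := 0) (by linarith)
  have key : ∀ c : ℂ, 0 ≤ (c * ∫ x : ℝ, G x).re := by
    intro c
    have := integral_re_nonneg_of_holomorphic hs (h.const_mul c) (hd.const_mul c)
    rw [← integral_const_mul]
    refine this.trans (le_of_eq ?_)
    exact (integral_re (hint.const_mul c))
  -- With this `c` the nonnegative quantity is minus the squared modulus of the integral.
  have k1 := key (-starRingEnd ℂ (∫ x : ℝ, G x))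
  rw [neg_mul, mul_comm, Complex.mul_conj, Complex.neg_re, Complex.ofReal_re] at k1
  exact Complex.normSq_eq_zero.mp (le_antisymm (by linarith) (Complex.normSq_nonneg _))

/-! ### Calculus of jets with decay. -/

/-- Functions in the class `Hardy s'` for some `s' > s`; this class is closed under derivatives. -/
def HardyPlus (s : ℝ) (F : ℂ → ℂ) : Prop := ∃ s', s < s' ∧ Hardy s' F

section HardyPlus
variable {s : ℝ} {F G : ℂ → ℂ}

lemma HardyPlus.dec (h : HardyPlus s F) : Dec s 1 F := by
  obtain ⟨s', hs, h⟩ := h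
  exact (h.anti hs.le).dec

lemma HardyPlus.derivative (h : HardyPlus s F) : HardyPlus s (deriv F) := by
  obtain ⟨s', hs, h⟩ := h
  exact ⟨(s + s') / 2, by linarith, h.deriv (by linarith)⟩

lemma HardyPlus.diff (h : HardyPlus s F) : DifferentiableOn ℂ F (halfPlane s) := by
  obtain ⟨s', hs, h⟩ := h
  exact (h.anti hs.le).diff

lemma HardyPlus.hasDerivAt (h : HardyPlus s F) {z : ℂ} (hz : z ∈ halfPlane s) :
    HasDerivAt F (_root_.deriv F z) z := h.diff.hasDerivAt_halfPlane hz

lemma HardyPlus.const_mul (h : HardyPlus s F) (c : ℂ) : HardyPlus s (fun z => c * F z) := by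
  obtain ⟨s', hs, h⟩ := h
  exact ⟨s', hs, h.diff.const_mul c, h.dec.const_mul c⟩

end HardyPlus

/-- A jet all of whose components are `O((1 + |z|)⁻ᵏ)`. -/
structure JetDec (s : ℝ) (k : ℕ) (Φ : ℂ → ℝ) (D DD : ℂ → ℂ → ℝ) : Prop where
  jet : Jet s Φ D DD
  dec0 : Dec s k Φ
  dec1 : ∀ e, Dec s k (D e)
  dec2 : ∀ e, Dec s k (DD e)

lemma JetDec.laplacePair {s : ℝ} {Φ : ℂ → ℝ} {D DD : ℂ → ℂ → ℝ} (h : JetDec s 2 Φ D DD) :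
    LaplacePair s Φ (fun z => DD 1 z + DD Complex.I z) :=
  h.jet.laplacePair h.dec0 h.dec1 h.dec2

lemma JetDec.add {s : ℝ} {k : ℕ} {Φ Ψ : ℂ → ℝ} {D DD D' DD' : ℂ → ℂ → ℝ}
    (h : JetDec s k Φ D DD) (h' : JetDec s k Ψ D' DD') :
    JetDec s k (fun z => Φ z + Ψ z) (fun e z => D e z + D' e z) (fun e z => DD e z + DD' e z) :=
  ⟨fun e z hz => ⟨(h.jet e z hz).1.add (h'.jet e z hz).1, (h.jet e z hz).2.add (h'.jet e z hz).2⟩,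
    h.dec0.add h'.dec0, fun e => (h.dec1 e).add (h'.dec1 e), fun e => (h.dec2 e).add (h'.dec2 e)⟩

lemma JetDec.mul {s : ℝ} {j k : ℕ} {Φ Ψ : ℂ → ℝ} {D DD D' DD' : ℂ → ℂ → ℝ}
    (h : JetDec s j Φ D DD) (h' : JetDec s k Ψ D' DD') :
    JetDec s (j + k) (fun z => Φ z * Ψ z) (fun e z => D e z * Ψ z + Φ z * D' e z)
      (fun e z => (DD e z * Ψ z + D e z * D' e z) + (D e z * D' e z + Φ z * DD' e z)) := by
  refine ⟨fun e z hz => ⟨?_, ?_⟩, h.dec0.mul h'.dec0,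
    fun e => ((h.dec1 e).mul h'.dec0).add (h.dec0.mul (h'.dec1 e)),
    fun e => (((h.dec2 e).mul h'.dec0).add ((h.dec1 e).mul (h'.dec1 e))).add
      (((h.dec1 e).mul (h'.dec1 e)).add (h.dec0.mul (h'.dec2 e)))⟩
  · simpa using (h.jet e z hz).1.fun_mul (h'.jet e z hz).1
  · have h1 := (h.jet e z hz).2.fun_mul (h'.jet e z hz).1
    have h2 := (h.jet e z hz).1.fun_mul (h'.jet e z hz).2
    simpa using h1.fun_add h2

/-- Bounded `f'` and `f''` transfer the decay of the derivatives of `Φ` to those of `f ∘ Φ`. The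
decay of `f ∘ Φ` itself depends on the value of `f` at `0`, so it is a separate hypothesis with its
own order `m`. -/
lemma JetDec.comp {s : ℝ} {k m : ℕ} {Φ : ℂ → ℝ} {D DD : ℂ → ℂ → ℝ} (h : JetDec s k Φ D DD)
    {f f' f'' : ℝ → ℝ} {J : Set ℝ} (hJ : ∀ z ∈ halfPlane s, Φ z ∈ J)
    (hf : ∀ t ∈ J, HasDerivAt f (f' t) t) (hf' : ∀ t ∈ J, HasDerivAt f' (f'' t) t)
    (hc : ContinuousOn f'' J) {C : ℝ} (hb' : ∀ t ∈ J, |f' t| ≤ C) (hb'' : ∀ t ∈ J, |f'' t| ≤ C)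
    (hmk : m ≤ k) (h0 : Dec s m (fun z => f (Φ z))) :
    JetDec s m (fun z => f (Φ z)) (fun e z => f' (Φ z) * D e z)
      (fun e z => f'' (Φ z) * D e z * D e z + f' (Φ z) * DD e z) := by
  have hcf' : ContinuousOn f' J := fun t ht => (hf' t ht).continuousAt.continuousWithinAt
  have d1 : Dec s 0 (fun z => f' (Φ z)) :=
    Dec.of_bdd (hcf'.comp h.dec0.cont hJ) fun z hz => hb' _ (hJ z hz)
  have d2 : Dec s 0 (fun z => f'' (Φ z)) :=
    Dec.of_bdd (hc.comp h.dec0.cont hJ) fun z hz => hb'' _ (hJ z hz)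
  have e1 : ∀ e, Dec s k (fun z => f' (Φ z) * D e z) := fun e => by
    simpa using d1.mul (h.dec1 e)
  have e2 : ∀ e, Dec s k (fun z => f'' (Φ z) * D e z * D e z) := fun e => by
    have := (d2.mul (h.dec1 e)).mul (h.dec1 e)
    exact this.mono (by omega)
  have e3 : ∀ e, Dec s k (fun z => f' (Φ z) * DD e z) := fun e => by
    simpa using d1.mul (h.dec2 e)
  refine ⟨fun e z hz => ⟨?_, ?_⟩, h0, fun e => (e1 e).mono hmk,
    fun e => ((e2 e).add (e3 e)).mono hmk⟩
  · have := (h.jet e z hz).1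
    have hz' : HasDerivAt f (f' (Φ z)) (Φ (z + (0 : ℝ) * e)) := by simpa using hf _ (hJ z hz)
    exact hz'.comp 0 this
  · have h1 := (h.jet e z hz).1
    have hz' : HasDerivAt f' (f'' (Φ z)) (Φ (z + (0 : ℝ) * e)) := by simpa using hf' _ (hJ z hz)
    have := (hz'.comp 0 h1).fun_mul (h.jet e z hz).2
    simpa using this

lemma HardyPlus.jetDec_re {s : ℝ} {F : ℂ → ℂ} (h : HardyPlus s F) :
    JetDec s 1 (fun z => (F z).re) (fun e z => (deriv F z * e).re)
      (fun e z => (deriv (deriv F) z * e * e).re) := by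
  have hmul : ∀ (e : ℂ) {φ : ℂ → ℂ}, Dec s 1 φ → Dec s 1 (fun z => φ z * e) := by
    intro e φ hφ
    simpa using hφ.mul (Dec.const e)
  refine ⟨fun e z hz => ⟨((h.hasDerivAt hz).complex_line e).complex_re,
    (((h.derivative.hasDerivAt hz).complex_line e).mul_const e).complex_re⟩, h.dec.re,
    fun e => (hmul e h.derivative.dec).re, fun e => (hmul e (hmul e h.derivative.derivative.dec)).re⟩

lemma HardyPlus.jetDec_im {s : ℝ} {F : ℂ → ℂ} (h : HardyPlus s F) :
    JetDec s 1 (fun z => (F z).im) (fun e z => (deriv F z * e).im)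
      (fun e z => (deriv (deriv F) z * e * e).im) := by
  have hmul : ∀ (e : ℂ) {φ : ℂ → ℂ}, Dec s 1 φ → Dec s 1 (fun z => φ z * e) := by
    intro e φ hφ
    simpa using hφ.mul (Dec.const e)
  refine ⟨fun e z hz => ⟨((h.hasDerivAt hz).complex_line e).complex_im,
    (((h.derivative.hasDerivAt hz).complex_line e).mul_const e).complex_im⟩, h.dec.im,
    fun e => (hmul e h.derivative.dec).im, fun e => (hmul e (hmul e h.derivative.derivative.dec)).im⟩

/-! ### Laplacians of regularized powers. -/

section Power
variable {s δ α : ℝ} {N : ℂ → ℝ} {D DD : ℂ → ℂ → ℝ}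

lemma hasDerivAt_add_rpow (hδ : 0 < δ) {t : ℝ} (ht : 0 ≤ t) (β : ℝ) :
    HasDerivAt (fun t => (t + δ) ^ β) (β * (t + δ) ^ (β - 1)) t := by
  have := ((hasDerivAt_id t).add_const δ).rpow_const (p := β) (Or.inl (by simp; linarith))
  simpa using this

lemma abs_add_rpow_le (hδ : 0 < δ) {t C : ℝ} (ht : 0 ≤ t) (htC : t ≤ C) (β : ℝ) :
    |(t + δ) ^ β| ≤ δ ^ β + (C + δ) ^ β := by
  rw [abs_of_nonneg (by positivity)]
  rcases le_total β 0 with hβ | hβ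
  · have h1 : (t + δ) ^ β ≤ δ ^ β := Real.rpow_le_rpow_of_nonpos hδ (by linarith) hβ
    have : 0 ≤ (C + δ) ^ β := Real.rpow_nonneg (by linarith) _
    linarith
  · have h1 : (t + δ) ^ β ≤ (C + δ) ^ β := Real.rpow_le_rpow (by linarith) (by linarith) hβ
    have : 0 ≤ δ ^ β := Real.rpow_nonneg hδ.le _
    linarith

lemma add_rpow_sub_le (hδ : 0 < δ) (hα0 : 0 ≤ α) (hα1 : α ≤ 1) {t : ℝ} (ht : 0 ≤ t) :
    (t + δ) ^ α - δ ^ α ≤ δ ^ (α - 1) * t := by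
  have h1 : t + δ = δ * (1 + t / δ) := by field_simp; ring
  have h2 := rpow_one_add_le_one_add_mul_self (s := t / δ) (p := α)
    (by have : 0 ≤ t / δ := by positivity
        linarith) hα0 hα1
  rw [h1, Real.mul_rpow hδ.le (by positivity), Real.rpow_sub_one hδ.ne']
  have h3 : 0 ≤ t / δ := by positivity
  have h4 : 0 < δ ^ α := Real.rpow_pos_of_pos hδ _
  have h5 : δ ^ α / δ * t = δ ^ α * (t / δ) := by field_simp
  rw [h5]
  nlinarith [mul_le_mul_of_nonneg_right hα1 h3]

lemma JetDec.rpow {k : ℕ} (h : JetDec s k N D DD) (hN : ∀ z ∈ halfPlane s, 0 ≤ N z) (hδ : 0 < δ)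
    {c : ℝ} {m : ℕ} (hmk : m ≤ k) (h0 : Dec s m (fun z => (N z + δ) ^ α - c)) :
    JetDec s m (fun z => (N z + δ) ^ α - c) (fun e z => α * (N z + δ) ^ (α - 1) * D e z)
      (fun e z => α * ((α - 1) * (N z + δ) ^ (α - 1 - 1)) * D e z * D e z +
        α * (N z + δ) ^ (α - 1) * DD e z) := by
  obtain ⟨C, hC, hb⟩ := h.dec0.exists_bound
  have hb1 : ∀ β : ℝ, ∀ t ∈ Set.Icc 0 C, |(t + δ) ^ β| ≤ δ ^ β + (C + δ) ^ β :=
    fun β t ht => abs_add_rpow_le hδ ht.1 ht.2 β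
  refine h.comp (J := Set.Icc 0 C) (f := fun t => (t + δ) ^ α - c)
    (f' := fun t => α * (t + δ) ^ (α - 1)) (f'' := fun t => α * ((α - 1) * (t + δ) ^ (α - 1 - 1)))
    (C := |α| * (δ ^ (α - 1) + (C + δ) ^ (α - 1)) +
      |α| * (|α - 1| * (δ ^ (α - 1 - 1) + (C + δ) ^ (α - 1 - 1)))) ?_ ?_ ?_ ?_ ?_ ?_ hmk h0
  · exact fun z hz => ⟨hN z hz, (le_abs_self _).trans (hb z hz)⟩
  · exact fun t ht => (hasDerivAt_add_rpow hδ ht.1 α).sub_const c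
  · exact fun t ht => (hasDerivAt_add_rpow hδ ht.1 (α - 1)).const_mul α
  · refine ContinuousOn.mul continuousOn_const (ContinuousOn.mul continuousOn_const ?_)
    exact fun t ht => (hasDerivAt_add_rpow hδ ht.1 (α - 1 - 1)).continuousAt.continuousWithinAt
  · intro t ht
    rw [abs_mul]
    have h1 := mul_le_mul_of_nonneg_left (hb1 (α - 1) t ht) (abs_nonneg α)
    have h2 : 0 ≤ |α| * (|α - 1| * (δ ^ (α - 1 - 1) + (C + δ) ^ (α - 1 - 1))) := by positivity
    linarith
  · intro t ht
    rw [abs_mul, abs_mul]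
    have h1 := mul_le_mul_of_nonneg_left (hb1 (α - 1 - 1) t ht) (abs_nonneg (α - 1))
    have h2 := mul_le_mul_of_nonneg_left h1 (abs_nonneg α)
    have h3 : 0 ≤ |α| * (δ ^ (α - 1) + (C + δ) ^ (α - 1)) := by positivity
    linarith

/-- By Bernoulli's inequality `t ↦ (t + δ)^α` rises at most linearly from its value at `0` when `α ≤
1`. Subtracting `δ^α` therefore preserves the decay of `N`, while `δ > 0` keeps the power smooth at
zeros. -/
lemma Dec.rpow_sub {k : ℕ} (h : Dec s k N) (hN : ∀ z ∈ halfPlane s, 0 ≤ N z) (hδ : 0 < δ)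
    (hα0 : 0 ≤ α) (hα1 : α ≤ 1) : Dec s k (fun z => (N z + δ) ^ α - δ ^ α) := by
  refine (h.const_mul (δ ^ (α - 1))).of_le ?_ fun z hz => ?_
  · refine (ContinuousOn.rpow_const (h.cont.add continuousOn_const) fun z hz => ?_).sub
      continuousOn_const
    have h0 := hN z hz
    exact Or.inl (show N z + δ ≠ 0 by positivity)
  · have h0 := hN z hz
    have h1 := add_rpow_sub_le hδ hα0 hα1 h0
    have h2 : δ ^ α ≤ (N z + δ) ^ α :=
      Real.rpow_le_rpow hδ.le (by linarith) hα0
    rw [Real.norm_of_nonneg (by linarith), Real.norm_eq_abs]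
    exact h1.trans (le_abs_self _)

end Power

/-- Regularized powers `(|F|² + δ)^α - δ^α` of a holomorphic function. -/
lemma HardyPlus.laplacePair_normSq {s δ α : ℝ} {F : ℂ → ℂ} (hF : HardyPlus s F) (hδ : 0 < δ)
    (hα0 : 0 ≤ α) (hα1 : α ≤ 1) :
    ∃ L, LaplacePair s (fun z => (‖F z‖ ^ 2 + δ) ^ α - δ ^ α) L ∧ ∀ z ∈ halfPlane s,
      4 * α ^ 2 * (‖F z‖ ^ 2 + δ) ^ (α - 1) * ‖deriv F z‖ ^ 2 ≤ L z ∧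
      L z ≤ 4 * α * (‖F z‖ ^ 2 + δ) ^ (α - 1) * ‖deriv F z‖ ^ 2 := by
  have hN := (hF.jetDec_re.mul hF.jetDec_re).add (hF.jetDec_im.mul hF.jetDec_im)
  have hN0 : ∀ z, 0 ≤ (F z).re * (F z).re + (F z).im * (F z).im := fun z => by
    nlinarith [mul_self_nonneg (F z).re, mul_self_nonneg (F z).im]
  have hnorm : ∀ z : ℂ, ‖z‖ ^ 2 = z.re * z.re + z.im * z.im := fun z => by
    rw [← Complex.normSq_eq_norm_sq, Complex.normSq_apply]
  have hL := (hN.rpow (α := α) (fun z _ => hN0 z) hδ (c := δ ^ α) le_rfl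
    (Dec.rpow_sub hN.dec0 (fun z _ => hN0 z) hδ hα0 hα1)).laplacePair
  refine ⟨_, by simpa only [hnorm] using hL, fun z hz => ?_⟩
  simp only [hnorm]
  have hn := hN0 z
  set n := (F z).re * (F z).re + (F z).im * (F z).im + δ with hn_def
  have hnpos : 0 < n := by rw [hn_def]; linarith
  have hpow : n ^ (α - 1 - 1) = n ^ (α - 1) / n := Real.rpow_sub_one hnpos.ne' _
  have hP : 0 < n ^ (α - 1) := Real.rpow_pos_of_pos hnpos _
  rw [hpow]
  simp only [mul_one, Complex.mul_re, Complex.mul_im, Complex.I_re, Complex.I_im, mul_zero,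
    zero_sub, add_zero]
  set P := n ^ (α - 1)
  set a := (F z).re
  set b := (F z).im
  set c := (deriv F z).re
  set d := (deriv F z).im
  set a2 := (deriv (deriv F) z).re
  set b2 := (deriv (deriv F) z).im
  -- By the Cauchy–Riemann equations the second derivatives of `F` cancel. The remaining Laplacian
  -- is `4 α P |F'|²` times `1 - (1 - α) |F|² / n`, and that last factor lies in `[α, 1]`.
  have hid : ∀ T : ℝ, T = α * P * (4 * (c * c + d * d)) +
      α * (α - 1) * (P / n) * (4 * (a * a + b * b) * (c * c + d * d)) →
      4 * α ^ 2 * P * (c * c + d * d) ≤ T ∧ T ≤ 4 * α * P * (c * c + d * d) := by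
    intro T hT
    have hab : (P / n) * (a * a + b * b) = P - P * (δ / n) := by
      have : a * a + b * b = n - δ := by rw [hn_def]; ring
      rw [this]
      field_simp
    have hT' : T = 4 * α * P * (c * c + d * d) +
        α * (α - 1) * (4 * (c * c + d * d)) * (P - P * (δ / n)) := by
      rw [hT, ← hab]; ring
    have hδn : 0 ≤ P * (δ / n) := by positivity
    have hδn' : P * (δ / n) ≤ P := by
      have : δ / n ≤ 1 := by rw [div_le_one hnpos, hn_def]; linarith
      nlinarith
    have hcd : 0 ≤ c * c + d * d := by nlinarith [mul_self_nonneg c, mul_self_nonneg d]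
    have hα : 0 ≤ α * (1 - α) := mul_nonneg hα0 (by linarith)
    have hk := mul_nonneg (mul_nonneg hα hcd) hδn
    have hk' := mul_nonneg (mul_nonneg hα hcd) (sub_nonneg.mpr hδn')
    constructor <;> rw [hT'] <;> nlinarith
  apply hid
  ring

/-- Regularized powers `(u² + δ)^α - δ^α` of the real part of a holomorphic function. -/
lemma HardyPlus.laplacePair_re {s δ α : ℝ} {F : ℂ → ℂ} (hF : HardyPlus s F) (hδ : 0 < δ)
    (hα0 : 0 ≤ α) (hα1 : α ≤ 1) :
    ∃ L, LaplacePair s (fun z => ((F z).re ^ 2 + δ) ^ α - δ ^ α) L ∧ ∀ z ∈ halfPlane s,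
      2 * α * (2 * α - 1) * ((F z).re ^ 2 + δ) ^ (α - 1) * ‖deriv F z‖ ^ 2 ≤ L z := by
  have hN := hF.jetDec_re.mul hF.jetDec_re
  have hN0 : ∀ z, 0 ≤ (F z).re * (F z).re := fun z => mul_self_nonneg _
  have hnorm : ∀ z : ℂ, ‖z‖ ^ 2 = z.re * z.re + z.im * z.im := fun z => by
    rw [← Complex.normSq_eq_norm_sq, Complex.normSq_apply]
  have hL := (hN.rpow (α := α) (fun z _ => hN0 z) hδ (c := δ ^ α) le_rfl
    (Dec.rpow_sub hN.dec0 (fun z _ => hN0 z) hδ hα0 hα1)).laplacePair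
  refine ⟨_, by simpa only [sq] using hL, fun z hz => ?_⟩
  simp only [hnorm]
  rw [sq ((F z).re)]
  have hn := hN0 z
  set n := (F z).re * (F z).re + δ with hn_def
  have hnpos : 0 < n := by rw [hn_def]; linarith
  have hpow : n ^ (α - 1 - 1) = n ^ (α - 1) / n := Real.rpow_sub_one hnpos.ne' _
  have hP : 0 < n ^ (α - 1) := Real.rpow_pos_of_pos hnpos _
  rw [hpow]
  simp only [mul_one, Complex.mul_re, Complex.mul_im, Complex.I_re, Complex.I_im, mul_zero,
    zero_sub, add_zero]
  set P := n ^ (α - 1)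
  set a := (F z).re
  set c := (deriv F z).re
  set d := (deriv F z).im
  set a2 := (deriv (deriv F) z).re
  set b2 := (deriv (deriv F) z).im
  -- Here the Laplacian is `2 α P |F'|²` times `1 - 2 (1 - α) u² / n`, and the last factor is at
  -- least `2α - 1` since `u² ≤ n`.
  have hid : ∀ T : ℝ, T = α * P * (2 * (c * c + d * d)) +
      α * (α - 1) * (P / n) * (4 * (a * a) * (c * c + d * d)) →
      2 * α * (2 * α - 1) * P * (c * c + d * d) ≤ T := by
    intro T hT
    have hab : (P / n) * (a * a) = P - P * (δ / n) := by
      have : a * a = n - δ := by rw [hn_def]; ring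
      rw [this]
      field_simp
    have hT' : T = 2 * α * P * (c * c + d * d) +
        α * (α - 1) * (4 * (c * c + d * d)) * (P - P * (δ / n)) := by
      rw [hT, ← hab]; ring
    have hδn : 0 ≤ P * (δ / n) := by positivity
    have hcd : 0 ≤ c * c + d * d := by nlinarith [mul_self_nonneg c, mul_self_nonneg d]
    have hα : 0 ≤ α * (1 - α) := mul_nonneg hα0 (by linarith)
    have hk := mul_nonneg (mul_nonneg hα hcd) hδn
    rw [hT']
    nlinarith
  apply hid
  ring

/-! ### The exponential weight. -/

/-- Put `ψ = u² + α log(|F|² + δ)`. Since `G` is holomorphic, the Laplacian of `exp(ψ) |G|²` is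
`exp(ψ) (|G|² Δψ + |2 ∂ψ G + 2 G'|²)`. The square is dropped, `Δψ` is `2 |∇u|²` plus the nonnegative
term `4 α δ |F'|² / (|F|² + δ)²`, and `X = exp(u²) ≥ 1` is bounded below by `1`. The hypothesis `hT`
is this identity in real coordinates, with `r = 1 / (|F|² + δ)`. -/
lemma weighted_laplacian_lower_bound {X P α r δ a b c d g h k l u v w T : ℝ} (hX : 1 ≤ X)
    (hP : 0 ≤ P) (hα : 0 ≤ α) (hr0 : 0 ≤ r) (hδ : 0 ≤ δ) (hr : r * (a * a + b * b) = 1 - r * δ)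
    (hT : T = X * P * ((g * g + h * h) * (2 * (v * v + w * w) +
      4 * α * (c * c + d * d) * r * (1 - r * (a * a + b * b))) +
      (((2 * u * v + α * r * (2 * (a * c + b * d))) * g
        + (-(2 * u * w) + α * r * (2 * (b * c - a * d))) * h + 2 * k) ^ 2 +
      ((2 * u * v + α * r * (2 * (a * c + b * d))) * h
        - (-(2 * u * w) + α * r * (2 * (b * c - a * d))) * g + 2 * l) ^ 2))) :
    2 * (v * v + w * w) * P * (g * g + h * h) ≤ T := by
  rw [hr, sub_sub_cancel] at hT
  have hm : 0 ≤ g * g + h * h := add_nonneg (mul_self_nonneg g) (mul_self_nonneg h)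
  have hcd : 0 ≤ c * c + d * d := add_nonneg (mul_self_nonneg c) (mul_self_nonneg d)
  have hvw : 0 ≤ v * v + w * w := add_nonneg (mul_self_nonneg v) (mul_self_nonneg w)
  have h1 : 0 ≤ (g * g + h * h) * (4 * α * (c * c + d * d) * r * (r * δ)) := by positivity
  have h5 : 0 ≤ (g * g + h * h) * (2 * (v * v + w * w)) := by positivity
  rw [hT]
  calc 2 * (v * v + w * w) * P * (g * g + h * h)
      = P * ((g * g + h * h) * (2 * (v * v + w * w))) := by ring
    _ ≤ X * P * ((g * g + h * h) * (2 * (v * v + w * w))) := by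
        gcongr
        exact le_mul_of_one_le_left hP hX
    _ ≤ _ := by
        gcongr
        rw [mul_add (g * g + h * h) (2 * (v * v + w * w)), add_assoc]
        refine le_add_of_nonneg_right (add_nonneg h1 (add_nonneg (sq_nonneg _) (sq_nonneg _)))

/-- The function `exp (u²) (|F|² + δ)^α |G|²`, `u = Re W`, has Laplacian at least
`2 |∇u|² (|F|² + δ)^α |G|²`. -/
lemma HardyPlus.laplacePair_exp {s δ α : ℝ} {W F G : ℂ → ℂ} (hW : HardyPlus s W)
    (hF : HardyPlus s F) (hG : HardyPlus s G) (hδ : 0 < δ) (hα0 : 0 ≤ α) :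
    ∃ L, LaplacePair s
      (fun z => Real.exp ((W z).re ^ 2) * (‖F z‖ ^ 2 + δ) ^ α * ‖G z‖ ^ 2) L ∧
      ∀ z ∈ halfPlane s,
        2 * ‖deriv W z‖ ^ 2 * (‖F z‖ ^ 2 + δ) ^ α * ‖G z‖ ^ 2 ≤ L z := by
  have hN := (hF.jetDec_re.mul hF.jetDec_re).add (hF.jetDec_im.mul hF.jetDec_im)
  have hM := (hG.jetDec_re.mul hG.jetDec_re).add (hG.jetDec_im.mul hG.jetDec_im)
  have hU := hW.jetDec_re.mul hW.jetDec_re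
  have hN0 : ∀ z, 0 ≤ (F z).re * (F z).re + (F z).im * (F z).im := fun z => by
    nlinarith [mul_self_nonneg (F z).re, mul_self_nonneg (F z).im]
  have hnorm : ∀ z : ℂ, ‖z‖ ^ 2 = z.re * z.re + z.im * z.im := fun z => by
    rw [← Complex.normSq_eq_norm_sq, Complex.normSq_apply]
  obtain ⟨C, hC, hb⟩ := hU.dec0.exists_bound
  have hbe : ∀ t ∈ Set.Icc (0 : ℝ) C, |Real.exp t| ≤ Real.exp C := fun t ht => by
    rw [abs_of_pos (Real.exp_pos t)]
    exact Real.exp_le_exp.mpr ht.2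
  have hUJ : ∀ z ∈ halfPlane s, (W z).re * (W z).re ∈ Set.Icc (0 : ℝ) C :=
    fun z hz => ⟨mul_self_nonneg _, (le_abs_self _).trans (hb z hz)⟩
  have hE := hU.comp (m := 0) (J := Set.Icc 0 C) (f := Real.exp) (f' := Real.exp)
    (f'' := Real.exp) hUJ (fun t _ => Real.hasDerivAt_exp t) (fun t _ => Real.hasDerivAt_exp t)
    Real.continuous_exp.continuousOn hbe hbe (Nat.zero_le _)
    (Dec.of_bdd (Real.continuous_exp.comp_continuousOn hU.dec0.cont)
      fun z hz => hbe _ (hUJ z hz))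
  obtain ⟨C', hC', hb'⟩ := hN.dec0.exists_bound
  have hP := hN.rpow (α := α) (fun z _ => hN0 z) hδ (c := 0) (m := 0) (Nat.zero_le _)
    (Dec.of_bdd (C := δ ^ α + (C' + δ) ^ α)
      ((ContinuousOn.rpow_const (hN.dec0.cont.add continuousOn_const) fun z _ =>
        Or.inl (by
          have h0 := hN0 z
          show (F z).re * (F z).re + (F z).im * (F z).im + δ ≠ 0
          positivity)).sub continuousOn_const)
      fun z hz => by
        rw [sub_zero]
        exact abs_add_rpow_le hδ (hN0 z) ((le_abs_self _).trans (hb' z hz)) α)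
  -- The exponential and the power are merely bounded; the quadratic decay comes entirely from
  -- `|G|²`, so no constant has to be subtracted from the power (`c = 0`).
  have hL := ((hE.mul hP).mul hM).laplacePair
  have hΦ : (fun z => Real.exp ((W z).re ^ 2) * (‖F z‖ ^ 2 + δ) ^ α * ‖G z‖ ^ 2) =
      fun z => Real.exp ((W z).re * (W z).re) *
        (((F z).re * (F z).re + (F z).im * (F z).im + δ) ^ α - 0) *
        ((G z).re * (G z).re + (G z).im * (G z).im) := by
    funext z
    rw [hnorm, hnorm, sq, sub_zero]
  rw [hΦ]
  refine ⟨_, hL, fun z hz => ?_⟩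
  simp only [hnorm]
  have hn := hN0 z
  set n := (F z).re * (F z).re + (F z).im * (F z).im + δ with hn_def
  have hnpos : 0 < n := by rw [hn_def]; linarith
  have hpow1 : n ^ (α - 1) = n ^ α * n⁻¹ := Real.rpow_sub_one hnpos.ne' _
  have hpow2 : n ^ (α - 1 - 1) = n ^ α * n⁻¹ * n⁻¹ := by
    rw [Real.rpow_sub_one hnpos.ne' (α - 1), hpow1, div_eq_mul_inv]
  have hP : 0 < n ^ α := Real.rpow_pos_of_pos hnpos _
  rw [hpow2, hpow1]
  simp only [mul_one, Complex.mul_re, Complex.mul_im, Complex.I_re, Complex.I_im, mul_zero,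
    zero_sub, add_zero, sub_zero]
  have hE1 : 1 ≤ Real.exp ((W z).re * (W z).re) := Real.one_le_exp (mul_self_nonneg _)
  set X := Real.exp ((W z).re * (W z).re)
  set P := n ^ α
  have hr : n⁻¹ * ((F z).re * (F z).re + (F z).im * (F z).im) = 1 - n⁻¹ * δ := by
    have : (F z).re * (F z).re + (F z).im * (F z).im = n - δ := by rw [hn_def]; ring
    rw [this, mul_sub, inv_mul_cancel₀ hnpos.ne']
  have hr0 : 0 < n⁻¹ := inv_pos.mpr hnpos
  set r := n⁻¹
  set a := (F z).re
  set b := (F z).im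
  set c := (deriv F z).re
  set d := (deriv F z).im
  set a2 := (deriv (deriv F) z).re
  set b2 := (deriv (deriv F) z).im
  set g := (G z).re
  set h := (G z).im
  set k := (deriv G z).re
  set l := (deriv G z).im
  set g2 := (deriv (deriv G) z).re
  set h2 := (deriv (deriv G) z).im
  set u := (W z).re
  set v := (deriv W z).re
  set w := (deriv W z).im
  set v2 := (deriv (deriv W) z).re
  set w2 := (deriv (deriv W) z).im
  refine weighted_laplacian_lower_bound (X := X) (P := P) (α := α) (r := r) (δ := δ) (a := a) (b := b)
    (c := c) (d := d) (g := g) (h := h) (k := k) (l := l) (u := u) (v := v) (w := w)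
    hE1 hP.le hα0 hr0.le hδ.le hr ?_
  ring

/-! ### M. Riesz' inequality for exponents at most two. -/

section RealLine
variable {E : Type*} [NormedAddCommGroup E] {s : ℝ} {k : ℕ} {φ : ℂ → E}

lemma Dec.continuous_real (h : Dec s k φ) (hs : 0 < s) : Continuous fun x : ℝ => φ x := by
  simpa using h.continuous_line (y := 0) (by linarith)

lemma Dec.integrable_real (h : Dec s 2 φ) (hs : 0 < s) : Integrable fun x : ℝ => φ x := by
  simpa using h.integrable_line (y := 0) (by linarith)

lemma ofReal_mem_halfPlane (hs : 0 < s) (x : ℝ) : (x : ℂ) ∈ halfPlane s := by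
  simpa [halfPlane] using hs

lemma Dec.integrable_rpow (h : Dec s 1 φ) (hs : 0 < s) {p : ℝ} (hp : 1 < p) :
    Integrable fun x : ℝ => ‖φ x‖ ^ p := by
  obtain ⟨C, hC, hb⟩ := h.bound
  have hint : Integrable fun x : ℝ => C ^ p * (1 + ‖x‖) ^ (-p) :=
    (integrable_one_add_norm (by simpa using hp)).const_mul _
  refine hint.mono' ?_ (Eventually.of_forall fun x => ?_)
  · exact ((h.continuous_real hs).norm.rpow_const
      fun x => Or.inr (by linarith)).aestronglyMeasurable
  · rw [Real.norm_of_nonneg (by positivity)]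
    have h1 := hb x (ofReal_mem_halfPlane hs x)
    rw [pow_one] at h1
    calc ‖φ x‖ ^ p ≤ (C / (1 + ‖(x : ℂ)‖)) ^ p := by gcongr
      _ = C ^ p * (1 + ‖x‖) ^ (-p) := by
          rw [Real.div_rpow hC (by positivity), Real.rpow_neg (by positivity), div_eq_mul_inv,
            Complex.norm_real]

end RealLine

lemma sq_rpow_half {x : ℝ} (hx : 0 ≤ x) (p : ℝ) : (x ^ 2) ^ (p / 2) = x ^ p := by
  rw [← Real.rpow_natCast, ← Real.rpow_mul hx]
  congr 1
  push_cast
  ring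

/-- M. Riesz' inequality for `1 < p ≤ 2`: a holomorphic function in the half-plane is controlled
by its real part. -/
theorem HardyPlus.integral_rpow_le {s p : ℝ} (hs : 0 < s) (hp1 : 1 < p) (hp2 : p ≤ 2) {F : ℂ → ℂ}
    (hF : HardyPlus s F) :
    ∫ x : ℝ, ‖F x‖ ^ p ≤ 2 / (p - 1) * ∫ x : ℝ, |(F x).re| ^ p := by
  have hα0 : 0 ≤ p / 2 := by linarith
  have hα1 : p / 2 ≤ 1 := by linarith
  have hintF := hF.dec.integrable_rpow hs hp1
  have hintu : Integrable fun x : ℝ => |(F x).re| ^ p := hF.dec.re.integrable_rpow hs hp1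
  have hreg : ∀ t : ℝ, 0 ≤ t → ∀ δ : ℝ, 0 < δ →
      0 ≤ (t ^ 2 + δ) ^ (p / 2) - δ ^ (p / 2) ∧
        (t ^ 2 + δ) ^ (p / 2) - δ ^ (p / 2) ≤ t ^ p := by
    intro t ht δ hδ
    have h1 := Real.rpow_add_le_add_rpow (sq_nonneg t) hδ.le hα0 hα1
    have h2 : δ ^ (p / 2) ≤ (t ^ 2 + δ) ^ (p / 2) :=
      Real.rpow_le_rpow hδ.le (by nlinarith) hα0
    rw [sq_rpow_half ht] at h1
    constructor <;> linarith
  have key : ∀ δ : ℝ, 0 < δ → ∫ x : ℝ, ((‖F x‖ ^ 2 + δ) ^ (p / 2) - δ ^ (p / 2)) ≤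
      2 / (p - 1) * ∫ x : ℝ, |(F x).re| ^ p := by
    intro δ hδ
    obtain ⟨L₁, h1, hL1⟩ := hF.laplacePair_normSq hδ hα0 hα1
    obtain ⟨L₂, h2, hL2⟩ := hF.laplacePair_re hδ hα0 hα1
    have hp1' : 0 < p - 1 := by linarith
    have hpos := ((h2.const_mul (2 / (p - 1))).add (h1.const_mul (-1))).integral_nonneg hs
      fun z hz => by
        have a1 := (hL1 z hz).2
        have a2 := hL2 z hz
        -- The exponent `p/2 - 1` is nonpositive, so replacing `|F|` by the smaller `|Re F|`
        -- increases the weight. The constant `2 / (p - 1)` is the ratio of `2p`, from `|F|^p`, to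
        -- `p(p - 1)`, from `|u|^p`.
        have hle : (‖F z‖ ^ 2 + δ) ^ (p / 2 - 1) ≤ ((F z).re ^ 2 + δ) ^ (p / 2 - 1) := by
          apply Real.rpow_le_rpow_of_nonpos (by positivity) _ (by linarith)
          have h3 := Complex.abs_re_le_norm (F z)
          have h4 := sq_abs (F z).re
          nlinarith [abs_nonneg (F z).re, pow_le_pow_left₀ (abs_nonneg (F z).re) h3 2]
        have a3 : 4 * (p / 2) * (‖F z‖ ^ 2 + δ) ^ (p / 2 - 1) * ‖deriv F z‖ ^ 2 ≤
            4 * (p / 2) * ((F z).re ^ 2 + δ) ^ (p / 2 - 1) * ‖deriv F z‖ ^ 2 := by gcongr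
        have a4 : 4 * (p / 2) * ((F z).re ^ 2 + δ) ^ (p / 2 - 1) * ‖deriv F z‖ ^ 2 =
            2 / (p - 1) * (2 * (p / 2) * (2 * (p / 2) - 1) *
              ((F z).re ^ 2 + δ) ^ (p / 2 - 1) * ‖deriv F z‖ ^ 2) := by
          field_simp
          ring
        have a5 := mul_le_mul_of_nonneg_left a2 (show 0 ≤ 2 / (p - 1) by positivity)
        linarith
    obtain ⟨_, _, _, _, d1, -⟩ := h1
    obtain ⟨_, _, _, _, d2, -⟩ := h2
    have i1 := d1.integrable_real hs
    have i2 := d2.integrable_real hs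
    rw [integral_add (i2.const_mul _) (i1.const_mul _), integral_const_mul, integral_const_mul]
      at hpos
    have hle : ∫ x : ℝ, (((F x).re ^ 2 + δ) ^ (p / 2) - δ ^ (p / 2)) ≤
        ∫ x : ℝ, |(F x).re| ^ p := by
      refine integral_mono i2 hintu fun x => ?_
      have := (hreg |(F x).re| (abs_nonneg _) δ hδ).2
      rwa [sq_abs] at this
    have := mul_le_mul_of_nonneg_left hle (show 0 ≤ 2 / (p - 1) by positivity)
    linarith
  have hlim : Tendsto (fun δ : ℝ => ∫ x : ℝ, ((‖F x‖ ^ 2 + δ) ^ (p / 2) - δ ^ (p / 2)))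
      (𝓝[>] 0) (𝓝 (∫ x : ℝ, ‖F x‖ ^ p)) := by
    refine tendsto_integral_filter_of_dominated_convergence (fun x : ℝ => ‖F x‖ ^ p) ?_ ?_ hintF ?_
    · filter_upwards [self_mem_nhdsWithin] with δ (hδ : 0 < δ)
      have hc := (hF.dec.continuous_real hs).norm
      exact (((hc.pow 2).add continuous_const).rpow_const fun x => Or.inr hα0).sub
        continuous_const |>.aestronglyMeasurable
    · filter_upwards [self_mem_nhdsWithin] with δ (hδ : 0 < δ)
      refine Eventually.of_forall fun x => ?_
      have := hreg ‖F x‖ (norm_nonneg _) δ hδ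
      rw [Real.norm_of_nonneg this.1]
      exact this.2
    · refine Eventually.of_forall fun x => ?_
      have hc : Continuous fun δ : ℝ => (‖F x‖ ^ 2 + δ) ^ (p / 2) - δ ^ (p / 2) :=
        ((continuous_const.add continuous_id).rpow_const fun x => Or.inr hα0).sub
          (continuous_id.rpow_const fun x => Or.inr hα0)
      have := (hc.tendsto 0).mono_left (nhdsWithin_le_nhds (s := Set.Ioi 0))
      simp only [add_zero] at this
      rwa [Real.zero_rpow (by linarith), sub_zero, sq_rpow_half (norm_nonneg _)] at this
  refine le_of_tendsto hlim ?_
  filter_upwards [self_mem_nhdsWithin] with δ hδ using key δ hδ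

/-! ### The trilinear estimate. -/

lemma HasDerivAt.complex_conj {f : ℝ → ℂ} {f' : ℂ} {t : ℝ} (h : HasDerivAt f f' t) :
    HasDerivAt (fun t => starRingEnd ℂ (f t)) (starRingEnd ℂ f') t :=
  (Complex.conjCLE.toContinuousLinearMap.hasFDerivAt.comp_hasDerivAt t h)

/-- The Laplacian of `Re (θ V̄ h)` is `-4 Re (θ V̄'' h)` up to horizontal derivatives. -/
lemma HardyPlus.laplacePair_conj_mul {s : ℝ} {V h h1 h2 : ℂ → ℂ} (hV : HardyPlus s V)
    (hd0 : ∀ z ∈ halfPlane s, HasDerivAt h (h1 z) z)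
    (hd1 : ∀ z ∈ halfPlane s, HasDerivAt h1 (h2 z) z)
    (b0 : Dec s 2 h) (b1 : Dec s 2 h1) (b2 : Dec s 2 h2) (θ : ℂ) :
    LaplacePair s (fun z => (θ * (starRingEnd ℂ (V z) * h z)).re)
      (fun z => (-4 * (θ * (starRingEnd ℂ (deriv (deriv V) z) * h z))).re) := by
  have v0 : Dec s 0 fun z => starRingEnd ℂ (V z) := (hV.dec.conj).mono (Nat.zero_le _)
  have v1 : Dec s 0 fun z => starRingEnd ℂ (deriv V z) :=
    (hV.derivative.dec.conj).mono (Nat.zero_le _)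
  have v2 : Dec s 0 fun z => starRingEnd ℂ (deriv (deriv V) z) :=
    (hV.derivative.derivative.dec.conj).mono (Nat.zero_le _)
  have m : ∀ {φ ψ : ℂ → ℂ}, Dec s 0 φ → Dec s 2 ψ → Dec s 2 (fun z => φ z * ψ z) := by
    intro φ ψ hφ hψ
    simpa using hφ.mul hψ
  have c0 : ∀ e, ∀ z ∈ halfPlane s, HasDerivAt (fun t : ℝ => starRingEnd ℂ (V (z + t * e)))
      (starRingEnd ℂ (deriv V z * e)) 0 := fun e z hz =>
    ((hV.hasDerivAt hz).complex_line e).complex_conj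
  have c1 : ∀ e, ∀ z ∈ halfPlane s, HasDerivAt (fun t : ℝ => starRingEnd ℂ (deriv V (z + t * e)))
      (starRingEnd ℂ (deriv (deriv V) z * e)) 0 := fun e z hz =>
    ((hV.derivative.hasDerivAt hz).complex_line e).complex_conj
  -- For `Φ = Re(θ V̄ h)` one has `ΔΦ = 4 Re(θ V̄' h')` and `V̄' h' = (V̄' h)_x - V̄'' h`. Hence the
  -- field `E` is `Φ_x - 4 Re(θ V̄' h)`, which explains the coefficient `-3`.
  refine ⟨fun z => (θ * (-Complex.I * (starRingEnd ℂ (deriv V z) * h z) +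
      Complex.I * (starRingEnd ℂ (V z) * h1 z))).re,
    fun z => (θ * (-(starRingEnd ℂ (deriv (deriv V) z) * h z) +
      2 * (starRingEnd ℂ (deriv V z) * h1 z) - (starRingEnd ℂ (V z) * h2 z))).re,
    fun z => (θ * (-3 * (starRingEnd ℂ (deriv V z) * h z) + starRingEnd ℂ (V z) * h1 z)).re,
    fun z => (θ * (-3 * (starRingEnd ℂ (deriv (deriv V) z) * h z) +
      -2 * (starRingEnd ℂ (deriv V z) * h1 z) + starRingEnd ℂ (V z) * h2 z)).re,
    ?_, ?_, ?_, ?_, ?_, ?_, ?_, ?_, ?_⟩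
  · exact ((m v0 b0).const_mul θ).re
  · exact ((((m v1 b0).const_mul _).add ((m v0 b1).const_mul _)).const_mul θ).re
  · exact ((((m v2 b0).neg.add ((m v1 b1).const_mul _)).sub (m v0 b2)).const_mul θ).re
  · exact ((((m v1 b0).const_mul _).add (m v0 b1)).const_mul θ).re
  · exact (((((m v2 b0).const_mul _).add ((m v1 b1).const_mul _)).add (m v0 b2)).const_mul θ).re
  · intro z hz
    have := (((c0 Complex.I z hz).fun_mul ((hd0 z hz).complex_line Complex.I)).const_mul
      θ).complex_re
    convert this using 2
    simp only [Complex.ofReal_zero, zero_mul, add_zero, map_mul, Complex.conj_I]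
    ring
  · intro z hz
    have e1 := ((c1 Complex.I z hz).fun_mul ((hd0 z hz).complex_line Complex.I)).const_mul
      (-Complex.I)
    have e2 := ((c0 Complex.I z hz).fun_mul ((hd1 z hz).complex_line Complex.I)).const_mul
      (Complex.I)
    have := ((e1.fun_add e2).const_mul θ).complex_re
    convert this using 2
    simp only [Complex.ofReal_zero, zero_mul, add_zero, map_mul, Complex.conj_I]
    linear_combination (-θ * (starRingEnd ℂ (deriv (deriv V) z) * h z) +
      2 * θ * (starRingEnd ℂ (deriv V z) * h1 z) - θ * (starRingEnd ℂ (V z) * h2 z)) *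
      Complex.I_mul_I
  · intro z hz
    have e1 := ((c1 1 z hz).fun_mul ((hd0 z hz).complex_line 1)).const_mul (-3)
    have e2 := (c0 1 z hz).fun_mul ((hd1 z hz).complex_line 1)
    have := ((e1.fun_add e2).const_mul θ).complex_re
    convert this using 2
    simp only [Complex.ofReal_zero, zero_mul, add_zero, map_mul, map_one]
    ring
  · intro z hz
    simp only [← Complex.add_re]
    congr 1
    ring

/-- Weighted Young inequality with weights `(2 - p)/p` and `2/q`, which add up to `1` exactly
because `p` and `q` are conjugate; the weights themselves, at most `1`, are discarded. -/
lemma rpow_mul_sq_le {p q x y : ℝ} (hpq : p.HolderConjugate q) (hp2 : p ≤ 2) (hx : 0 ≤ x)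
    (hy : 0 ≤ y) : x ^ (2 - p) * y ^ 2 ≤ x ^ p + y ^ q := by
  have hp := hpq.pos
  have hq := hpq.symm.pos
  have h1 : p⁻¹ + q⁻¹ = 1 := hpq.inv_add_inv_eq_one
  have hw : (2 - p) / p + 2 / q = 1 := by
    rw [sub_div, div_self hp.ne', div_eq_mul_inv, div_eq_mul_inv]
    linarith
  have := Real.geom_mean_le_arith_mean2_weighted (w₁ := (2 - p) / p) (w₂ := 2 / q)
    (div_nonneg (by linarith) hp.le) (by positivity)
    (Real.rpow_nonneg hx p) (Real.rpow_nonneg hy q) hw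
  rw [← Real.rpow_mul hx, ← Real.rpow_mul hy, mul_div_cancel₀ _ hp.ne',
    mul_div_cancel₀ _ hq.ne', Real.rpow_two] at this
  refine this.trans (add_le_add ?_ ?_)
  · refine mul_le_of_le_one_left (Real.rpow_nonneg hx p) ?_
    have : 0 ≤ 2 / q := by positivity
    linarith
  · refine mul_le_of_le_one_left (Real.rpow_nonneg hy q) ?_
    have : 0 ≤ (2 - p) / p := div_nonneg (by linarith) hp.le
    linarith

/-- The main trilinear estimate for Hardy functions. -/
theorem HardyPlus.norm_integral_conj_mul_deriv_mul_le {s p q : ℝ} (hs : 0 < s)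
    (hpq : p.HolderConjugate q) (hp2 : p ≤ 2) {V F G : ℂ → ℂ} (hV : HardyPlus s V)
    (hF : HardyPlus s F) (hG : HardyPlus s G) (hu : ∀ x : ℝ, |(2 * deriv V x).re| ≤ 1) :
    ‖∫ x : ℝ, starRingEnd ℂ (V x) * (deriv F x * G x)‖ ≤
      6 * ((∫ x : ℝ, ‖F x‖ ^ p) + ∫ x : ℝ, ‖G x‖ ^ q) := by
  have hp1 : 1 < p := hpq.lt
  have hq1 : 1 < q := hpq.symm.lt
  have hα0 : 0 ≤ p / 2 := by linarith
  have hα1 : p / 2 ≤ 1 := by linarith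
  have hF1 := hF.derivative
  have hF2 := hF1.derivative
  have hF3 := hF2.derivative
  have hG1 := hG.derivative
  have hG2 := hG1.derivative
  have hpair := fun θ => hV.laplacePair_conj_mul
    (h := fun z => deriv F z * G z)
    (h1 := fun z => deriv (deriv F) z * G z + deriv F z * deriv G z)
    (h2 := fun z => (deriv (deriv (deriv F)) z * G z + deriv (deriv F) z * deriv G z) +
      (deriv (deriv F) z * deriv G z + deriv F z * deriv (deriv G) z))
    (fun z hz => (hF1.hasDerivAt hz).fun_mul (hG.hasDerivAt hz))
    (fun z hz => ((hF2.hasDerivAt hz).fun_mul (hG.hasDerivAt hz)).fun_add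
      ((hF1.hasDerivAt hz).fun_mul (hG1.hasDerivAt hz)))
    (hF1.dec.mul hG.dec) ((hF2.dec.mul hG.dec).add (hF1.dec.mul hG1.dec))
    (((hF3.dec.mul hG.dec).add (hF2.dec.mul hG1.dec)).add
      ((hF2.dec.mul hG1.dec).add (hF1.dec.mul hG2.dec))) θ
  have hintF := hF.dec.integrable_rpow hs hp1
  have hintG := hG.dec.integrable_rpow hs hq1
  have hintG2 : Integrable fun x : ℝ => ‖G x‖ ^ 2 := by
    simpa using hG.dec.integrable_rpow hs one_lt_two
  set A := ∫ x : ℝ, ‖F x‖ ^ p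
  set B := ∫ x : ℝ, ‖G x‖ ^ q
  set J := ∫ x : ℝ, starRingEnd ℂ (V x) * (deriv F x * G x)
  have hA : 0 ≤ A := integral_nonneg fun x => by positivity
  have hB : 0 ≤ B := integral_nonneg fun x => by positivity
  have he : Real.exp 1 < 3 := Real.exp_one_lt_three
  have key : ∀ δ : ℝ, 0 < δ →
      ‖J‖ ≤ A + 3 * (A + B + δ ^ (1 - p / 2) * ∫ x : ℝ, ‖G x‖ ^ 2) := by
    intro δ hδ
    -- The phase turns the integral into `-‖J‖`, so nonnegativity of the total boundary integral
    -- becomes an upper bound for `‖J‖`.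
    obtain ⟨θ, hθ, hθJ⟩ : ∃ θ : ℂ, ‖θ‖ ≤ 1 ∧ θ * J = -(‖J‖ : ℂ) := by
      by_cases hJ : J = 0
      · exact ⟨0, by simp, by simp [hJ]⟩
      · refine ⟨-(starRingEnd ℂ J) / ‖J‖, by simp [hJ], ?_⟩
        have : (‖J‖ : ℂ) ≠ 0 := by simpa using hJ
        field_simp
        rw [Complex.conj_mul']
    obtain ⟨L₁, h1, hL1⟩ := hF.laplacePair_normSq hδ hα0 hα1
    -- The weight is built on `W = 2 V'`, whose real part on the real line is the derivative of `2
    -- Re V`. Thus `|W'|² = 4 |V''|²`.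
    obtain ⟨L₂, h2, hL2⟩ := (hV.derivative.const_mul 2).laplacePair_exp hF hG hδ
      (show 0 ≤ 1 - p / 2 by linarith)
    have hpos := ((h1.add h2).add (hpair θ)).integral_nonneg hs fun z hz => by
      have a1 := (hL1 z hz).1
      have a2 := hL2 z hz
      have hn : 0 < ‖F z‖ ^ 2 + δ := by positivity
      rw [deriv_const_mul_field, norm_mul] at a2
      have hprod : (‖F z‖ ^ 2 + δ) ^ (p / 2 - 1) * (‖F z‖ ^ 2 + δ) ^ (1 - p / 2) = 1 := by
        rw [← Real.rpow_add hn]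
        simp
      have hP := Real.rpow_pos_of_pos hn (p / 2 - 1)
      have hQ := Real.rpow_pos_of_pos hn (1 - p / 2)
      set P := (‖F z‖ ^ 2 + δ) ^ (p / 2 - 1)
      set Q := (‖F z‖ ^ 2 + δ) ^ (1 - p / 2)
      set v := ‖deriv (deriv V) z‖
      set f := ‖deriv F z‖
      set g := ‖G z‖
      have hv : 0 ≤ v := norm_nonneg _
      have hf : 0 ≤ f := norm_nonneg _
      have hg : 0 ≤ g := norm_nonneg _
      have a3 : -(4 * (v * (f * g))) ≤
          (-4 * (θ * (starRingEnd ℂ (deriv (deriv V) z) * (deriv F z * G z)))).re := by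
        have h3 := Complex.abs_re_le_norm
          (-4 * (θ * (starRingEnd ℂ (deriv (deriv V) z) * (deriv F z * G z))))
        have h4 : ‖-4 * (θ * (starRingEnd ℂ (deriv (deriv V) z) * (deriv F z * G z)))‖ ≤
            4 * (v * (f * g)) := by
          simp only [norm_mul, norm_neg, RCLike.norm_conj]
          rw [show ‖(4 : ℂ)‖ = 4 by simp]
          have : ‖θ‖ * (v * (f * g)) ≤ v * (f * g) :=
            mul_le_of_le_one_left (by positivity) hθ
          linarith
        exact (abs_le.mp (h3.trans h4)).1
      rw [show ‖(2 : ℂ)‖ = 2 by simp] at a2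
      have a4 : 0 ≤ P * f ^ 2 * (4 * (p / 2) ^ 2 - 1) := by
        have : 0 ≤ 4 * (p / 2) ^ 2 - 1 := by nlinarith
        positivity
      -- Since `P Q = 1`, the difference of the two sides is the square `P (f - 2 v g Q)²`.
      have a5 : 4 * (v * (f * g)) ≤ P * f ^ 2 + 4 * (v ^ 2 * g ^ 2 * Q) := by
        have h5 : (v * (f * g)) = (v * g * Q) * (f * P) := by
          calc v * (f * g) = v * (f * g) * (P * Q) := by rw [hprod, mul_one]
            _ = _ := by ring
        have h6 : P * f ^ 2 + 4 * (v ^ 2 * g ^ 2 * Q) - 4 * (v * (f * g)) =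
            P * (f - 2 * (v * g * Q)) ^ 2 := by
          rw [h5]
          linear_combination (-4 * v ^ 2 * g ^ 2 * Q + 4 * v ^ 2 * g ^ 2 * Q * 0) * hprod
        have h7 : 0 ≤ P * (f - 2 * (v * g * Q)) ^ 2 := by positivity
        linarith
      have a6 : 0 ≤ v ^ 2 * g ^ 2 * Q := by positivity
      nlinarith
    obtain ⟨_, _, _, _, d1, -⟩ := h1
    obtain ⟨_, _, _, _, d2, -⟩ := h2
    obtain ⟨_, _, _, _, d3, -⟩ := hpair θ
    have i1 := d1.integrable_real hs
    have i2 := d2.integrable_real hs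
    have i3 := d3.integrable_real hs
    rw [integral_add (i1.fun_add i2) i3, integral_add i1 i2] at hpos
    have hJre : ∫ x : ℝ, (θ * (starRingEnd ℂ (V x) * (deriv F x * G x))).re = -‖J‖ := by
      have hintJ : Integrable fun x : ℝ => starRingEnd ℂ (V x) * (deriv F x * G x) := by
        have hdec : Dec s 2 fun z => starRingEnd ℂ (V z) * (deriv F z * G z) := by
          simpa using (hV.dec.conj.mono (Nat.zero_le 1)).mul (hF1.dec.mul hG.dec)
        exact hdec.integrable_real hs
      have h3 : ∫ x : ℝ, (θ * (starRingEnd ℂ (V x) * (deriv F x * G x))).re =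
        (∫ x : ℝ, θ * (starRingEnd ℂ (V x) * (deriv F x * G x))).re :=
        integral_re (hintJ.const_mul θ)
      rw [h3, integral_const_mul, hθJ]
      simp
    rw [hJre] at hpos
    have e1 : ∫ x : ℝ, ((‖F x‖ ^ 2 + δ) ^ (p / 2) - δ ^ (p / 2)) ≤ A := by
      refine integral_mono i1 hintF fun x => ?_
      have h1 := Real.rpow_add_le_add_rpow (sq_nonneg ‖F x‖) hδ.le hα0 hα1
      rw [sq_rpow_half (norm_nonneg _)] at h1
      simp only
      linarith
    have e2 : ∫ x : ℝ, Real.exp ((2 * deriv V x).re ^ 2) * (‖F x‖ ^ 2 + δ) ^ (1 - p / 2) *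
        ‖G x‖ ^ 2 ≤ 3 * (A + B + δ ^ (1 - p / 2) * ∫ x : ℝ, ‖G x‖ ^ 2) := by
      have hR : 3 * (A + B + δ ^ (1 - p / 2) * ∫ x : ℝ, ‖G x‖ ^ 2) =
          ∫ x : ℝ, 3 * ((‖F x‖ ^ p + ‖G x‖ ^ q) + δ ^ (1 - p / 2) * ‖G x‖ ^ 2) := by
        rw [integral_const_mul, integral_add (hintF.fun_add hintG) (hintG2.const_mul _),
          integral_add hintF hintG, integral_const_mul]
      rw [hR]
      refine integral_mono i2 (((hintF.fun_add hintG).fun_add (hintG2.const_mul _)).const_mul 3)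
        fun x => ?_
      simp only
      have h1 := Real.rpow_add_le_add_rpow (p := 1 - p / 2) (sq_nonneg ‖F x‖) hδ.le
        (by linarith) (by linarith)
      have h2 : (‖F x‖ ^ 2) ^ (1 - p / 2) = ‖F x‖ ^ (2 - p) := by
        rw [show 1 - p / 2 = (2 - p) / 2 by ring, sq_rpow_half (norm_nonneg _)]
      rw [h2] at h1
      have h3 := rpow_mul_sq_le hpq hp2 (norm_nonneg (F x)) (norm_nonneg (G x))
      -- The bound on `Re(2 V')` is used only here, on the boundary; no bound inside the half-plane
      -- is required.
      have h4 : Real.exp ((2 * deriv V x).re ^ 2) ≤ 3 := by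
        refine le_trans (Real.exp_le_exp.mpr ?_) he.le
        rw [← sq_abs]
        have := hu x
        have h0 := abs_nonneg (2 * deriv V x).re
        nlinarith
      have h5 := mul_le_mul_of_nonneg_right h1 (sq_nonneg ‖G x‖)
      rw [mul_assoc]
      refine mul_le_mul h4 ?_ (by positivity) (by norm_num)
      linarith
    linarith
  -- For `p < 2` the error `δ^(1 - p/2)` vanishes as `δ → 0`. For `p = 2` it equals `1`, and the
  -- extra term is `B` itself; both cases fit the constant `6`.
  rcases eq_or_lt_of_le hp2 with rfl | hlt
  · have hq : q = 2 := by
      have := hpq.inv_add_inv_eq_one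
      have h1 : q⁻¹ = 2⁻¹ := by linarith
      exact inv_inj.mp h1
    subst hq
    have := key 1 one_pos
    have hB2 : ∫ x : ℝ, ‖G x‖ ^ 2 = B := by simp [B]
    rw [hB2, Real.one_rpow] at this
    linarith
  · have hlim : Tendsto (fun δ : ℝ => A + 3 * (A + B + δ ^ (1 - p / 2) * ∫ x : ℝ, ‖G x‖ ^ 2))
        (𝓝[>] 0) (𝓝 (A + 3 * (A + B + 0 ^ (1 - p / 2) * ∫ x : ℝ, ‖G x‖ ^ 2))) := by
      have hc : Continuous fun δ : ℝ => A + 3 * (A + B + δ ^ (1 - p / 2) * ∫ x : ℝ, ‖G x‖ ^ 2) := by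
        have : Continuous fun δ : ℝ => δ ^ (1 - p / 2) :=
          continuous_id.rpow_const fun x => Or.inr (by linarith)
        fun_prop
      exact (hc.tendsto 0).mono_left nhdsWithin_le_nhds
    have := ge_of_tendsto hlim (by
      filter_upwards [self_mem_nhdsWithin] with δ hδ using key δ hδ)
    rw [Real.zero_rpow (by linarith)] at this
    linarith

/-! ### Cauchy integrals and Poisson means. -/

/-- The Cauchy integral of `φ` at height `s` above `z`. -/
noncomputable def cauchyExt (φ : ℝ → ℝ) (s : ℝ) (z : ℂ) : ℂ :=
  (2 * Real.pi * Complex.I)⁻¹ * ∫ t : ℝ, (φ t : ℂ) / ((t : ℂ) - z - s * Complex.I)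

/-- The Poisson mean of `φ` at height `s`. -/
noncomputable def poissonMean (φ : ℝ → ℝ) (s x : ℝ) : ℝ :=
  Real.pi⁻¹ * ∫ τ : ℝ, φ (x + s * τ) * (1 + τ ^ 2)⁻¹

section CauchyExt
variable {φ : ℝ → ℝ} {s : ℝ}

lemma half_le_norm_sub {z : ℂ} (hz : z ∈ halfPlane (s / 2)) (t : ℝ) :
    s / 2 ≤ ‖(t : ℂ) - z - s * Complex.I‖ := by
  have h1 := Complex.abs_im_le_norm ((t : ℂ) - z - s * Complex.I)
  have h2 : -(s / 2) < z.im := hz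
  simp only [Complex.sub_im, Complex.ofReal_im, Complex.mul_im, Complex.ofReal_re, Complex.I_im,
    Complex.I_re, mul_one, mul_zero, add_zero, zero_sub] at h1
  have h3 := neg_le_abs (-z.im - s)
  linarith

lemma hasDerivAt_cauchyExt (hφ : Continuous φ) (hφ' : HasCompactSupport φ) (hs : 0 < s) {z : ℂ}
    (hz : z ∈ halfPlane (s / 2)) :
    HasDerivAt (cauchyExt φ s) ((2 * Real.pi * Complex.I)⁻¹ *
      ∫ t : ℝ, (φ t : ℂ) / ((t : ℂ) - z - s * Complex.I) ^ 2) z := by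
  have hne : ∀ w ∈ halfPlane (s / 2), ∀ t : ℝ, (t : ℂ) - w - s * Complex.I ≠ 0 := by
    intro w hw t h0
    have := half_le_norm_sub hw t
    rw [h0, norm_zero] at this
    linarith
  have hint : Integrable φ := hφ.integrable_of_hasCompactSupport hφ'
  have hcont : ∀ w ∈ halfPlane (s / 2), ∀ k : ℕ,
      Continuous fun t : ℝ => (φ t : ℂ) / ((t : ℂ) - w - s * Complex.I) ^ k := by
    intro w hw k
    refine Continuous.div (by fun_prop) (by fun_prop) fun t => pow_ne_zero k (hne w hw t)
  refine HasDerivAt.const_mul _ ?_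
  refine (hasDerivAt_integral_of_dominated_loc_of_deriv_le (s := halfPlane (s / 2))
    (F := fun (z : ℂ) (t : ℝ) => (φ t : ℂ) / ((t : ℂ) - z - s * Complex.I))
    (F' := fun (z : ℂ) (t : ℝ) => (φ t : ℂ) / ((t : ℂ) - z - s * Complex.I) ^ 2)
    (bound := fun t => |φ t| * ((s / 2) ^ 2)⁻¹) ((isOpen_halfPlane _).mem_nhds hz) ?_ ?_ ?_ ?_ ?_
    ?_).2
  · filter_upwards [(isOpen_halfPlane _).mem_nhds hz] with w hw
    simpa using (hcont w hw 1).aestronglyMeasurable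
  · refine (hint.abs.mul_const (s / 2)⁻¹).mono' (by
      simpa using (hcont z hz 1).aestronglyMeasurable) (Eventually.of_forall fun t => ?_)
    rw [norm_div, Complex.norm_real, div_eq_mul_inv, Real.norm_eq_abs]
    have := half_le_norm_sub hz t
    gcongr
  · exact (hcont z hz 2).aestronglyMeasurable
  · refine Eventually.of_forall fun t w hw => ?_
    rw [norm_div, Complex.norm_real, div_eq_mul_inv, Real.norm_eq_abs, norm_pow]
    have := half_le_norm_sub hw t
    gcongr
  · exact hint.abs.mul_const _
  · refine Eventually.of_forall fun t w hw => ?_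
    have h1 : HasDerivAt (fun w : ℂ => (t : ℂ) - w - s * Complex.I) (-1) w := by
      simpa using ((hasDerivAt_id w).const_sub (t : ℂ)).sub_const (s * Complex.I)
    have h2 := (hasDerivAt_const w (φ t : ℂ)).fun_div h1 (hne w hw t)
    simpa using h2

/-- The singularities lie on `Im z = -s`, outside `Im z > -s/2`, and compact support of `φ` gives
decay `1/|z|`. -/
lemma hardyPlus_cauchyExt (hφ : Continuous φ) (hφ' : HasCompactSupport φ) (hs : 0 < s) :
    HardyPlus (s / 4) (cauchyExt φ s) := by
  have hint : Integrable φ := hφ.integrable_of_hasCompactSupport hφ'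
  have hd : DifferentiableOn ℂ (cauchyExt φ s) (halfPlane (s / 2)) := fun z hz =>
    (hasDerivAt_cauchyExt hφ hφ' hs hz).differentiableAt.differentiableWithinAt
  -- With `w = t - z - i s` one has `1 + |z| ≤ |w| + (1 + |t| + s)` and `|w| ≥ s/2`, so this weight
  -- dominates `(1 + |z|) / |w|`.
  have hint2 : Integrable fun t => |φ t| * (1 + (1 + |t| + s) * (2 / s)) := by
    refine Continuous.integrable_of_hasCompactSupport (by fun_prop) ?_
    exact (hφ'.comp_left (g := fun x : ℝ => |x|) abs_zero).mul_right
  refine ⟨s / 2, by linarith, hd, hd.continuousOn, ‖(2 * Real.pi * Complex.I : ℂ)⁻¹‖ *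
    ∫ t, |φ t| * (1 + (1 + |t| + s) * (2 / s)), ?_, fun z hz => ?_⟩
  · refine mul_nonneg (norm_nonneg _) (integral_nonneg fun t => ?_)
    simp only [Pi.zero_apply]
    positivity
  · rw [cauchyExt, norm_mul, mul_div_assoc]
    gcongr
    rw [pow_one, ← integral_div]
    refine norm_integral_le_of_norm_le (hint2.div_const _) (Eventually.of_forall fun t => ?_)
    rw [norm_div, Complex.norm_real, Real.norm_eq_abs, mul_div_assoc, div_eq_mul_inv]
    gcongr
    have h1 := half_le_norm_sub hz t
    set w := (t : ℂ) - z - s * Complex.I with hw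
    have hw0 : 0 < ‖w‖ := by linarith
    have h2 : ‖z‖ ≤ ‖w‖ + |t| + s := by
      have hzw : z = t - w - s * Complex.I := by rw [hw]; ring
      have h3 := norm_sub_le ((t : ℂ) - w) (s * Complex.I)
      have h4 := norm_sub_le (t : ℂ) w
      rw [← hzw] at h3
      have h5 : ‖(s : ℂ) * Complex.I‖ = s := by simp [abs_of_pos hs]
      rw [Complex.norm_real, Real.norm_eq_abs] at h4
      linarith
    have hz0 : 0 < 1 + ‖z‖ := by positivity
    rw [inv_le_iff_one_le_mul₀ hw0, div_mul_eq_mul_div, one_le_div hz0]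
    have h6 : (1 + |t| + s) ≤ (1 + |t| + s) * (2 / s) * ‖w‖ := by
      have : 1 ≤ 2 / s * ‖w‖ := by
        rw [div_mul_eq_mul_div, one_le_div hs]; linarith
      have h7 : 0 ≤ 1 + |t| + s := by positivity
      nlinarith
    nlinarith

lemma integral_comp_add_mul {g : ℝ → ℝ} (hs : 0 < s) (x : ℝ) :
    ∫ τ : ℝ, g (x + s * τ) = s⁻¹ * ∫ t, g t := by
  have h1 := Measure.integral_comp_mul_left (fun y => g (x + y)) s
  rw [h1, integral_add_left_eq_self, abs_of_pos (inv_pos.mpr hs), smul_eq_mul]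

/-- The real part of the Cauchy kernel at height `s` is half the Poisson kernel; rescaling `t = x +
s τ` gives the normalization of `poissonMean`. -/
lemma two_mul_re_cauchyExt (hφ : Continuous φ) (hφ' : HasCompactSupport φ) (hs : 0 < s) (x : ℝ) :
    2 * (cauchyExt φ s x).re = poissonMean φ s x := by
  have hint : Integrable fun t : ℝ => (φ t : ℂ) / ((t : ℂ) - x - s * Complex.I) := by
    have hx : (x : ℂ) ∈ halfPlane (s / 2) := ofReal_mem_halfPlane (by linarith) x
    refine ((hφ.integrable_of_hasCompactSupport hφ').abs.mul_const (s / 2)⁻¹).mono' ?_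
      (Eventually.of_forall fun t => ?_)
    · refine (Continuous.div (by fun_prop) (by fun_prop) fun t h0 => ?_).aestronglyMeasurable
      have := half_le_norm_sub hx t
      rw [h0, norm_zero] at this
      linarith
    · rw [norm_div, Complex.norm_real, div_eq_mul_inv, Real.norm_eq_abs]
      have := half_le_norm_sub hx t
      gcongr
  have h1 : (cauchyExt φ s x).re = (2 * Real.pi)⁻¹ *
      ∫ t : ℝ, ((φ t : ℂ) / ((t : ℂ) - x - s * Complex.I)).im := by
    have him : ∫ t : ℝ, ((φ t : ℂ) / ((t : ℂ) - x - s * Complex.I)).im =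
      (∫ t : ℝ, (φ t : ℂ) / ((t : ℂ) - x - s * Complex.I)).im := integral_im hint
    rw [him, cauchyExt, mul_inv, Complex.inv_I]
    have : ((2 : ℂ) * Real.pi)⁻¹ = (((2 * Real.pi)⁻¹ : ℝ) : ℂ) := by push_cast; rfl
    rw [this, mul_assoc, Complex.re_ofReal_mul]
    simp
  have h2 : ∀ t : ℝ, ((φ t : ℂ) / ((t : ℂ) - x - s * Complex.I)).im =
      φ t * (s / ((t - x) ^ 2 + s ^ 2)) := by
    intro t
    rw [div_eq_mul_inv, Complex.im_ofReal_mul, Complex.inv_im]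
    simp [Complex.normSq_apply]
    left
    ring
  have h3 := integral_comp_add_mul (g := fun t => φ t * (s / ((t - x) ^ 2 + s ^ 2))) hs x
  have h4 : ∀ τ : ℝ, φ (x + s * τ) * (s / ((x + s * τ - x) ^ 2 + s ^ 2)) =
      s⁻¹ * (φ (x + s * τ) * (1 + τ ^ 2)⁻¹) := by
    intro τ
    have : 0 < 1 + τ ^ 2 := by positivity
    rw [show (x + s * τ - x) ^ 2 + s ^ 2 = s ^ 2 * (1 + τ ^ 2) by ring]
    field_simp
  simp_rw [h4, integral_const_mul] at h3
  have h5 : ∫ τ : ℝ, φ (x + s * τ) * (1 + τ ^ 2)⁻¹ =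
      ∫ t, φ t * (s / ((t - x) ^ 2 + s ^ 2)) := by
    have hs' : s⁻¹ ≠ 0 := inv_ne_zero hs.ne'
    exact mul_left_cancel₀ hs' h3
  rw [h1, poissonMean, h5, ← mul_assoc, mul_inv, mul_inv_cancel_left₀ two_ne_zero]
  simp_rw [h2]

end CauchyExt

section PoissonMean
variable {φ : ℝ → ℝ} {s : ℝ}

lemma integrable_poisson_integrand (hφ : Continuous φ) {M : ℝ} (hM : ∀ x, |φ x| ≤ M) (s x : ℝ) :
    Integrable fun τ : ℝ => φ (x + s * τ) * (1 + τ ^ 2)⁻¹ := by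
  refine (integrable_inv_one_add_sq.const_mul M).mono' ?_ (Eventually.of_forall fun τ => ?_)
  · refine Continuous.aestronglyMeasurable ((by fun_prop : Continuous fun τ => φ (x + s * τ)).mul
      (Continuous.inv₀ (by fun_prop) fun τ => ?_))
    positivity
  · rw [norm_mul, Real.norm_of_nonneg (by positivity : (0 : ℝ) ≤ (1 + τ ^ 2)⁻¹)]
    gcongr
    exact hM _

lemma pi_inv_mul_integral : Real.pi⁻¹ * ∫ τ : ℝ, (1 + τ ^ 2)⁻¹ = 1 := by
  rw [integral_univ_inv_one_add_sq, inv_mul_cancel₀ Real.pi_ne_zero]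

/-- An average of translates keeps the Lipschitz constant exactly. Hence the normalization `|A'| ≤
1` survives the regularization. -/
lemma abs_poissonMean_sub_le (hφ : Continuous φ) {M : ℝ} (hM : ∀ x, |φ x| ≤ M) {K : ℝ}
    (hK : ∀ x y, |φ x - φ y| ≤ K * |x - y|) (x y : ℝ) :
    |poissonMean φ s x - poissonMean φ s y| ≤ K * |x - y| := by
  rw [poissonMean, poissonMean, ← mul_sub, ← integral_sub
    (integrable_poisson_integrand hφ hM s x) (integrable_poisson_integrand hφ hM s y), abs_mul,
    abs_of_pos (inv_pos.mpr Real.pi_pos)]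
  have h1 : |∫ τ : ℝ, (φ (x + s * τ) * (1 + τ ^ 2)⁻¹ - φ (y + s * τ) * (1 + τ ^ 2)⁻¹)| ≤
      ∫ τ : ℝ, K * |x - y| * (1 + τ ^ 2)⁻¹ := by
    rw [← Real.norm_eq_abs]
    refine norm_integral_le_of_norm_le (integrable_inv_one_add_sq.const_mul _)
      (Eventually.of_forall fun τ => ?_)
    rw [← sub_mul, norm_mul, Real.norm_of_nonneg (by positivity : (0 : ℝ) ≤ (1 + τ ^ 2)⁻¹)]
    gcongr
    have := hK (x + s * τ) (y + s * τ)
    rwa [add_sub_add_right_eq_sub] at this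
  calc _ ≤ Real.pi⁻¹ * ∫ τ : ℝ, K * |x - y| * (1 + τ ^ 2)⁻¹ := by
        gcongr
    _ = K * |x - y| * (Real.pi⁻¹ * ∫ τ : ℝ, (1 + τ ^ 2)⁻¹) := by
        rw [integral_const_mul]; ring
    _ = _ := by rw [pi_inv_mul_integral, mul_one]

lemma tendsto_poissonMean (hφ : Continuous φ) {M : ℝ} (hM : ∀ x, |φ x| ≤ M) (x : ℝ) :
    Tendsto (fun s => poissonMean φ s x) (𝓝[>] 0) (𝓝 (φ x)) := by
  have h1 : Tendsto (fun s => ∫ τ : ℝ, φ (x + s * τ) * (1 + τ ^ 2)⁻¹) (𝓝[>] 0)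
      (𝓝 (∫ τ : ℝ, φ x * (1 + τ ^ 2)⁻¹)) := by
    refine tendsto_integral_filter_of_dominated_convergence (fun τ => M * (1 + τ ^ 2)⁻¹) ?_ ?_
      (integrable_inv_one_add_sq.const_mul M) ?_
    · exact Eventually.of_forall fun s => (integrable_poisson_integrand hφ hM s x).1
    · refine Eventually.of_forall fun s => Eventually.of_forall fun τ => ?_
      rw [norm_mul, Real.norm_of_nonneg (by positivity : (0 : ℝ) ≤ (1 + τ ^ 2)⁻¹)]
      gcongr
      exact hM _
    · refine Eventually.of_forall fun τ => Tendsto.mul_const _ ?_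
      have hc : Continuous fun s : ℝ => φ (x + s * τ) := by fun_prop
      have := (hc.tendsto 0).mono_left (nhdsWithin_le_nhds (s := Set.Ioi 0))
      simpa using this
  have h2 := h1.const_mul Real.pi⁻¹
  rw [integral_const_mul, mul_left_comm, pi_inv_mul_integral, mul_one] at h2
  exact h2

/-- The bound is uniform in `s ≤ 1`; it serves as the dominating function when `s → 0`. -/
lemma exists_abs_poissonMean_le (hφ : Continuous φ) (hφ' : HasCompactSupport φ) :
    ∃ C, 0 ≤ C ∧ ∀ s, 0 < s → s ≤ 1 → ∀ x, |poissonMean φ s x| ≤ C * (1 + x ^ 2)⁻¹ := by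
  have hint : Integrable φ := hφ.integrable_of_hasCompactSupport hφ'
  obtain ⟨M, hM⟩ := hφ.bounded_above_of_compact_support hφ'
  obtain ⟨N, hN⟩ := (show Continuous fun t => (1 + t ^ 2) * φ t by
    fun_prop).bounded_above_of_compact_support (hφ'.mul_left)
  have hN0 : 0 ≤ N := (norm_nonneg _).trans (hN 0)
  set I := ∫ t, |φ t|
  have hI : 0 ≤ I := integral_nonneg fun t => abs_nonneg _
  refine ⟨2 * N + Real.pi⁻¹ * (2 * I), by positivity, fun s hs hs1 x => ?_⟩
  have hx : 0 < 1 + x ^ 2 := by positivity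
  rw [← div_eq_mul_inv, le_div_iff₀ hx, poissonMean, abs_mul, abs_of_pos (inv_pos.mpr Real.pi_pos)]
  have hg : Integrable fun τ : ℝ => |φ (x + s * τ)| := by
    have : Integrable fun y : ℝ => |φ (x + y)| := hint.abs.comp_add_left x
    exact this.comp_mul_left' hs.ne'
  have h1 : |∫ τ : ℝ, φ (x + s * τ) * (1 + τ ^ 2)⁻¹| * (1 + x ^ 2) ≤
      ∫ τ : ℝ, (2 * N * (1 + τ ^ 2)⁻¹ + 2 * s ^ 2 * |φ (x + s * τ)|) := by
    rw [← abs_of_pos hx, ← abs_mul, ← integral_mul_const, ← Real.norm_eq_abs]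
    refine norm_integral_le_of_norm_le ((integrable_inv_one_add_sq.const_mul _).add
      (hg.const_mul _)) (Eventually.of_forall fun τ => ?_)
    rw [Real.norm_eq_abs, abs_mul, abs_mul, abs_of_pos hx]
    have hτ : 0 < 1 + τ ^ 2 := by positivity
    rw [abs_of_pos (inv_pos.mpr hτ)]
    have h2 := hN (x + s * τ)
    rw [Real.norm_eq_abs, abs_mul, abs_of_pos (by positivity : 0 < 1 + (x + s * τ) ^ 2)] at h2
    -- Splitting `x` as `(x + s τ) - s τ`: the first part is absorbed by the decay of `φ`, the
    -- second by the Poisson kernel, leaving `s² ∫ |φ(x + s τ)| dτ = s ∫ |φ|`.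
    have h3 : 1 + x ^ 2 ≤ 2 * (1 + (x + s * τ) ^ 2) + 2 * s ^ 2 * τ ^ 2 := by
      nlinarith [sq_nonneg (x + 2 * (s * τ))]
    have ha := abs_nonneg (φ (x + s * τ))
    set a := |φ (x + s * τ)|
    have h4 : τ ^ 2 * (1 + τ ^ 2)⁻¹ ≤ 1 := by
      rw [← div_eq_mul_inv, div_le_one hτ]; linarith
    calc a * (1 + τ ^ 2)⁻¹ * (1 + x ^ 2)
        ≤ a * (1 + τ ^ 2)⁻¹ * (2 * (1 + (x + s * τ) ^ 2) + 2 * s ^ 2 * τ ^ 2) := by gcongr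
      _ = 2 * ((1 + (x + s * τ) ^ 2) * a) * (1 + τ ^ 2)⁻¹ +
          2 * s ^ 2 * a * (τ ^ 2 * (1 + τ ^ 2)⁻¹) := by ring
      _ ≤ 2 * N * (1 + τ ^ 2)⁻¹ + 2 * s ^ 2 * a * 1 := by gcongr
      _ = _ := by ring
  rw [integral_add (integrable_inv_one_add_sq.const_mul _) (hg.const_mul _), integral_const_mul,
    integral_const_mul, integral_comp_add_mul (g := fun y => |φ y|) hs x] at h1
  calc Real.pi⁻¹ * |∫ τ : ℝ, φ (x + s * τ) * (1 + τ ^ 2)⁻¹| * (1 + x ^ 2)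
      = Real.pi⁻¹ * (|∫ τ : ℝ, φ (x + s * τ) * (1 + τ ^ 2)⁻¹| * (1 + x ^ 2)) := by ring
    _ ≤ Real.pi⁻¹ * (2 * N * (∫ τ : ℝ, (1 + τ ^ 2)⁻¹) + 2 * s ^ 2 * (s⁻¹ * I)) := by gcongr
    _ = 2 * N * (Real.pi⁻¹ * ∫ τ : ℝ, (1 + τ ^ 2)⁻¹) + Real.pi⁻¹ * (2 * I * s) := by
        field_simp
    _ ≤ _ := by
        rw [pi_inv_mul_integral, mul_one]
        have : 2 * I * s ≤ 2 * I := by nlinarith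
        gcongr

end PoissonMean

/-! ### M. Riesz' inequality for exponents at least two, by duality. -/

/-- Young's inequality with the factors `1/p`, `1/q` dropped. The free parameter `l` is there to
make one term small enough to be absorbed. -/
lemma mul_le_weighted_rpow {p q : ℝ} (hpq : p.HolderConjugate q) {l : ℝ} (hl : 0 < l) {a b : ℝ}
    (ha : 0 ≤ a) (hb : 0 ≤ b) : a * b ≤ l ^ p * a ^ p + l⁻¹ ^ q * b ^ q := by
  have h := Real.young_inequality_of_nonneg (a := l * a) (b := l⁻¹ * b) (by positivity)
    (by positivity) hpq
  rw [Real.mul_rpow hl.le ha, Real.mul_rpow (by positivity) hb] at h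
  have h1 : l * a * (l⁻¹ * b) = a * b := by field_simp
  rw [h1] at h
  refine h.trans (add_le_add ?_ ?_)
  · exact div_le_self (by positivity) hpq.lt.le
  · exact div_le_self (by positivity) hpq.symm.lt.le

lemma mul_le_add_rpow {p q : ℝ} (hpq : p.HolderConjugate q) {a b : ℝ}
    (ha : 0 ≤ a) (hb : 0 ≤ b) : a * b ≤ a ^ p + b ^ q := by
  simpa using mul_le_weighted_rpow hpq one_pos ha hb

lemma add_rpow_le_two_rpow {q : ℝ} (hq : 0 ≤ q) {a b : ℝ} (ha : 0 ≤ a) (hb : 0 ≤ b) :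
    (a + b) ^ q ≤ 2 ^ q * (a ^ q + b ^ q) := by
  rcases le_total a b with h | h
  · calc (a + b) ^ q ≤ (2 * b) ^ q := by gcongr; linarith
      _ = 2 ^ q * b ^ q := Real.mul_rpow two_pos.le hb
      _ ≤ _ := by gcongr; linarith [Real.rpow_nonneg ha q]
  · calc (a + b) ^ q ≤ (2 * a) ^ q := by gcongr; linarith
      _ = 2 ^ q * a ^ q := Real.mul_rpow two_pos.le ha
      _ ≤ _ := by gcongr; linarith [Real.rpow_nonneg hb q]

/-- A continuous cut-off function equal to `1` on `[1 - n, n - 1]`. -/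
noncomputable def cutoff (n x : ℝ) : ℝ := max 0 (min 1 (n - |x|))

lemma continuous_cutoff (n : ℝ) : Continuous (cutoff n) := by
  unfold cutoff; fun_prop

lemma cutoff_nonneg (n x : ℝ) : 0 ≤ cutoff n x := le_max_left _ _

lemma cutoff_le_one (n x : ℝ) : cutoff n x ≤ 1 := max_le zero_le_one (min_le_left _ _)

lemma cutoff_eq_one {n x : ℝ} (h : |x| + 1 ≤ n) : cutoff n x = 1 := by
  rw [cutoff, min_eq_left (by linarith), max_eq_right zero_le_one]

lemma hasCompactSupport_cutoff (n : ℝ) : HasCompactSupport (cutoff n) := by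
  refine HasCompactSupport.of_support_subset_isCompact (isCompact_Icc (a := -n) (b := n)) ?_
  intro x hx
  by_contra h
  apply hx
  rw [cutoff, max_eq_left]
  refine (min_le_right _ _).trans ?_
  have : n < |x| := by
    by_contra! h'
    exact h (abs_le.mp h')
  linarith

lemma tendsto_integral_mul_poissonMean {φ v : ℝ → ℝ} (hφ : Continuous φ)
    (hφ' : HasCompactSupport φ) (hv : Continuous v) {M : ℝ} (hM : ∀ x, |v x| ≤ M) :
    Tendsto (fun s => ∫ x, v x * poissonMean φ s x) (𝓝[>] 0) (𝓝 (∫ x, v x * φ x)) := by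
  obtain ⟨C, hC, hb⟩ := exists_abs_poissonMean_le hφ hφ'
  obtain ⟨N, hN⟩ := hφ.bounded_above_of_compact_support hφ'
  have hM0 : 0 ≤ M := (abs_nonneg _).trans (hM 0)
  refine tendsto_integral_filter_of_dominated_convergence (fun x => M * (C * (1 + x ^ 2)⁻¹)) ?_ ?_
    ((integrable_inv_one_add_sq.const_mul C).const_mul M) ?_
  · filter_upwards [self_mem_nhdsWithin] with s (hs : 0 < s)
    have hc : Continuous (poissonMean φ s) := by
      have h1 : poissonMean φ s = fun x : ℝ => 2 * (cauchyExt φ s x).re :=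
        funext fun x => (two_mul_re_cauchyExt hφ hφ' hs x).symm
      rw [h1]
      exact continuous_const.mul
        ((hardyPlus_cauchyExt hφ hφ' hs).dec.re.continuous_real (by linarith))
    exact (hv.mul hc).aestronglyMeasurable
  · filter_upwards [Ioc_mem_nhdsGT one_pos] with s hs
    refine Eventually.of_forall fun x => ?_
    rw [norm_mul]
    exact mul_le_mul (hM x) (hb s hs.1 hs.2 x) (norm_nonneg _) hM0
  · exact Eventually.of_forall fun x => (tendsto_poissonMean hφ hN x).const_mul _

lemma tendsto_integral_poissonMean_rpow {φ : ℝ → ℝ} (hφ : Continuous φ)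
    (hφ' : HasCompactSupport φ) {p : ℝ} (hp : 1 < p) :
    Tendsto (fun s => ∫ x, |poissonMean φ s x| ^ p) (𝓝[>] 0) (𝓝 (∫ x, |φ x| ^ p)) := by
  obtain ⟨C, hC, hb⟩ := exists_abs_poissonMean_le hφ hφ'
  obtain ⟨N, hN⟩ := hφ.bounded_above_of_compact_support hφ'
  refine tendsto_integral_filter_of_dominated_convergence (fun x => C ^ p * (1 + x ^ 2)⁻¹) ?_ ?_
    (integrable_inv_one_add_sq.const_mul _) ?_
  · filter_upwards [self_mem_nhdsWithin] with s (hs : 0 < s)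
    have hc : Continuous (poissonMean φ s) := by
      have h1 : poissonMean φ s = fun x : ℝ => 2 * (cauchyExt φ s x).re :=
        funext fun x => (two_mul_re_cauchyExt hφ hφ' hs x).symm
      rw [h1]
      exact continuous_const.mul
        ((hardyPlus_cauchyExt hφ hφ' hs).dec.re.continuous_real (by linarith))
    exact (hc.abs.rpow_const fun x => Or.inr (by linarith)).aestronglyMeasurable
  · filter_upwards [Ioc_mem_nhdsGT one_pos] with s hs
    refine Eventually.of_forall fun x => ?_
    rw [Real.norm_of_nonneg (by positivity)]
    have hx : 0 < 1 + x ^ 2 := by positivity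
    calc |poissonMean φ s x| ^ p ≤ (C * (1 + x ^ 2)⁻¹) ^ p := by
          gcongr
          exact hb s hs.1 hs.2 x
      _ = C ^ p * ((1 + x ^ 2)⁻¹) ^ p := Real.mul_rpow hC (by positivity)
      _ ≤ C ^ p * ((1 + x ^ 2)⁻¹) ^ (1 : ℝ) := by
          refine mul_le_mul_of_nonneg_left ?_ (Real.rpow_nonneg hC p)
          refine Real.rpow_le_rpow_of_exponent_ge (by positivity) ?_ hp.le
          exact inv_le_one_of_one_le₀ (by nlinarith [sq_nonneg x])
      _ = _ := by rw [Real.rpow_one]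
  · refine Eventually.of_forall fun x => ?_
    exact ((tendsto_poissonMean hφ hN x).abs).rpow_const (Or.inr (by linarith))

lemma HardyPlus.anti {s s' : ℝ} {F : ℂ → ℂ} (h : HardyPlus s F) (hs : s' ≤ s) :
    HardyPlus s' F := by
  obtain ⟨r, hr, h⟩ := h
  exact ⟨r, by linarith, h⟩

/-- The imaginary part of Cauchy's theorem for the product `G K`: conjugation is skew-adjoint, so an
estimate for one exponent passes to the dual one. -/
lemma HardyPlus.integral_im_mul_eq {s : ℝ} (hs : 0 < s) {G K : ℂ → ℂ} (hG : HardyPlus s G)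
    (hK : HardyPlus s K) :
    ∫ x : ℝ, (G x).im * (K x).re = -∫ x : ℝ, (G x).re * (K x).im := by
  have h0 := integral_eq_zero_of_holomorphic hs (hG.diff.mul hK.diff) (hG.dec.mul hK.dec)
  have hint := (hG.dec.mul hK.dec).integrable_real hs
  have h1 : ∫ x : ℝ, (G x * K x).im = (∫ x : ℝ, G x * K x).im := integral_im hint
  have h0' : ∫ x : ℝ, G x * K x = 0 := h0
  rw [h0', Complex.zero_im] at h1
  simp_rw [Complex.mul_im] at h1
  rw [integral_add ((hG.dec.re.mul hK.dec.im).integrable_real hs)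
    ((hG.dec.im.mul hK.dec.re).integrable_real hs)] at h1
  linarith

/-- Dual form of M. Riesz' inequality, tested against `φ ∈ C_c`. -/
lemma HardyPlus.integral_im_mul_le {p q : ℝ} (hpq : p.HolderConjugate q)
    (hp2 : p ≤ 2) {s : ℝ} (hs : 0 < s) {G : ℂ → ℂ} (hG : HardyPlus s G) {φ : ℝ → ℝ}
    (hφ : Continuous φ) (hφ' : HasCompactSupport φ) {l : ℝ} (hl : 0 < l) :
    ∫ x : ℝ, (G x).im * φ x ≤ 2 * (l ^ p * (2 / (p - 1)) * ∫ x, |φ x| ^ p) +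
      2 * (l⁻¹ ^ q * ∫ x : ℝ, |(G x).re| ^ q) := by
  have hp1 := hpq.lt
  have hp10 : 0 < p - 1 := by linarith
  obtain ⟨M, hM0, hM⟩ := hG.dec.exists_bound
  have hlim := tendsto_integral_mul_poissonMean hφ hφ' (hG.dec.im.continuous_real hs) (M := M)
    fun x => (Complex.abs_im_le_norm _).trans (hM _ (ofReal_mem_halfPlane hs x))
  have hlim2 := (((tendsto_integral_poissonMean_rpow hφ hφ' hp1).const_mul
    (l ^ p * (2 / (p - 1)))).const_mul 2).add_const (2 * (l⁻¹ ^ q * ∫ x : ℝ, |(G x).re| ^ q))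
  refine le_of_tendsto_of_tendsto hlim hlim2 ?_
  filter_upwards [self_mem_nhdsWithin] with r (hr : 0 < r)
  have hm : 0 < min s (r / 4) := lt_min hs (by linarith)
  have hG' := hG.anti (min_le_left s (r / 4))
  have hK := (hardyPlus_cauchyExt hφ hφ' hr).anti (min_le_right s (r / 4))
  set K := cauchyExt φ r
  have h1 : ∫ x : ℝ, (G x).im * poissonMean φ r x = 2 * ∫ x : ℝ, (G x).im * (K x).re := by
    rw [← integral_const_mul]
    congr 1
    funext x
    rw [← two_mul_re_cauchyExt hφ hφ' hr]
    ring
  have i1 : Integrable fun x : ℝ => ‖K x‖ ^ p := hK.dec.integrable_rpow hm hp1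
  have i2 : Integrable fun x : ℝ => |(G x).re| ^ q := hG.dec.re.integrable_rpow hs hpq.symm.lt
  have h2 : -∫ x : ℝ, (G x).re * (K x).im ≤
      l ^ p * (∫ x : ℝ, ‖K x‖ ^ p) + l⁻¹ ^ q * ∫ x : ℝ, |(G x).re| ^ q := by
    rw [← integral_neg, ← integral_const_mul, ← integral_const_mul,
      ← integral_add (i1.const_mul _) (i2.const_mul _)]
    refine integral_mono ((hG'.dec.re.mul hK.dec.im).integrable_real hm).neg
      ((i1.const_mul _).add (i2.const_mul _)) fun x => ?_
    have h3 := mul_le_weighted_rpow hpq hl (norm_nonneg (K x)) (abs_nonneg (G x).re)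
    refine le_trans ?_ h3
    refine (neg_le_abs _).trans ?_
    rw [abs_mul, mul_comm]
    gcongr
    exact Complex.abs_im_le_norm _
  have h4 : ∫ x : ℝ, ‖K x‖ ^ p ≤ 2 / (p - 1) * ∫ x : ℝ, |poissonMean φ r x| ^ p := by
    refine (hK.integral_rpow_le hm hp1 hp2).trans ?_
    have i3 : Integrable fun x : ℝ => |poissonMean φ r x| ^ p := by
      have : Integrable fun x : ℝ => |2 * (K x).re| ^ p :=
        (hK.dec.re.const_mul 2).integrable_rpow hm hp1
      refine this.congr (Eventually.of_forall fun x => ?_)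
      simp only
      rw [← two_mul_re_cauchyExt hφ hφ' hr]
    refine mul_le_mul_of_nonneg_left ?_ (by positivity)
    refine integral_mono (hK.dec.re.integrable_rpow hm hp1) i3 fun x => ?_
    simp only
    rw [← two_mul_re_cauchyExt hφ hφ' hr]
    refine Real.rpow_le_rpow (abs_nonneg _) ?_ (by linarith)
    rw [abs_mul, abs_two]
    linarith [abs_nonneg (K x).re]
  rw [h1, hG'.integral_im_mul_eq hm hK]
  have h5 := mul_le_mul_of_nonneg_left h4 (Real.rpow_nonneg hl.le p)
  linarith

/-- M. Riesz' inequality for `2 ≤ q`. -/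
theorem exists_integral_rpow_le_of_two_le {p q : ℝ} (hpq : p.HolderConjugate q) (hp2 : p ≤ 2) :
    ∃ C : ℝ, 0 ≤ C ∧ ∀ s : ℝ, 0 < s → ∀ G : ℂ → ℂ, HardyPlus s G →
      ∫ x : ℝ, ‖G x‖ ^ q ≤ C * ∫ x : ℝ, |(G x).re| ^ q := by
  have hp1 := hpq.lt
  have hq1 := hpq.symm.lt
  have hp10 : 0 < p - 1 := by linarith
  have hpq' : (q - 1) * p = q := by
    have := hpq.symm.sub_one_mul_conj
    exact this
  have hq2 : 2 ≤ q := by nlinarith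
  -- choose `l` with `2 l^p (2 / (p - 1)) = 1/2`
  obtain ⟨l, hl, hl2⟩ : ∃ l : ℝ, 0 < l ∧ 2 * (l ^ p * (2 / (p - 1))) = 1 / 2 := by
    refine ⟨((p - 1) / 8) ^ p⁻¹, by positivity, ?_⟩
    rw [Real.rpow_inv_rpow (by positivity) (by linarith)]
    field_simp
    norm_num
  refine ⟨2 ^ q * (1 + 4 * l⁻¹ ^ q), by positivity, fun s hs G hG => ?_⟩
  have hv : Continuous fun x : ℝ => (G x).im := hG.dec.im.continuous_real hs
  have iv : Integrable fun x : ℝ => |(G x).im| ^ q := hG.dec.im.integrable_rpow hs hq1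
  have iu : Integrable fun x : ℝ => |(G x).re| ^ q := hG.dec.re.integrable_rpow hs hq1
  -- With `v = Im G`, the test function is `v |v|^(q-2)` cut off to compact support; as `(q - 1) p =
  -- q`, its `p`-th power is at most the integrand on the left. The choice of `l` makes that term
  -- half of the left side, and absorbing it doubles the constant `2` to `4`.
  have hcut : ∀ n : ℕ, ∫ x : ℝ, cutoff n x * |(G x).im| ^ q ≤
      4 * (l⁻¹ ^ q * ∫ x : ℝ, |(G x).re| ^ q) := by
    intro n
    have hφ : Continuous fun x : ℝ => cutoff n x * ((G x).im * |(G x).im| ^ (q - 2)) :=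
      (continuous_cutoff n).mul (hv.mul (hv.abs.rpow_const fun x => Or.inr (by linarith)))
    have h1 := hG.integral_im_mul_le hpq hp2 hs hφ (hasCompactSupport_cutoff n).mul_right hl
    have hpow : ∀ t : ℝ, |t| * |t| ^ (q - 2) = |t| ^ (q - 1) := by
      intro t
      rcases eq_or_ne t 0 with rfl | ht
      · rw [abs_zero, zero_mul, Real.zero_rpow (by linarith)]
      · nth_rewrite 1 [← Real.rpow_one |t|]
        rw [← Real.rpow_add (abs_pos.mpr ht)]
        congr 1
        ring
    have h2 : ∀ x : ℝ, (G x).im * (cutoff n x * ((G x).im * |(G x).im| ^ (q - 2))) =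
        cutoff n x * |(G x).im| ^ q := by
      intro x
      have h3 : |(G x).im| ^ q = |(G x).im| * |(G x).im| ^ (q - 1) := by
        rcases eq_or_ne (G x).im 0 with h0 | h0
        · rw [h0, abs_zero, zero_mul, Real.zero_rpow (by linarith)]
        · nth_rewrite 2 [← Real.rpow_one |(G x).im|]
          rw [← Real.rpow_add (abs_pos.mpr h0)]
          congr 1
          ring
      rw [h3, ← hpow, ← mul_assoc |(G x).im|, abs_mul_abs_self]
      ring
    have ic : Integrable fun x : ℝ => cutoff n x * |(G x).im| ^ q := by
      refine iv.mono' ((continuous_cutoff n).mul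
        (hv.abs.rpow_const fun x => Or.inr (by linarith))).aestronglyMeasurable
        (Eventually.of_forall fun x => ?_)
      rw [Real.norm_of_nonneg (mul_nonneg (cutoff_nonneg _ _) (by positivity))]
      exact mul_le_of_le_one_left (by positivity) (cutoff_le_one _ _)
    have h4 : ∀ x : ℝ, |cutoff n x * ((G x).im * |(G x).im| ^ (q - 2))| ^ p ≤
        cutoff n x * |(G x).im| ^ q := by
      intro x
      rw [abs_mul, abs_mul, abs_of_nonneg (cutoff_nonneg _ _),
        abs_of_nonneg (Real.rpow_nonneg (abs_nonneg _) _), hpow,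
        Real.mul_rpow (cutoff_nonneg _ _) (by positivity), ← Real.rpow_mul (abs_nonneg _), hpq']
      gcongr
      calc cutoff n x ^ p ≤ cutoff n x ^ (1 : ℝ) :=
            Real.rpow_le_rpow_of_exponent_ge_of_imp (cutoff_nonneg _ _) (cutoff_le_one _ _)
              hp1.le (by intro _ h; linarith)
        _ = cutoff n x := Real.rpow_one _
    simp_rw [h2] at h1
    have h5 : ∫ x : ℝ, |cutoff n x * ((G x).im * |(G x).im| ^ (q - 2))| ^ p ≤
        ∫ x : ℝ, cutoff n x * |(G x).im| ^ q :=
      integral_mono_of_nonneg (Eventually.of_forall fun x => by positivity) ic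
        (Eventually.of_forall h4)
    have h6 : 2 * (l ^ p * (2 / (p - 1)) *
        ∫ x : ℝ, |cutoff n x * ((G x).im * |(G x).im| ^ (q - 2))| ^ p) ≤
        1 / 2 * ∫ x : ℝ, cutoff n x * |(G x).im| ^ q := by
      rw [← mul_assoc, hl2]
      gcongr
    linarith
  have hlim : Tendsto (fun n : ℕ => ∫ x : ℝ, cutoff n x * |(G x).im| ^ q) atTop
      (𝓝 (∫ x : ℝ, |(G x).im| ^ q)) := by
    refine tendsto_integral_of_dominated_convergence _ (fun n => ?_) iv (fun n => ?_) ?_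
    · exact ((continuous_cutoff n).mul
        (hv.abs.rpow_const fun x => Or.inr (by linarith))).aestronglyMeasurable
    · refine Eventually.of_forall fun x => ?_
      rw [Real.norm_of_nonneg (mul_nonneg (cutoff_nonneg _ _) (by positivity))]
      exact mul_le_of_le_one_left (by positivity) (cutoff_le_one _ _)
    · refine Eventually.of_forall fun x => ?_
      refine tendsto_const_nhds.congr' ?_
      filter_upwards [eventually_ge_atTop ⌈|x| + 1⌉₊] with n hn
      rw [cutoff_eq_one (Nat.ceil_le.mp hn), one_mul]
  have h7 := le_of_tendsto hlim (Eventually.of_forall hcut)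
  calc ∫ x : ℝ, ‖G x‖ ^ q ≤ ∫ x : ℝ, 2 ^ q * (|(G x).re| ^ q + |(G x).im| ^ q) := by
        refine integral_mono (hG.dec.integrable_rpow hs hq1) ((iu.add iv).const_mul _) fun x => ?_
        refine le_trans ?_ (add_rpow_le_two_rpow (by linarith) (abs_nonneg _) (abs_nonneg _))
        simp only
        gcongr
        exact Complex.norm_le_abs_re_add_abs_im _
    _ = 2 ^ q * ((∫ x : ℝ, |(G x).re| ^ q) + ∫ x : ℝ, |(G x).im| ^ q) := by
        rw [integral_const_mul, integral_add iu iv]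
    _ ≤ 2 ^ q * ((∫ x : ℝ, |(G x).re| ^ q) + 4 * (l⁻¹ ^ q * ∫ x : ℝ, |(G x).re| ^ q)) := by gcongr
    _ = _ := by ring

/-! ### The antisymmetrized kernel and its integrability. -/

/-- The antisymmetrized kernel of the commutator form. -/
noncomputable def commKer {𝕜 E : Type*} [RCLike 𝕜] [NormedAddCommGroup E] [NormedSpace 𝕜 E]
    (A : ℝ → E) (f g : ℝ → 𝕜) (z : ℝ × ℝ) : E :=
  ((f z.2 * g z.1 - f z.1 * g z.2) * ((((z.1 - z.2) ^ 2)⁻¹ : ℝ) : 𝕜)) • (A z.1 - A z.2)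

/-- Lipschitz functions with quadratic decay, with explicit constants. -/
structure TestBound {𝕜 : Type*} [RCLike 𝕜] (C L : ℝ) (f : ℝ → 𝕜) : Prop where
  decay : ∀ x, ‖f x‖ ≤ C * (1 + x ^ 2)⁻¹
  lip : ∀ x y, ‖f x - f y‖ ≤ L * |x - y|

/-- The integrable majorant of `commKer`. -/
noncomputable def commMajorant (z : ℝ × ℝ) : ℝ :=
  (1 + z.1 ^ 2)⁻¹ * (1 + (z.1 - z.2) ^ 2)⁻¹ + (1 + z.1 ^ 2)⁻¹ * (1 + z.2 ^ 2)⁻¹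

lemma integrable_commMajorant : Integrable commMajorant := by
  have h : Integrable fun x : ℝ => (1 + x ^ 2)⁻¹ := integrable_inv_one_add_sq
  refine Integrable.add ?_ (h.mul_prod h)
  have := Integrable.convolution_integrand (ContinuousLinearMap.mul ℝ ℝ) h h
    (μ := volume) (ν := volume)
  have h2 := this.swap
  refine h2.congr (Eventually.of_forall fun z => ?_)
  simp only [Function.comp_apply, Prod.swap, ContinuousLinearMap.mul_apply']
  rw [show (z.2 - z.1) ^ 2 = (z.1 - z.2) ^ 2 by ring]

section
variable {𝕜 E : Type*} [RCLike 𝕜] [NormedAddCommGroup E] [NormedSpace 𝕜 E]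
  {A : ℝ → E} {f g : ℝ → 𝕜} {C L M : ℝ}

lemma TestBound.continuous (hf : TestBound C L f) : Continuous f := by
  have hL : 0 ≤ L := by
    have := (norm_nonneg _).trans (hf.lip 1 0)
    simpa using this
  exact (LipschitzWith.of_dist_le_mul (K := L.toNNReal) fun x y => by
    rw [dist_eq_norm, Real.dist_eq, Real.coe_toNNReal L hL]; exact hf.lip x y).continuous

lemma continuous_of_lip (hA : ∀ x y, ‖A x - A y‖ ≤ M * |x - y|) : Continuous A := by
  have hM : 0 ≤ M := by
    have := (norm_nonneg _).trans (hA 1 0)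
    simpa using this
  exact (LipschitzWith.of_dist_le_mul (K := M.toNNReal) fun x y => by
    rw [dist_eq_norm, Real.dist_eq, Real.coe_toNNReal M hM]; exact hA x y).continuous

lemma TestBound.integrable (hf : TestBound C L f) : Integrable f :=
  (integrable_inv_one_add_sq.const_mul C).mono' hf.continuous.aestronglyMeasurable
    (Eventually.of_forall hf.decay)

/-- Near the diagonal the numerator vanishes to first order and cancels `|x - y|⁻¹`; away from it
the product decay of `f` and `g` suffices. Constants and majorant depend only on the bounds, which
allows dominated convergence along families. -/
lemma norm_mul_sub_mul_le (hf : TestBound C L f) (hg : TestBound C L g) (x y : ℝ) :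
    ‖f y * g x - f x * g y‖ * |x - y|⁻¹ ≤
      (4 * C * L + 2 * C ^ 2) * commMajorant (x, y) := by
  have hL : 0 ≤ L := by
    have := (norm_nonneg _).trans (hf.lip 1 0)
    simpa using this
  have hC : 0 ≤ C := by
    have := (norm_nonneg _).trans (hf.decay 0)
    simpa using this
  have hx : 0 < (1 + x ^ 2)⁻¹ := by positivity
  have hy : 0 < (1 + y ^ 2)⁻¹ := by positivity
  have hxy : 0 < (1 + (x - y) ^ 2)⁻¹ := by positivity
  have h1 := hf.decay x
  have h2 := hf.decay y
  have h3 := hg.decay x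
  have h4 := hg.decay y
  have h5 := hf.lip y x
  have h6 := hg.lip x y
  rw [abs_sub_comm] at h5
  unfold commMajorant
  simp only
  set X := (1 + x ^ 2)⁻¹
  set Y := (1 + y ^ 2)⁻¹
  rcases le_or_gt |x - y| 1 with hd | hd
  · have h7 : ‖f y * g x - f x * g y‖ ≤ |x - y| * (2 * C * L * X) := by
      have : f y * g x - f x * g y = (f y - f x) * g x + f x * (g x - g y) := by ring
      rw [this]
      refine (norm_add_le _ _).trans ?_
      rw [norm_mul, norm_mul]
      calc ‖f y - f x‖ * ‖g x‖ + ‖f x‖ * ‖g x - g y‖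
          ≤ (L * |x - y|) * (C * X) + (C * X) * (L * |x - y|) := by gcongr
        _ = _ := by ring
    have h8 : ‖f y * g x - f x * g y‖ * |x - y|⁻¹ ≤ 2 * C * L * X := by
      rcases eq_or_ne |x - y| 0 with h0 | h0
      · rw [h0, inv_zero, mul_zero]; positivity
      · rw [← div_eq_mul_inv, div_le_iff₀ (lt_of_le_of_ne (abs_nonneg _) h0.symm)]
        exact h7.trans_eq (by ring)
    have h9 : (1 : ℝ) ≤ 2 * (1 + (x - y) ^ 2)⁻¹ := by
      rw [← div_eq_mul_inv, one_le_div (by positivity), ← sq_abs]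
      nlinarith [abs_nonneg (x - y)]
    calc _ ≤ 2 * C * L * X * 1 := by rw [mul_one]; exact h8
      _ ≤ 2 * C * L * X * (2 * (1 + (x - y) ^ 2)⁻¹) := by gcongr
      _ = 4 * C * L * (X * (1 + (x - y) ^ 2)⁻¹) := by ring
      _ ≤ _ := by
        have e1 : 0 ≤ C ^ 2 * (X * (1 + (x - y) ^ 2)⁻¹) := by positivity
        have e2 : 0 ≤ (4 * C * L + 2 * C ^ 2) * (X * Y) := by positivity
        nlinarith
  · have h7 : ‖f y * g x - f x * g y‖ ≤ 2 * C ^ 2 * (X * Y) := by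
      refine (norm_sub_le _ _).trans ?_
      rw [norm_mul, norm_mul]
      calc ‖f y‖ * ‖g x‖ + ‖f x‖ * ‖g y‖
          ≤ (C * Y) * (C * X) + (C * X) * (C * Y) := by gcongr
        _ = _ := by ring
    have h8 : |x - y|⁻¹ ≤ 1 := inv_le_one_of_one_le₀ hd.le
    calc _ ≤ 2 * C ^ 2 * (X * Y) * 1 := by gcongr
      _ ≤ _ := by
        have e1 : 0 ≤ C * L * (X * Y) := by positivity
        have e2 : 0 ≤ (4 * C * L + 2 * C ^ 2) * (X * (1 + (x - y) ^ 2)⁻¹) := by positivity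
        nlinarith

lemma norm_commKer_le (hf : TestBound C L f) (hg : TestBound C L g)
    (hA : ∀ x y, ‖A x - A y‖ ≤ M * |x - y|) (z : ℝ × ℝ) :
    ‖commKer A f g z‖ ≤ M * (4 * C * L + 2 * C ^ 2) * commMajorant z := by
  have hM : 0 ≤ M := by
    have := (norm_nonneg _).trans (hA 1 0)
    simpa using this
  obtain ⟨x, y⟩ := z
  have h := norm_mul_sub_mul_le hf hg x y
  rw [commKer, norm_smul, norm_mul, RCLike.norm_ofReal]
  simp only
  have hinv : |((x - y) ^ 2)⁻¹| * |x - y| = |x - y|⁻¹ := by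
    rw [abs_inv, abs_pow]
    rcases eq_or_ne |x - y| 0 with h0 | h0
    · rw [h0]; simp
    · field_simp
  calc ‖f y * g x - f x * g y‖ * |((x - y) ^ 2)⁻¹| * ‖A x - A y‖
      ≤ ‖f y * g x - f x * g y‖ * |((x - y) ^ 2)⁻¹| * (M * |x - y|) := by
        gcongr
        exact hA x y
    _ = M * (‖f y * g x - f x * g y‖ * (|((x - y) ^ 2)⁻¹| * |x - y|)) := by ring
    _ ≤ M * ((4 * C * L + 2 * C ^ 2) * commMajorant (x, y)) := by
        rw [hinv]
        gcongr
    _ = _ := by ring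

lemma aestronglyMeasurable_commKer (hf : Continuous f) (hg : Continuous g) (hA : Continuous A) :
    AEStronglyMeasurable (commKer A f g) (volume : Measure (ℝ × ℝ)) := by
  unfold commKer
  refine AEStronglyMeasurable.smul (AEStronglyMeasurable.mul ?_ ?_) ?_
  · exact Continuous.aestronglyMeasurable (by fun_prop)
  · have : Measurable fun z : ℝ × ℝ => ((((z.1 - z.2) ^ 2)⁻¹ : ℝ) : 𝕜) :=
      RCLike.measurable_ofReal.comp (by fun_prop)
    exact this.aestronglyMeasurable
  · exact Continuous.aestronglyMeasurable (by fun_prop)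

lemma integrable_commKer (hf : TestBound C L f) (hg : TestBound C L g)
    (hA : ∀ x y, ‖A x - A y‖ ≤ M * |x - y|) : Integrable (commKer A f g) :=
  (integrable_commMajorant.const_mul _).mono'
    (aestronglyMeasurable_commKer hf.continuous hg.continuous (continuous_of_lip hA))
    (Eventually.of_forall (norm_commKer_le hf hg hA))

lemma tendsto_integral_commKer [NormedSpace ℝ E] {ι : Type*} {l : Filter ι}
    [l.IsCountablyGenerated]
    {A' : ι → ℝ → E} {f' g' : ι → ℝ → 𝕜} (hf : ∀ᶠ i in l, TestBound C L (f' i))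
    (hg : ∀ᶠ i in l, TestBound C L (g' i))
    (hA : ∀ᶠ i in l, ∀ x y, ‖A' i x - A' i y‖ ≤ M * |x - y|)
    (hf' : ∀ x, Tendsto (fun i => f' i x) l (𝓝 (f x)))
    (hg' : ∀ x, Tendsto (fun i => g' i x) l (𝓝 (g x)))
    (hA' : ∀ x, Tendsto (fun i => A' i x) l (𝓝 (A x))) :
    Tendsto (fun i => ∫ z, commKer (A' i) (f' i) (g' i) z) l (𝓝 (∫ z, commKer A f g z)) := by
  refine tendsto_integral_filter_of_dominated_convergence _ ?_ ?_
    (integrable_commMajorant.const_mul (M * (4 * C * L + 2 * C ^ 2))) ?_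
  · filter_upwards [hf, hg, hA] with i h1 h2 h3
    exact aestronglyMeasurable_commKer h1.continuous h2.continuous (continuous_of_lip h3)
  · filter_upwards [hf, hg, hA] with i h1 h2 h3
    exact Eventually.of_forall (norm_commKer_le h1 h2 h3)
  · refine Eventually.of_forall fun z => ?_
    exact ((((hf' z.2).mul (hg' z.1)).sub ((hf' z.1).mul (hg' z.2))).mul_const _).smul
      ((hA' z.1).sub (hA' z.2))

lemma commKer_swap (z : ℝ × ℝ) : commKer A g f z = -commKer A f g z := by
  rw [commKer, commKer, ← neg_smul]
  congr 1
  ring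

end

/-! ### Cauchy's formula for the derivative on the half-plane. -/

/-- The region `|z| ≤ R`, `Im z ≥ -s'` is compact in the larger half-plane, so decay only needs
checking far out, at the price of shrinking the half-plane. -/
lemma Dec.of_far {E : Type*} [NormedAddCommGroup E] {s s' : ℝ} {k : ℕ} {G : ℂ → E} (hs : s' < s)
    (hc : ContinuousOn G (halfPlane s)) {C R : ℝ}
    (hb : ∀ z ∈ halfPlane s, R ≤ ‖z‖ → ‖G z‖ ≤ C / (1 + ‖z‖) ^ k) : Dec s' k G := by
  have hsub : halfPlane s' ⊆ halfPlane s := fun z (hz : -s' < z.im) =>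
    show -s < z.im by linarith
  have hcomp : IsCompact (Metric.closedBall (0 : ℂ) R ∩ {z | -s' ≤ z.im}) :=
    (isCompact_closedBall _ _).inter_right (isClosed_le continuous_const Complex.continuous_im)
  obtain ⟨N, hN⟩ := hcomp.exists_bound_of_continuousOn (f := G)
    (hc.mono fun z hz => show -s < z.im from lt_of_lt_of_le (by linarith) hz.2)
  refine ⟨hc.mono hsub, max C 0 + max N 0 * (1 + |R|) ^ k, by positivity, fun z hz => ?_⟩
  have hpos := one_add_norm_pow_pos z k
  rcases le_or_gt R ‖z‖ with h | h
  · refine (hb z (hsub hz) h).trans ?_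
    gcongr
    exact (le_max_left C 0).trans (le_add_of_nonneg_right (by positivity))
  · have h1 := hN z ⟨by simpa using h.le, show -s' ≤ z.im from (show -s' < z.im from hz).le⟩
    rw [le_div_iff₀ hpos]
    calc ‖G z‖ * (1 + ‖z‖) ^ k ≤ max N 0 * (1 + |R|) ^ k := by
          gcongr
          · exact h1.trans (le_max_left _ _)
          · exact h.le.trans (le_abs_self R)
      _ ≤ _ := le_add_of_nonneg_left (le_max_right _ _)

lemma exists_norm_inv_sub_sq_le {w : ℂ} (hw : w.im ≠ 0) :
    ∃ C : ℝ, 0 ≤ C ∧ ∀ x : ℝ, ‖(((x : ℂ) - w) ^ 2)⁻¹‖ ≤ C * (1 + x ^ 2)⁻¹ := by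
  have hv : 0 < w.im ^ 2 := by positivity
  refine ⟨2 + (1 + 2 * w.re ^ 2) / w.im ^ 2, by positivity, fun x => ?_⟩
  have h1 : ‖((x : ℂ) - w) ^ 2‖ = (x - w.re) ^ 2 + w.im ^ 2 := by
    rw [norm_pow, ← Complex.normSq_eq_norm_sq, Complex.normSq_apply]
    simp
    ring
  rw [norm_inv, h1, ← div_eq_mul_inv, inv_eq_one_div, div_le_div_iff₀ (by positivity) (by positivity)]
  have h2 : (1 + 2 * w.re ^ 2) / w.im ^ 2 * w.im ^ 2 = 1 + 2 * w.re ^ 2 :=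
    div_mul_cancel₀ _ hv.ne'
  have h3 : 0 ≤ (1 + 2 * w.re ^ 2) / w.im ^ 2 * (x - w.re) ^ 2 := by positivity
  nlinarith [sq_nonneg (x - 2 * w.re)]

lemma integrable_inv_sub_sq {w : ℂ} (hw : w.im ≠ 0) {h : ℝ → ℂ} (hc : Continuous h) {B : ℝ}
    (hB : ∀ x, ‖h x‖ ≤ B) : Integrable fun x : ℝ => h x * (((x : ℂ) - w) ^ 2)⁻¹ := by
  obtain ⟨C, hC, hb⟩ := exists_norm_inv_sub_sq_le hw
  refine (integrable_inv_one_add_sq.const_mul (B * C)).mono' ?_ (Eventually.of_forall fun x => ?_)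
  · refine (hc.mul (Continuous.inv₀ (by fun_prop) fun x => pow_ne_zero 2 fun h0 => ?_)).aestronglyMeasurable
    apply hw
    have := congrArg Complex.im h0
    simpa using this
  · rw [norm_mul, mul_assoc]
    exact mul_le_mul (hB x) (hb x) (norm_nonneg _) ((norm_nonneg _).trans (hB x))

/-- Cauchy's formula: the case of a pole in the lower half-plane. -/
lemma HardyPlus.integral_mul_inv_sq_eq_zero {s : ℝ} (hs : 0 < s) {F : ℂ → ℂ} (hF : HardyPlus s F)
    {w : ℂ} (hw : w.im < 0) : ∫ x : ℝ, F x * (((x : ℂ) - w) ^ 2)⁻¹ = 0 := by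
  set r := min s (-w.im / 2) with hr
  have hr0 : 0 < r := lt_min hs (by linarith)
  have hF' := hF.anti (min_le_left s (-w.im / 2))
  rw [← hr] at hF'
  have hne : ∀ z ∈ halfPlane r, (z - w) ^ 2 ≠ 0 := by
    intro z hz h0
    have h1 : z = w := sub_eq_zero.mp (pow_eq_zero_iff two_ne_zero |>.mp h0)
    have h2 : -r < z.im := hz
    rw [h1] at h2
    linarith [min_le_right s (-w.im / 2)]
  have hd : DifferentiableOn ℂ (fun z => F z * ((z - w) ^ 2)⁻¹) (halfPlane r) :=
    hF'.diff.mul (DifferentiableOn.inv (by fun_prop) hne)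
  obtain ⟨B, hB0, hB⟩ := hF'.dec.exists_bound
  have hdec : Dec (r / 2) 2 (fun z => F z * ((z - w) ^ 2)⁻¹) := by
    refine Dec.of_far (s := r) (R := 2 * ‖w‖ + 1) (C := B * 16) (by linarith) hd.continuousOn
      fun z hz hR => ?_
    rw [norm_mul, mul_div_assoc]
    have h1 : (1 + ‖z‖) / 4 ≤ ‖z - w‖ := by
      have := norm_sub_norm_le z w
      have := norm_nonneg w
      linarith
    refine mul_le_mul (hB z hz) ?_ (norm_nonneg _) hB0
    rw [norm_inv, norm_pow]
    calc (‖z - w‖ ^ 2)⁻¹ ≤ (((1 + ‖z‖) / 4) ^ 2)⁻¹ := by gcongr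
      _ = _ := by field_simp; norm_num
  exact integral_eq_zero_of_holomorphic (s := r / 2) (by linarith)
    (hd.mono fun z (hz : -(r / 2) < z.im) => show -r < z.im by linarith) hdec

lemma integral_poisson_eq_pi {u v : ℝ} (hv : 0 < v) :
    ∫ x : ℝ, v / ((x - u) ^ 2 + v ^ 2) = Real.pi := by
  have h3 := integral_comp_add_mul (g := fun t => v / ((t - u) ^ 2 + v ^ 2)) hv u
  have h4 : ∀ τ : ℝ, v / ((u + v * τ - u) ^ 2 + v ^ 2) = v⁻¹ * (1 + τ ^ 2)⁻¹ := by
    intro τ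
    have : 0 < 1 + τ ^ 2 := by positivity
    rw [show (u + v * τ - u) ^ 2 + v ^ 2 = v ^ 2 * (1 + τ ^ 2) by ring]
    field_simp
  simp_rw [h4, integral_const_mul, integral_univ_inv_one_add_sq] at h3
  exact (mul_left_cancel₀ (inv_ne_zero hv.ne') h3).symm

/-- Cauchy's formula for the derivative on the half-plane. -/
lemma HardyPlus.integral_mul_inv_sq {s : ℝ} (hs : 0 < s) {F : ℂ → ℂ} (hF : HardyPlus s F)
    {w : ℂ} (hw : 0 < w.im) :
    ∫ x : ℝ, F x * (((x : ℂ) - w) ^ 2)⁻¹ = 2 * Real.pi * Complex.I * deriv F w := by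
  set r := min s (w.im / 2) with hr
  have hr0 : 0 < r := lt_min hs (by linarith)
  have hF' := hF.anti (min_le_left s (w.im / 2))
  rw [← hr] at hF'
  have hwr : w ∈ halfPlane r := show -r < w.im by linarith
  have hnhds := (isOpen_halfPlane r).mem_nhds hwr
  set a := deriv F w
  set b := starRingEnd ℂ w with hb
  have hne : ∀ z ∈ halfPlane r, z - b ≠ 0 := by
    intro z hz h0
    have h1 : z = b := sub_eq_zero.mp h0
    have h2 : -r < z.im := hz
    rw [h1, hb, Complex.conj_im] at h2
    linarith [min_le_right s (w.im / 2)]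
  -- The second divided difference removes the pole at `w` but decays only like `-a / (z - w)`.
  -- Adding `a / (z - w̄)`, whose pole is outside the half-plane, restores quadratic decay; on the
  -- real line the two combine into a Poisson kernel of integral `π`.
  set Ψ : ℂ → ℂ := fun z => dslope (dslope F w) w z + a * (z - b)⁻¹ with hΨ
  have hd : DifferentiableOn ℂ Ψ (halfPlane r) := by
    refine DifferentiableOn.add ?_ ((differentiableOn_const _).mul
      (DifferentiableOn.inv (by fun_prop) hne))
    exact (Complex.differentiableOn_dslope hnhds).mpr
      ((Complex.differentiableOn_dslope hnhds).mpr hF'.diff)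
  have hval : ∀ z, z ≠ w → z - b ≠ 0 → Ψ z = F z * ((z - w) ^ 2)⁻¹ - F w * ((z - w) ^ 2)⁻¹ +
      a * ((b - w) * ((z - b)⁻¹ * (z - w)⁻¹)) := by
    intro z hz hzb
    have hzw : z - w ≠ 0 := sub_ne_zero.mpr hz
    simp only [hΨ]
    rw [dslope_of_ne _ hz, slope_def_field, dslope_of_ne _ hz, slope_def_field, dslope_same]
    field_simp
    ring
  obtain ⟨B, hB0, hB⟩ := hF'.dec.exists_bound
  have hbn : ‖b‖ = ‖w‖ := RCLike.norm_conj w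
  have hdec : Dec (r / 2) 2 Ψ := by
    refine Dec.of_far (s := r) (R := 2 * ‖w‖ + 1) (C := (B + B + ‖a‖ * ‖b - w‖) * 16) (by linarith)
      hd.continuousOn fun z hz hR => ?_
    have hzw : z ≠ w := by
      rintro rfl
      linarith [norm_nonneg z]
    have hz0 : 0 < 1 + ‖z‖ := by positivity
    have h1 : (1 + ‖z‖) / 4 ≤ ‖z - w‖ := by
      have := norm_sub_norm_le z w
      have := norm_nonneg w
      linarith
    have h2 : (1 + ‖z‖) / 4 ≤ ‖z - b‖ := by
      have := norm_sub_norm_le z b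
      have := norm_nonneg w
      linarith
    have i1 : ‖(z - w)⁻¹‖ ≤ 4 / (1 + ‖z‖) := by
      rw [norm_inv, ← inv_div]
      gcongr
    have i2 : ‖(z - b)⁻¹‖ ≤ 4 / (1 + ‖z‖) := by
      rw [norm_inv, ← inv_div]
      gcongr
    have i3 : ‖((z - w) ^ 2)⁻¹‖ ≤ 16 / (1 + ‖z‖) ^ 2 := by
      rw [← inv_pow, norm_pow]
      calc ‖(z - w)⁻¹‖ ^ 2 ≤ (4 / (1 + ‖z‖)) ^ 2 := by gcongr
        _ = _ := by rw [div_pow]; norm_num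
    have i4 : ‖(z - b)⁻¹ * (z - w)⁻¹‖ ≤ 16 / (1 + ‖z‖) ^ 2 := by
      rw [norm_mul]
      calc ‖(z - b)⁻¹‖ * ‖(z - w)⁻¹‖ ≤ (4 / (1 + ‖z‖)) * (4 / (1 + ‖z‖)) := by gcongr
        _ = _ := by field_simp; norm_num
    rw [hval z hzw (hne z hz)]
    refine (norm_add_le _ _).trans ?_
    refine (add_le_add_left (norm_sub_le _ _) _).trans ?_
    rw [norm_mul, norm_mul, norm_mul a, norm_mul (b - w)]
    calc ‖F z‖ * ‖((z - w) ^ 2)⁻¹‖ + ‖F w‖ * ‖((z - w) ^ 2)⁻¹‖ +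
        ‖a‖ * (‖b - w‖ * ‖(z - b)⁻¹ * (z - w)⁻¹‖)
        ≤ B * (16 / (1 + ‖z‖) ^ 2) + B * (16 / (1 + ‖z‖) ^ 2) +
          ‖a‖ * (‖b - w‖ * (16 / (1 + ‖z‖) ^ 2)) := by
          have := hB z hz
          have := hB w hwr
          gcongr
      _ = _ := by ring
  have hzero := integral_eq_zero_of_holomorphic (s := r / 2) (by linarith)
    (hd.mono fun z (hz : -(r / 2) < z.im) => show -r < z.im by linarith) hdec
  have hxw : ∀ x : ℝ, (x : ℂ) ≠ w := by
    intro x h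
    rw [← h] at hw
    simp at hw
  have hsplit : ∀ x : ℝ, Ψ x = F x * (((x : ℂ) - w) ^ 2)⁻¹ - F w * (((x : ℂ) - w) ^ 2)⁻¹ +
      a * (-2 * Complex.I * ((w.im / ((x - w.re) ^ 2 + w.im ^ 2) : ℝ) : ℂ)) := by
    intro x
    rw [hval x (hxw x) (hne x (ofReal_mem_halfPlane hr0 x))]
    congr 2
    have h1 : ((x : ℂ) - b) * ((x : ℂ) - w) = (((x - w.re) ^ 2 + w.im ^ 2 : ℝ) : ℂ) := by
      have h3 : (x : ℂ) - b = starRingEnd ℂ ((x : ℂ) - w) := by simp [hb]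
      rw [h3, ← Complex.normSq_eq_conj_mul_self, Complex.normSq_apply]
      simp only [Complex.sub_re, Complex.sub_im, Complex.ofReal_re, Complex.ofReal_im]
      congr 1
      ring
    have h2 : b - w = -2 * Complex.I * (w.im : ℂ) := by
      apply Complex.ext <;> simp [hb]
      ring
    rw [← mul_inv, h1, h2, Complex.ofReal_div]
    ring
  have hw0 : w.im ≠ 0 := hw.ne'
  -- The constant has no decay, so the previous lemma does not cover it. The conjugate integrand has
  -- its pole in the lower half-plane, where Cauchy's theorem applies directly.
  have hwb : ∫ x : ℝ, (((x : ℂ) - w) ^ 2)⁻¹ = 0 := by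
    have hb0 : b.im < 0 := by rw [hb, Complex.conj_im]; linarith
    set r' := -b.im / 2 with hr'
    have hr0' : 0 < r' := by rw [hr']; linarith
    have hne' : ∀ z ∈ halfPlane r', (z - b) ^ 2 ≠ 0 := by
      intro z hz h0
      have h1 : z = b := sub_eq_zero.mp (pow_eq_zero_iff two_ne_zero |>.mp h0)
      have h2 : -r' < z.im := hz
      rw [h1] at h2
      linarith
    have hd' : DifferentiableOn ℂ (fun z => ((z - b) ^ 2)⁻¹) (halfPlane r') :=
      DifferentiableOn.inv (by fun_prop) hne'
    have hdec' : Dec (r' / 2) 2 (fun z => ((z - b) ^ 2)⁻¹) := by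
      refine Dec.of_far (s := r') (R := 2 * ‖b‖ + 1) (C := 16) (by linarith) hd'.continuousOn
        fun z hz hR => ?_
      have h1 : (1 + ‖z‖) / 4 ≤ ‖z - b‖ := by
        have := norm_sub_norm_le z b
        have := norm_nonneg b
        linarith
      rw [norm_inv, norm_pow]
      calc (‖z - b‖ ^ 2)⁻¹ ≤ (((1 + ‖z‖) / 4) ^ 2)⁻¹ := by gcongr
        _ = _ := by field_simp; norm_num
    have h0 := integral_eq_zero_of_holomorphic (s := r' / 2) (by linarith)
      (hd'.mono fun z (hz : -(r' / 2) < z.im) => show -r' < z.im by linarith) hdec'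
    have h1 := congrArg (starRingEnd ℂ) h0
    rw [← integral_conj, map_zero] at h1
    rw [← h1]
    congr 1
    funext x
    simp [hb]
  simp_rw [hsplit] at hzero
  have j1 : Integrable fun x : ℝ => F x * (((x : ℂ) - w) ^ 2)⁻¹ :=
    integrable_inv_sub_sq hw0 (hF'.dec.continuous_real hr0)
      fun x => hB _ (ofReal_mem_halfPlane hr0 x)
  have j2 : Integrable fun x : ℝ => F w * (((x : ℂ) - w) ^ 2)⁻¹ :=
    integrable_inv_sub_sq hw0 continuous_const fun x => le_rfl
  have j3 : Integrable fun x : ℝ => a * (-2 * Complex.I *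
      ((w.im / ((x - w.re) ^ 2 + w.im ^ 2) : ℝ) : ℂ)) := by
    have hint : Integrable fun x : ℝ => w.im / ((x - w.re) ^ 2 + w.im ^ 2) := by
      by_contra hni
      have := integral_poisson_eq_pi (u := w.re) hw
      rw [integral_undef hni] at this
      exact Real.pi_ne_zero this.symm
    exact Integrable.const_mul (Integrable.const_mul hint.ofReal _) _
  rw [integral_add (j1.sub' j2) j3, integral_sub j1 j2, integral_const_mul, integral_const_mul,
    integral_const_mul, integral_complex_ofReal, integral_poisson_eq_pi hw, hwb] at hzero
  linear_combination hzero

/-! ### The commutator form as a boundary integral. -/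

/-- The regularization `Re (t + iε)⁻²` of `t⁻²`. -/
noncomputable def regKer (ε t : ℝ) : ℝ := (t ^ 2 - ε ^ 2) / (t ^ 2 + ε ^ 2) ^ 2

lemma regKer_neg (ε t : ℝ) : regKer ε (-t) = regKer ε t := by simp [regKer]

lemma abs_regKer_le (ε t : ℝ) : |regKer ε t| ≤ (t ^ 2 + ε ^ 2)⁻¹ := by
  rw [regKer, abs_div, abs_of_nonneg (by positivity : 0 ≤ (t ^ 2 + ε ^ 2) ^ 2)]
  have h1 : |t ^ 2 - ε ^ 2| ≤ t ^ 2 + ε ^ 2 := by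
    rw [abs_le]
    constructor <;> nlinarith [sq_nonneg t, sq_nonneg ε]
  rcases eq_or_ne (t ^ 2 + ε ^ 2) 0 with h0 | h0
  · rw [h0]; simp
  · have hpos : 0 < t ^ 2 + ε ^ 2 := lt_of_le_of_ne (by positivity) h0.symm
    calc |t ^ 2 - ε ^ 2| / (t ^ 2 + ε ^ 2) ^ 2 ≤ (t ^ 2 + ε ^ 2) / (t ^ 2 + ε ^ 2) ^ 2 := by gcongr
      _ = _ := by field_simp

lemma continuous_regKer {ε : ℝ} (hε : 0 < ε) : Continuous (regKer ε) := by
  unfold regKer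
  refine Continuous.div (by fun_prop) (by fun_prop) fun t => ?_
  positivity

/-- The kernel is half the sum of `(y - w)⁻²` and its conjugate, `w = x + i ε`. Integrated against
`F`, the first gives `2 π i F'(w)` and the second, with its pole below the axis, gives zero; then
real parts are taken. -/
lemma HardyPlus.integral_re_mul_regKer {s : ℝ} (hs : 0 < s) {F : ℂ → ℂ} (hF : HardyPlus s F)
    {ε : ℝ} (hε : 0 < ε) (x : ℝ) :
    ∫ y : ℝ, 2 * (F y).re * regKer ε (x - y) =
      -(2 * Real.pi) * (deriv F (x + ε * Complex.I)).im := by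
  set w : ℂ := x + ε * Complex.I with hw
  have hwi : w.im = ε := by simp [hw]
  have hwr : w.re = x := by simp [hw]
  have hwi' : (starRingEnd ℂ w).im = -ε := by rw [Complex.conj_im, hwi]
  obtain ⟨B, hB0, hB⟩ := hF.dec.exists_bound
  have hb : ∀ y : ℝ, ‖F y‖ ≤ B := fun y => hB _ (ofReal_mem_halfPlane hs y)
  have j1 := integrable_inv_sub_sq (w := w) (by rw [hwi]; exact hε.ne')
    (hF.dec.continuous_real hs) hb
  have j2 := integrable_inv_sub_sq (w := starRingEnd ℂ w)
    (by rw [hwi']; exact (neg_neg_of_pos hε).ne) (hF.dec.continuous_real hs) hb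
  have e1 := hF.integral_mul_inv_sq hs (w := w) (by rw [hwi]; exact hε)
  have e2 := hF.integral_mul_inv_sq_eq_zero hs (w := starRingEnd ℂ w) (by rw [hwi']; linarith)
  have key : ∀ y : ℝ, 2 * (F y).re * regKer ε (x - y) =
      (F y * (((y : ℂ) - w) ^ 2)⁻¹ + F y * (((y : ℂ) - starRingEnd ℂ w) ^ 2)⁻¹).re := by
    intro y
    set c := (((y : ℂ) - w) ^ 2)⁻¹ with hc
    have h1 : (((y : ℂ) - starRingEnd ℂ w) ^ 2)⁻¹ = starRingEnd ℂ c := by simp [hc]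
    have h2 : c.re = regKer ε (x - y) := by
      rw [hc, Complex.inv_re, Complex.normSq_eq_norm_sq, norm_pow, ← Complex.normSq_eq_norm_sq,
        Complex.normSq_apply, regKer]
      simp only [sq, Complex.mul_re, Complex.sub_re, Complex.sub_im, Complex.ofReal_re,
        Complex.ofReal_im, hwi, hwr]
      congr 1 <;> ring
    rw [h1, ← mul_add, Complex.add_conj, h2, Complex.re_mul_ofReal]
    ring
  simp_rw [key]
  have hre : ∫ y : ℝ, (F y * (((y : ℂ) - w) ^ 2)⁻¹ + F y * (((y : ℂ) - starRingEnd ℂ w) ^ 2)⁻¹).re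
      = (∫ y : ℝ, (F y * (((y : ℂ) - w) ^ 2)⁻¹ +
        F y * (((y : ℂ) - starRingEnd ℂ w) ^ 2)⁻¹)).re := integral_re (j1.fun_add j2)
  rw [hre, integral_add j1 j2, e1, e2, add_zero]
  simp

/-- The commutator form in terms of the boundary values of holomorphic functions. -/
theorem HardyPlus.integral_commKer {s : ℝ} (hs : 0 < s) {F G : ℂ → ℂ} (hF : HardyPlus s F)
    (hG : HardyPlus s G) {C L M N : ℝ} {A f g : ℝ → ℝ} (hf : TestBound C L f)
    (hg : TestBound C L g) (hA : ∀ x y, ‖A x - A y‖ ≤ M * |x - y|) (hN : ∀ x, |A x| ≤ N)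
    (hfF : ∀ x : ℝ, f x = 2 * (F x).re) (hgG : ∀ x : ℝ, g x = 2 * (G x).re) :
    ∫ z, commKer A f g z =
      -(4 * Real.pi) * ∫ x : ℝ, A x * (g x * (deriv F x).im - f x * (deriv G x).im) := by
  have hAc : Continuous A := continuous_of_lip hA
  have hN0 : 0 ≤ N := (abs_nonneg _).trans (hN 0)
  obtain ⟨BF, hBF0, hBF⟩ := hF.derivative.dec.exists_bound
  obtain ⟨BG, hBG0, hBG⟩ := hG.derivative.dec.exists_bound
  -- integrals against the regularized kernel
  have hP : ∀ {H : ℂ → ℂ} {h k : ℝ → ℝ}, HardyPlus s H → (∀ x : ℝ, h x = 2 * (H x).re) →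
      TestBound C L h → TestBound C L k → ∀ ε : ℝ, 0 < ε →
      Integrable (fun z : ℝ × ℝ => A z.1 * k z.1 * (h z.2 * regKer ε (z.1 - z.2))) ∧
      ∫ z : ℝ × ℝ, A z.1 * k z.1 * (h z.2 * regKer ε (z.1 - z.2)) =
        ∫ x : ℝ, A x * k x * (-(2 * Real.pi) * (deriv H (x + ε * Complex.I)).im) := by
    intro H h k hH hhH hh hk ε hε
    have hint : Integrable fun z : ℝ × ℝ => A z.1 * k z.1 * (h z.2 * regKer ε (z.1 - z.2)) := by
      have h1 : Integrable fun z : ℝ × ℝ => ‖k z.1‖ * ‖h z.2‖ :=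
        hk.integrable.norm.mul_prod hh.integrable.norm
      refine (h1.const_mul (N * (ε ^ 2)⁻¹)).mono' ?_ (Eventually.of_forall fun z => ?_)
      · have := hk.continuous
        have := hh.continuous
        have := continuous_regKer hε
        exact Continuous.aestronglyMeasurable (by fun_prop)
      · rw [norm_mul, norm_mul, norm_mul]
        have h2 : ‖regKer ε (z.1 - z.2)‖ ≤ (ε ^ 2)⁻¹ := by
          refine (abs_regKer_le _ _).trans ?_
          gcongr
          nlinarith [sq_nonneg (z.1 - z.2)]
        calc ‖A z.1‖ * ‖k z.1‖ * (‖h z.2‖ * ‖regKer ε (z.1 - z.2)‖)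
            ≤ N * ‖k z.1‖ * (‖h z.2‖ * (ε ^ 2)⁻¹) := by
              gcongr
              exact hN _
          _ = _ := by ring
    refine ⟨hint, ?_⟩
    rw [Measure.volume_eq_prod] at hint ⊢
    rw [integral_prod _ hint]
    congr 1
    funext x
    simp only
    rw [integral_const_mul, ← hH.integral_re_mul_regKer hs hε x]
    simp_rw [hhH]
  -- For `ε > 0` the four products obtained by expanding are separately integrable. Exchanging the
  -- variables identifies them in pairs, whence the factor `2`.
  have hI : ∀ ε : ℝ, 0 < ε →
      ∫ z : ℝ × ℝ, (f z.2 * g z.1 - f z.1 * g z.2) * regKer ε (z.1 - z.2) * (A z.1 - A z.2) =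
      2 * ((∫ x : ℝ, A x * g x * (-(2 * Real.pi) * (deriv F (x + ε * Complex.I)).im)) -
        ∫ x : ℝ, A x * f x * (-(2 * Real.pi) * (deriv G (x + ε * Complex.I)).im)) := by
    intro ε hε
    obtain ⟨i1, e1⟩ := hP hF hfF hf hg ε hε
    obtain ⟨i2, e2⟩ := hP hG hgG hg hf ε hε
    have i1' := i1.swap
    have i2' := i2.swap
    have e1' : ∫ z : ℝ × ℝ, A z.2 * g z.2 * (f z.1 * regKer ε (z.2 - z.1)) = _ :=
      (integral_prod_swap (μ := (volume : Measure ℝ)) (ν := (volume : Measure ℝ))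
        (fun z : ℝ × ℝ => A z.1 * g z.1 * (f z.2 * regKer ε (z.1 - z.2)))).trans e1
    have e2' : ∫ z : ℝ × ℝ, A z.2 * f z.2 * (g z.1 * regKer ε (z.2 - z.1)) = _ :=
      (integral_prod_swap (μ := (volume : Measure ℝ)) (ν := (volume : Measure ℝ))
        (fun z : ℝ × ℝ => A z.1 * f z.1 * (g z.2 * regKer ε (z.1 - z.2)))).trans e2
    have hpt : ∀ z : ℝ × ℝ,
        (f z.2 * g z.1 - f z.1 * g z.2) * regKer ε (z.1 - z.2) * (A z.1 - A z.2) =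
        (A z.1 * g z.1 * (f z.2 * regKer ε (z.1 - z.2)) +
          A z.2 * g z.2 * (f z.1 * regKer ε (z.2 - z.1))) -
        (A z.1 * f z.1 * (g z.2 * regKer ε (z.1 - z.2)) +
          A z.2 * f z.2 * (g z.1 * regKer ε (z.2 - z.1))) := by
      intro z
      rw [← neg_sub z.1 z.2, regKer_neg]
      ring
    simp_rw [hpt]
    have i3 : Integrable (fun z : ℝ × ℝ => A z.2 * g z.2 * (f z.1 * regKer ε (z.2 - z.1))) := i1'
    have i4 : Integrable (fun z : ℝ × ℝ => A z.2 * f z.2 * (g z.1 * regKer ε (z.2 - z.1))) := i2'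
    rw [integral_sub (i1.fun_add i3) (i2.fun_add i4), integral_add i1 i3, integral_add i2 i4,
      e1', e2', e1, e2]
    ring
  -- The regularized kernel is bounded by `(x - y)⁻²`, so the majorant of `commKer` serves for all
  -- `ε`.
  have hlim1 : Tendsto (fun ε => ∫ z : ℝ × ℝ,
      (f z.2 * g z.1 - f z.1 * g z.2) * regKer ε (z.1 - z.2) * (A z.1 - A z.2)) (𝓝[>] 0)
      (𝓝 (∫ z, commKer A f g z)) := by
    refine tendsto_integral_filter_of_dominated_convergence _ ?_ ?_
      (integrable_commMajorant.const_mul (M * (4 * C * L + 2 * C ^ 2))) ?_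
    · filter_upwards [self_mem_nhdsWithin] with ε hε
      have := hf.continuous
      have := hg.continuous
      have := continuous_regKer hε
      exact Continuous.aestronglyMeasurable (by fun_prop)
    · refine Eventually.of_forall fun ε => Eventually.of_forall fun z => ?_
      refine le_trans ?_ (norm_commKer_le hf hg hA z)
      rw [commKer, norm_mul, norm_mul, smul_eq_mul, norm_mul, norm_mul]
      rcases eq_or_ne (z.1 - z.2) 0 with h0 | h0
      · rw [sub_eq_zero.mp h0]; simp
      · gcongr
        refine (abs_regKer_le _ _).trans ?_
        have hpos : 0 < (z.1 - z.2) ^ 2 := by positivity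
        refine le_trans ?_ (le_abs_self _)
        simp only [RCLike.ofReal_real_eq_id, id_eq]
        gcongr
        nlinarith [sq_nonneg ε]
    · refine Eventually.of_forall fun z => ?_
      rcases eq_or_ne (z.1 - z.2) 0 with h0 | h0
      · have h1 := sub_eq_zero.mp h0
        simp [commKer, h1]
      · rw [commKer, smul_eq_mul]
        refine Tendsto.mul_const _ (Tendsto.const_mul _ ?_)
        have hc : ContinuousAt (fun ε => regKer ε (z.1 - z.2)) 0 := by
          unfold regKer
          refine ContinuousAt.div (by fun_prop) (by fun_prop) ?_
          positivity
        have h2 := hc.tendsto.mono_left (nhdsWithin_le_nhds (s := Set.Ioi 0))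
        convert h2 using 2
        simp only [RCLike.ofReal_real_eq_id, id_eq, regKer]
        field_simp
        ring
  have hlim2 : ∀ {H : ℂ → ℂ} {k : ℝ → ℝ}, HardyPlus s H → TestBound C L k →
      Tendsto (fun ε : ℝ => ∫ x : ℝ, A x * k x *
        (-(2 * Real.pi) * (deriv H (x + ε * Complex.I)).im)) (𝓝[>] 0)
      (𝓝 (∫ x : ℝ, A x * k x * (-(2 * Real.pi) * (deriv H x).im))) := by
    intro H k hH hk
    obtain ⟨B, hB0, hB⟩ := hH.derivative.dec.exists_bound
    refine tendsto_integral_filter_of_dominated_convergence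
      (fun x => N * ‖k x‖ * (2 * Real.pi * B)) ?_ ?_
      ((hk.integrable.norm.const_mul N).mul_const _) ?_
    · filter_upwards [self_mem_nhdsWithin] with ε (hε : 0 < ε)
      have h1 := hH.derivative.dec.im.continuous_line (y := ε) (by linarith)
      have := hk.continuous
      exact Continuous.aestronglyMeasurable (by fun_prop)
    · filter_upwards [self_mem_nhdsWithin] with ε (hε : 0 < ε)
      refine Eventually.of_forall fun x => ?_
      have h1 : |(deriv H (x + ε * Complex.I)).im| ≤ B :=
        (Complex.abs_im_le_norm _).trans (hB _ (mem_halfPlane_line (by linarith)))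
      have h2 := hN x
      have hpi : ‖-(2 * Real.pi)‖ = 2 * Real.pi := by
        rw [norm_neg, Real.norm_of_nonneg (by positivity)]
      rw [norm_mul, norm_mul, norm_mul, hpi, Real.norm_eq_abs (A x),
        Real.norm_eq_abs (Complex.im _)]
      gcongr
    · refine Eventually.of_forall fun x => Tendsto.const_mul _ (Tendsto.const_mul _ ?_)
      have h1 : ContinuousAt (deriv H) x :=
        (hH.derivative.hasDerivAt (ofReal_mem_halfPlane hs x)).continuousAt
      have h2 : Tendsto (fun ε : ℝ => (x + ε * Complex.I : ℂ)) (𝓝[>] 0) (𝓝 (x : ℂ)) := by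
        have hc : Continuous fun ε : ℝ => (x + ε * Complex.I : ℂ) := by fun_prop
        have := (hc.tendsto 0).mono_left (nhdsWithin_le_nhds (s := Set.Ioi 0))
        simpa using this
      exact (Complex.continuous_im.tendsto _).comp (h1.tendsto.comp h2)
  have hlim3 := ((hlim2 hF hg).sub (hlim2 hG hf)).const_mul 2
  have heq := tendsto_nhds_unique (hlim1.congr' (by
    filter_upwards [self_mem_nhdsWithin] with ε hε using hI ε hε)) hlim3
  have hint : ∀ {H : ℂ → ℂ} {k : ℝ → ℝ}, HardyPlus s H → TestBound C L k →
      Integrable fun x : ℝ => A x * k x * (-(2 * Real.pi) * (deriv H x).im) := by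
    intro H k hH hk
    obtain ⟨B, hB0, hB⟩ := hH.derivative.dec.exists_bound
    refine ((hk.integrable.norm.const_mul N).mul_const (2 * Real.pi * B)).mono' ?_
      (Eventually.of_forall fun x => ?_)
    · have h1 := hH.derivative.dec.im.continuous_real hs
      have := hk.continuous
      exact Continuous.aestronglyMeasurable (by fun_prop)
    · have h1 : |(deriv H x).im| ≤ B :=
        (Complex.abs_im_le_norm _).trans (hB _ (ofReal_mem_halfPlane hs x))
      have h2 := hN x
      have hpi : ‖-(2 * Real.pi)‖ = 2 * Real.pi := by
        rw [norm_neg, Real.norm_of_nonneg (by positivity)]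
      rw [norm_mul, norm_mul, norm_mul, hpi, Real.norm_eq_abs (A x),
        Real.norm_eq_abs (Complex.im _)]
      gcongr
  rw [heq, ← integral_sub (hint hF hg) (hint hG hf), ← integral_const_mul, ← integral_const_mul]
  congr 1
  funext x
  ring

/-! ### The estimate on holomorphic data. -/

/-- Since `2 Re V = V + V̄` and `V F' G` is holomorphic with integral zero, only the conjugate part
contributes, and the trilinear estimate applies to it. -/
lemma HardyPlus.norm_integral_ofReal_mul_le {s p q : ℝ} (hs : 0 < s)
    (hpq : p.HolderConjugate q) (hp2 : p ≤ 2) {V F G : ℂ → ℂ} (hV : HardyPlus s V)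
    (hF : HardyPlus s F) (hG : HardyPlus s G) (hu : ∀ x : ℝ, |(2 * deriv V x).re| ≤ 1) :
    ‖∫ x : ℝ, ((2 * (V x).re : ℝ) : ℂ) * (deriv F x * G x)‖ ≤
      6 * ((∫ x : ℝ, ‖F x‖ ^ p) + ∫ x : ℝ, ‖G x‖ ^ q) := by
  have hF1 := hF.derivative
  have h1 : Dec s 3 fun z => V z * (deriv F z * G z) := hV.dec.mul (hF1.dec.mul hG.dec)
  have h2 : Dec s 3 fun z => starRingEnd ℂ (V z) * (deriv F z * G z) :=
    hV.dec.conj.mul (hF1.dec.mul hG.dec)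
  have h0 := integral_eq_zero_of_holomorphic hs (hV.diff.mul (hF1.diff.mul hG.diff))
    (h1.mono (by norm_num : 2 ≤ 3))
  have hsplit : ∀ x : ℝ, ((2 * (V x).re : ℝ) : ℂ) * (deriv F x * G x) =
      V x * (deriv F x * G x) + starRingEnd ℂ (V x) * (deriv F x * G x) := by
    intro x
    rw [← add_mul, Complex.add_conj]
  simp_rw [hsplit]
  rw [integral_add ((h1.mono (by norm_num)).integrable_real hs)
    ((h2.mono (by norm_num)).integrable_real hs)]
  simp only [Pi.mul_apply] at h0
  rw [h0, zero_add]
  exact hV.norm_integral_conj_mul_deriv_mul_le hs hpq hp2 hF hG hu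

lemma integral_mul_norm_le {p q : ℝ} {s : ℝ} (hs : 0 < s) (hpq : p.HolderConjugate q)
    {F G : ℂ → ℂ} (hF : HardyPlus s F) (hG : HardyPlus s G) {φ : ℝ → ℂ}
    (hφ : ∀ x, ‖φ x‖ ≤ ‖F x‖ * ‖G x‖) :
    ‖∫ x, φ x‖ ≤ (∫ x : ℝ, ‖F x‖ ^ p) + ∫ x : ℝ, ‖G x‖ ^ q := by
  have i1 := hF.dec.integrable_rpow hs hpq.lt
  have i2 := hG.dec.integrable_rpow hs hpq.symm.lt
  rw [← integral_add i1 i2]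
  refine norm_integral_le_of_norm_le (i1.fun_add i2) (Eventually.of_forall fun x => ?_)
  exact (hφ x).trans (mul_le_add_rpow hpq (norm_nonneg _) (norm_nonneg _))

/-- The integrand is the imaginary part of `A (2 F' G - (F G)' + (F Ḡ)')`. The last two terms are
integrated by parts onto the bounded `A'` and cost `1` each; the first costs `2 · 6`. -/
lemma HardyPlus.abs_integral_mul_im_le {s p q : ℝ} (hs : 0 < s)
    (hpq : p.HolderConjugate q) (hp2 : p ≤ 2) {V F G : ℂ → ℂ} (hV : HardyPlus s V)
    (hF : HardyPlus s F) (hG : HardyPlus s G) (hu : ∀ x : ℝ, |(2 * deriv V x).re| ≤ 1) :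
    |∫ x : ℝ, 2 * (V x).re * (2 * (G x).re * (deriv F x).im - 2 * (F x).re * (deriv G x).im)| ≤
      14 * ((∫ x : ℝ, ‖F x‖ ^ p) + ∫ x : ℝ, ‖G x‖ ^ q) := by
  have hF1 := hF.derivative
  have hG1 := hG.derivative
  have hV1 := hV.derivative
  set A : ℝ → ℂ := fun x => ((2 * (V x).re : ℝ) : ℂ) with hA
  set A' : ℝ → ℂ := fun x => ((2 * (deriv V x).re : ℝ) : ℂ) with hA'
  have dr : ∀ {H : ℂ → ℂ}, HardyPlus s H → ∀ x : ℝ, HasDerivAt (fun x : ℝ => H x) (deriv H x) x :=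
    fun hH x => (hH.hasDerivAt (ofReal_mem_halfPlane hs x)).comp_ofReal
  have dA : ∀ x, HasDerivAt A (A' x) x := fun x =>
    (((dr hV x).complex_re).const_mul 2).ofReal_comp
  have decA : ∀ {W : ℂ → ℂ}, HardyPlus s W → Dec s 1 fun z => ((2 * (W z).re : ℝ) : ℂ) := by
    intro W hW
    simp_rw [← Complex.add_conj]
    exact hW.dec.add hW.dec.conj
  have parts : ∀ {K K' : ℂ → ℂ}, Dec s 2 K → Dec s 2 K' →
      (∀ x : ℝ, HasDerivAt (fun x : ℝ => K x) (K' x) x) →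
      ∫ x : ℝ, A x * K' x = -∫ x : ℝ, A' x * K x := by
    intro K K' hK hK' hd
    exact integral_mul_deriv_eq_deriv_mul_of_integrable (u := A) (u' := A')
      (v := fun x : ℝ => K x) (v' := fun x : ℝ => K' x) (fun x _ => dA x) (fun x _ => hd x)
      ((((decA hV).mul hK').mono (by norm_num)).integrable_real hs)
      ((((decA hV1).mul hK).mono (by norm_num)).integrable_real hs)
      ((((decA hV).mul hK).mono (by norm_num)).integrable_real hs)
  have d1 : Dec s 2 fun z => F z * G z := hF.dec.mul hG.dec
  have d1' : Dec s 2 fun z => deriv F z * G z + F z * deriv G z :=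
    (hF1.dec.mul hG.dec).add (hF.dec.mul hG1.dec)
  have d2 : Dec s 2 fun z => F z * starRingEnd ℂ (G z) := hF.dec.mul hG.dec.conj
  have d2' : Dec s 2 fun z =>
      deriv F z * starRingEnd ℂ (G z) + F z * starRingEnd ℂ (deriv G z) :=
    (hF1.dec.mul hG.dec.conj).add (hF.dec.mul hG1.dec.conj)
  have p1 := parts d1 d1' fun x => (dr hF x).fun_mul (dr hG x)
  have p2 := parts d2 d2' fun x => (dr hF x).fun_mul (dr hG x).complex_conj
  have e0 := HardyPlus.norm_integral_ofReal_mul_le hs hpq hp2 hV hF hG hu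
  have hA1 : ∀ x, ‖A' x‖ ≤ 1 := by
    intro x
    have := hu x
    rw [Complex.norm_real, Real.norm_eq_abs]
    simpa using this
  have e1 : ‖∫ x : ℝ, A' x * (F x * G x)‖ ≤ (∫ x : ℝ, ‖F x‖ ^ p) + ∫ x : ℝ, ‖G x‖ ^ q := by
    refine integral_mul_norm_le hs hpq hF hG fun x => ?_
    rw [norm_mul, norm_mul]
    exact mul_le_of_le_one_left (by positivity) (hA1 x)
  have e2 : ‖∫ x : ℝ, A' x * (F x * starRingEnd ℂ (G x))‖ ≤
      (∫ x : ℝ, ‖F x‖ ^ p) + ∫ x : ℝ, ‖G x‖ ^ q := by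
    refine integral_mul_norm_le hs hpq hF hG fun x => ?_
    rw [norm_mul, norm_mul, RCLike.norm_conj]
    exact mul_le_of_le_one_left (by positivity) (hA1 x)
  have hpt : ∀ x : ℝ,
      2 * (V x).re * (2 * (G x).re * (deriv F x).im - 2 * (F x).re * (deriv G x).im) =
      ((2 * (A x * (deriv F x * G x)) - A x * (deriv F x * G x + F x * deriv G x)) +
        A x * (deriv F x * starRingEnd ℂ (G x) + F x * starRingEnd ℂ (deriv G x))).im := by
    intro x
    simp only [hA, Complex.add_im, Complex.sub_im, Complex.mul_im, Complex.mul_re, Complex.add_re,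
      Complex.ofReal_re, Complex.ofReal_im, Complex.conj_re, Complex.conj_im, Complex.re_ofNat,
      Complex.im_ofNat]
    ring
  have i0 : Integrable fun x : ℝ => 2 * (A x * (deriv F x * G x)) :=
    (((decA hV).mul (hF1.dec.mul hG.dec)).mono (by norm_num)).integrable_real hs |>.const_mul 2
  have i1 : Integrable fun x : ℝ => A x * (deriv F x * G x + F x * deriv G x) :=
    (((decA hV).mul d1').mono (by norm_num)).integrable_real hs
  have i2 : Integrable fun x : ℝ =>
      A x * (deriv F x * starRingEnd ℂ (G x) + F x * starRingEnd ℂ (deriv G x)) :=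
    (((decA hV).mul d2').mono (by norm_num)).integrable_real hs
  simp_rw [hpt]
  have him : ∫ x : ℝ, (((2 * (A x * (deriv F x * G x)) -
      A x * (deriv F x * G x + F x * deriv G x)) +
        A x * (deriv F x * starRingEnd ℂ (G x) + F x * starRingEnd ℂ (deriv G x))).im) =
      (∫ x : ℝ, ((2 * (A x * (deriv F x * G x)) -
      A x * (deriv F x * G x + F x * deriv G x)) +
        A x * (deriv F x * starRingEnd ℂ (G x) + F x * starRingEnd ℂ (deriv G x)))).im :=
    integral_im ((i0.sub' i1).fun_add i2)
  rw [him, integral_add (i0.sub' i1) i2, integral_sub i0 i1, integral_const_mul, p1, p2]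
  refine (Complex.abs_im_le_norm _).trans ?_
  have t1 := norm_add_le (2 * (∫ x : ℝ, A x * (deriv F x * G x)) - -∫ x : ℝ, A' x * (F x * G x))
    (-∫ x : ℝ, A' x * (F x * starRingEnd ℂ (G x)))
  have t2 := norm_sub_le (2 * ∫ x : ℝ, A x * (deriv F x * G x)) (-∫ x : ℝ, A' x * (F x * G x))
  rw [norm_neg] at t1 t2
  rw [norm_mul, Complex.norm_ofNat] at t2
  linarith

/-- The commutator form on boundary values of functions holomorphic in a larger half plane. -/
theorem exists_abs_integral_commKer_le_of_hardy {p q : ℝ} (hpq : p.HolderConjugate q)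
    (hp2 : p ≤ 2) : ∃ K, 0 ≤ K ∧ ∀ (s : ℝ) (V F G : ℂ → ℂ) (A f g : ℝ → ℝ) (C L N : ℝ), 0 < s →
      HardyPlus s V → HardyPlus s F → HardyPlus s G → TestBound C L f → TestBound C L g →
      (∀ x y, ‖A x - A y‖ ≤ 1 * |x - y|) → (∀ x, |A x| ≤ N) →
      (∀ x : ℝ, A x = 2 * (V x).re) → (∀ x : ℝ, f x = 2 * (F x).re) →
      (∀ x : ℝ, g x = 2 * (G x).re) →
      |∫ z, commKer A f g z| ≤ K * ((∫ x, |f x| ^ p) + ∫ x, |g x| ^ q) := by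
  obtain ⟨C₁, hC₁, hq⟩ := exists_integral_rpow_le_of_two_le hpq hp2
  have hp1 : 1 < p := hpq.lt
  have hp0 : 0 ≤ 2 / (p - 1) := div_nonneg (by norm_num) (by linarith)
  refine ⟨4 * Real.pi * (14 * (2 / (p - 1) + C₁)), by positivity, ?_⟩
  intro s V F G A f g C L N hs hV hF hG hf hg hA hN hAV hfF hgG
  -- The real part of `2 V'` is the derivative of the 1-Lipschitz function `A`.
  have hu : ∀ x : ℝ, |(2 * deriv V x).re| ≤ 1 := by
    intro x
    have h1 : HasDerivAt A (2 * (deriv V x).re) x := by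
      have := ((hV.hasDerivAt (ofReal_mem_halfPlane hs x)).comp_ofReal.complex_re).const_mul 2
      exact this.congr_of_eventuallyEq (Eventually.of_forall hAV)
    have h2 : LipschitzWith 1 A := by
      refine LipschitzWith.of_dist_le_mul fun a b => ?_
      rw [Real.dist_eq, Real.dist_eq]
      exact hA a b
    have h3 := h1.le_of_lipschitz h2
    simpa using h3
  have hmono : ∀ {H : ℂ → ℂ} {h : ℝ → ℝ} {r : ℝ}, (∀ x : ℝ, h x = 2 * (H x).re) → 1 < r →
      HardyPlus s H → ∫ x : ℝ, |(H x).re| ^ r ≤ ∫ x, |h x| ^ r := by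
    intro H h r hh hr hH
    have i1 : Integrable fun x : ℝ => |(H x).re| ^ r := hH.dec.re.integrable_rpow hs hr
    have i2 : Integrable fun x : ℝ => |h x| ^ r := by
      have := (hH.dec.re.const_mul 2).integrable_rpow hs hr
      simpa only [Real.norm_eq_abs, hh] using this
    refine integral_mono i1 i2 fun x => ?_
    simp only
    rw [hh, abs_mul, abs_two]
    have := abs_nonneg (H x).re
    exact Real.rpow_le_rpow this (by linarith) (by linarith)
  have hFb := (hF.integral_rpow_le hs hp1 hp2).trans
    (mul_le_mul_of_nonneg_left (hmono hfF hp1 hF) hp0)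
  have hGb := (hq s hs G hG).trans
    (mul_le_mul_of_nonneg_left (hmono hgG hpq.symm.lt hG) hC₁)
  rw [hF.integral_commKer hs hG hf hg hA hN hfF hgG, abs_mul, abs_neg, abs_of_nonneg
    (by positivity : 0 ≤ 4 * Real.pi), mul_assoc (4 * Real.pi)]
  refine mul_le_mul_of_nonneg_left ?_ (by positivity)
  simp_rw [hAV, hfF, hgG]
  refine (HardyPlus.abs_integral_mul_im_le hs hpq hp2 hV hF hG hu).trans ?_
  rw [mul_assoc]
  simp_rw [← hfF, ← hgG]
  have a0 : 0 ≤ ∫ x, |f x| ^ p := integral_nonneg fun x => by positivity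
  have b0 : 0 ≤ ∫ x, |g x| ^ q := integral_nonneg fun x => by positivity
  have a1 : 0 ≤ C₁ * ∫ x, |f x| ^ p := mul_nonneg hC₁ a0
  have b1 : 0 ≤ 2 / (p - 1) * ∫ x, |g x| ^ q := mul_nonneg hp0 b0
  nlinarith

/-! ### From holomorphic data to test functions and general Lipschitz functions. -/

section
variable {𝕜 : Type*} [RCLike 𝕜] {f g : ℝ → 𝕜}

lemma TestBound.mono {C L C' L' : ℝ} (h : TestBound C L f) (hC : C ≤ C') (hL : L ≤ L') :
    TestBound C' L' f :=
  ⟨fun x => (h.decay x).trans (by gcongr), fun x y => (h.lip x y).trans (by gcongr)⟩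

/-- Continuously differentiable functions with compact support. -/
structure IsTest (f : ℝ → 𝕜) : Prop where
  smooth : ContDiff ℝ 1 f
  supp : HasCompactSupport f

lemma IsTest.exists_testBound (h : IsTest f) : ∃ C L, TestBound C L f := by
  obtain ⟨L, hL⟩ := h.smooth.lipschitzWith_of_hasCompactSupport h.supp one_ne_zero
  have hc := h.smooth.continuous
  obtain ⟨C, hC⟩ := (show Continuous fun x => (1 + x ^ 2) * ‖f x‖ by
    fun_prop).bounded_above_of_compact_support (h.supp.norm.mul_left)
  refine ⟨C, L, fun x => ?_, fun x y => ?_⟩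
  · have h1 := hC x
    rw [Real.norm_of_nonneg (by positivity)] at h1
    rw [← div_eq_mul_inv, le_div_iff₀ (by positivity)]
    linarith
  · have := hL.dist_le_mul x y
    rwa [dist_eq_norm, Real.dist_eq] at this

lemma IsTest.exists_testBound₂ (hf : IsTest f) (hg : IsTest g) :
    ∃ C L, TestBound C L f ∧ TestBound C L g := by
  obtain ⟨C, L, h⟩ := hf.exists_testBound
  obtain ⟨C', L', h'⟩ := hg.exists_testBound
  exact ⟨max C C', max L L', h.mono (le_max_left _ _) (le_max_left _ _),
    h'.mono (le_max_right _ _) (le_max_right _ _)⟩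

end

lemma exists_testBound_poissonMean {φ : ℝ → ℝ} (h : IsTest φ) :
    ∃ C L, ∀ s, 0 < s → s ≤ 1 → TestBound C L (poissonMean φ s) := by
  obtain ⟨C, L, hb⟩ := h.exists_testBound
  have hc := h.smooth.continuous
  obtain ⟨M, hM⟩ := hc.bounded_above_of_compact_support h.supp
  obtain ⟨C', -, hC'⟩ := exists_abs_poissonMean_le hc h.supp
  exact ⟨C', L, fun s hs hs1 => ⟨hC' s hs hs1, abs_poissonMean_sub_le hc hM hb.lip⟩⟩

/-- The Poisson means of `A`, `f`, `g` are boundary values of holomorphic functions, obey test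
bounds uniform in `s`, and converge with their `p`-th and `q`-th power integrals as `s → 0`. -/
lemma abs_integral_commKer_le_of_compact {p q K : ℝ} (hpq : p.HolderConjugate q)
    (hK : ∀ (s : ℝ) (V F G : ℂ → ℂ) (A f g : ℝ → ℝ) (C L N : ℝ), 0 < s →
      HardyPlus s V → HardyPlus s F → HardyPlus s G → TestBound C L f → TestBound C L g →
      (∀ x y, ‖A x - A y‖ ≤ 1 * |x - y|) → (∀ x, |A x| ≤ N) →
      (∀ x : ℝ, A x = 2 * (V x).re) → (∀ x : ℝ, f x = 2 * (F x).re) →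
      (∀ x : ℝ, g x = 2 * (G x).re) →
      |∫ z, commKer A f g z| ≤ K * ((∫ x, |f x| ^ p) + ∫ x, |g x| ^ q))
    {A f g : ℝ → ℝ} (hf : IsTest f) (hg : IsTest g) (hA : ∀ x y, ‖A x - A y‖ ≤ 1 * |x - y|)
    (hA' : HasCompactSupport A) :
    |∫ z, commKer A f g z| ≤ K * ((∫ x, |f x| ^ p) + ∫ x, |g x| ^ q) := by
  have hAc : Continuous A := continuous_of_lip hA
  have hfc := hf.smooth.continuous
  have hgc := hg.smooth.continuous
  obtain ⟨C₁, L₁, h1⟩ := exists_testBound_poissonMean hf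
  obtain ⟨C₂, L₂, h2⟩ := exists_testBound_poissonMean hg
  obtain ⟨M, hM⟩ := hAc.bounded_above_of_compact_support hA'
  obtain ⟨N, -, hN⟩ := exists_abs_poissonMean_le hAc hA'
  obtain ⟨Mf, hMf⟩ := hfc.bounded_above_of_compact_support hf.supp
  obtain ⟨Mg, hMg⟩ := hgc.bounded_above_of_compact_support hg.supp
  have hev : ∀ᶠ s : ℝ in 𝓝[>] 0, 0 < s ∧ s ≤ 1 :=
    Ioc_mem_nhdsGT one_pos
  have hlf : ∀ s : ℝ, 0 < s ∧ s ≤ 1 → TestBound (max C₁ C₂) (max L₁ L₂) (poissonMean f s) :=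
    fun s hs => (h1 s hs.1 hs.2).mono (le_max_left _ _) (le_max_left _ _)
  have hlg : ∀ s : ℝ, 0 < s ∧ s ≤ 1 → TestBound (max C₁ C₂) (max L₁ L₂) (poissonMean g s) :=
    fun s hs => (h2 s hs.1 hs.2).mono (le_max_right _ _) (le_max_right _ _)
  have hlim := tendsto_integral_commKer (l := 𝓝[>] (0 : ℝ)) (hev.mono hlf) (hev.mono hlg)
    (Eventually.of_forall fun s => abs_poissonMean_sub_le (s := s) hAc hM hA)
    (tendsto_poissonMean hfc hMf) (tendsto_poissonMean hgc hMg) (tendsto_poissonMean hAc hM)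
  have hlim' := ((tendsto_integral_poissonMean_rpow hfc hf.supp hpq.lt).add
    (tendsto_integral_poissonMean_rpow hgc hg.supp hpq.symm.lt)).const_mul K
  refine le_of_tendsto_of_tendsto hlim.abs hlim' ?_
  filter_upwards [hev] with s hs
  refine hK (s / 4) (cauchyExt A s) (cauchyExt f s) (cauchyExt g s) _ _ _ (max C₁ C₂)
    (max L₁ L₂) N (by linarith [hs.1]) (hardyPlus_cauchyExt hAc hA' hs.1)
    (hardyPlus_cauchyExt hfc hf.supp hs.1) (hardyPlus_cauchyExt hgc hg.supp hs.1) (hlf s hs)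
    (hlg s hs) (abs_poissonMean_sub_le hAc hM hA) (fun x => (hN s hs.1 hs.2 x).trans ?_)
    (fun x => (two_mul_re_cauchyExt hAc hA' hs.1 x).symm)
    (fun x => (two_mul_re_cauchyExt hfc hf.supp hs.1 x).symm)
    (fun x => (two_mul_re_cauchyExt hgc hg.supp hs.1 x).symm)
  have hN0 : 0 ≤ N := by
    have := (abs_nonneg _).trans (hN s hs.1 hs.2 0)
    simpa using this
  refine mul_le_of_le_one_right hN0 (inv_le_one_of_one_le₀ ?_)
  nlinarith [sq_nonneg x]

/-- Truncation of a Lipschitz function to compact support. -/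
noncomputable def lipTrunc (A : ℝ → ℝ) (ρ x : ℝ) : ℝ :=
  max (min (A x - A 0) (max (ρ - |x|) 0)) (-(max (ρ - |x|) 0))

/-- Minima and maxima of 1-Lipschitz functions are 1-Lipschitz, so this truncation loses nothing in
the constant, unlike multiplication by a cutoff. -/
lemma lipTrunc_sub_le {A : ℝ → ℝ} (hA : ∀ x y, ‖A x - A y‖ ≤ 1 * |x - y|) (ρ x y : ℝ) :
    ‖lipTrunc A ρ x - lipTrunc A ρ y‖ ≤ 1 * |x - y| := by
  have h1 : LipschitzWith 1 fun x => A x - A 0 := by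
    refine LipschitzWith.of_dist_le_mul fun a b => ?_
    rw [Real.dist_eq, Real.dist_eq, sub_sub_sub_cancel_right]
    exact hA a b
  have h2 : LipschitzWith 1 fun x : ℝ => max (ρ - |x|) 0 := by
    refine LipschitzWith.max_const (LipschitzWith.of_dist_le_mul fun a b => ?_) 0
    rw [Real.dist_eq, Real.dist_eq, sub_sub_sub_cancel_left, abs_sub_comm a b]
    simpa using abs_abs_sub_abs_le_abs_sub b a
  have h3 := (h1.min h2).max h2.neg
  have h4 := h3.dist_le_mul x y
  rw [Real.dist_eq, Real.dist_eq] at h4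
  simpa [lipTrunc] using h4

lemma hasCompactSupport_lipTrunc (A : ℝ → ℝ) (ρ : ℝ) : HasCompactSupport (lipTrunc A ρ) := by
  refine HasCompactSupport.intro (isCompact_Icc (a := -ρ) (b := ρ)) fun x hx => ?_
  have h1 : ρ < |x| := by
    by_contra! h
    exact hx (abs_le.mp h)
  rw [lipTrunc, max_eq_right (by linarith : ρ - |x| ≤ 0), neg_zero]
  exact max_eq_right (min_le_right _ _)

lemma lipTrunc_eq {A : ℝ → ℝ} (hA : ∀ x y, ‖A x - A y‖ ≤ 1 * |x - y|) {ρ x : ℝ}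
    (h : 2 * |x| ≤ ρ) : lipTrunc A ρ x = A x - A 0 := by
  have h1 := hA x 0
  rw [sub_zero, one_mul, Real.norm_eq_abs, abs_le] at h1
  have h2 : |x| ≤ ρ - |x| := by linarith
  rw [lipTrunc, max_eq_left (by linarith [abs_nonneg x] : 0 ≤ ρ - |x|), min_eq_left (by linarith),
    max_eq_left (by linarith)]

/-- The commutator estimate on test functions. -/
theorem exists_abs_integral_commKer_le {p q : ℝ} (hpq : p.HolderConjugate q) :
    ∃ K, 0 ≤ K ∧ ∀ A f g : ℝ → ℝ, IsTest f → IsTest g → (∀ x y, ‖A x - A y‖ ≤ 1 * |x - y|) →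
      |∫ z, commKer A f g z| ≤ K * ((∫ x, |f x| ^ p) + ∫ x, |g x| ^ q) := by
  -- One of two conjugate exponents is at most `2`, and exchanging `f` and `g` only changes the sign
  -- of the kernel.
  wlog hp2 : p ≤ 2 generalizing p q
  · have hq2 : q ≤ 2 := by
      have h1 := hpq.inv_add_inv_eq_one
      by_contra! hq
      have h2 : p⁻¹ < 2⁻¹ := inv_strictAnti₀ (by norm_num) (by linarith)
      have h3 : q⁻¹ < 2⁻¹ := inv_strictAnti₀ (by norm_num) (by linarith)
      norm_num at h2 h3
      linarith
    obtain ⟨K, hK0, hK⟩ := this hpq.symm hq2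
    refine ⟨K, hK0, fun A f g hf hg hA => ?_⟩
    have h1 := hK A g f hg hf hA
    simp_rw [commKer_swap (A := A) (f := f) (g := g)] at h1
    rwa [integral_neg, abs_neg, add_comm] at h1
  obtain ⟨K, hK0, hK⟩ := exists_abs_integral_commKer_le_of_hardy hpq hp2
  refine ⟨K, hK0, fun A f g hf hg hA => ?_⟩
  obtain ⟨C, L, h1, h2⟩ := hf.exists_testBound₂ hg
  have hlim := tendsto_integral_commKer (l := (atTop : Filter ℕ)) (f' := fun _ => f)
    (g' := fun _ => g) (A' := fun n => lipTrunc A n) (A := fun x => A x - A 0)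
    (Eventually.of_forall fun _ => h1) (Eventually.of_forall fun _ => h2)
    (Eventually.of_forall fun n => lipTrunc_sub_le hA n) (fun _ => tendsto_const_nhds)
    (fun _ => tendsto_const_nhds) (fun x => by
      refine tendsto_const_nhds.congr' ?_
      filter_upwards [tendsto_natCast_atTop_atTop.eventually_ge_atTop (2 * |x|)] with n hn
      exact (lipTrunc_eq hA hn).symm)
  -- The kernel involves only differences of `A`, so subtracting `A 0`, needed for compact
  -- truncation, is harmless.
  have heq : commKer (fun x => A x - A 0) f g = commKer A f g := by
    funext z
    simp [commKer]
  rw [heq] at hlim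
  exact le_of_tendsto hlim.abs (Eventually.of_forall fun n =>
    abs_integral_commKer_le_of_compact hpq hK hf hg (lipTrunc_sub_le hA n)
      (hasCompactSupport_lipTrunc A n))

/-! ### Bounds uniform in the truncation. -/

lemma IsTest.integrable_rpow {𝕜 : Type*} [RCLike 𝕜] {f : ℝ → 𝕜} (hf : IsTest f) {p : ℝ}
    (hp : 0 < p) : Integrable fun x => ‖f x‖ ^ p := by
  have hc : Continuous fun x => ‖f x‖ ^ p :=
    hf.smooth.continuous.norm.rpow_const fun x => Or.inr hp.le
  refine hc.integrable_of_hasCompactSupport ?_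
  exact hf.supp.comp_left (g := fun c : 𝕜 => ‖c‖ ^ p) (by simp [hp.ne'])

lemma IsTest.mul_smooth {f u : ℝ → ℝ} (hf : IsTest f) (hu : ContDiff ℝ 1 u) :
    IsTest fun x => f x * u x :=
  ⟨hf.smooth.mul hu, hf.supp.mul_right⟩

/-- The addition formula for the cosine: modulating both functions, which does not increase their
sizes, acts as a multiplier depending on `x - y` only. -/
lemma commKer_cos_add_sin (A f g : ℝ → ℝ) (ξ : ℝ) (z : ℝ × ℝ) :
    commKer A (fun x => f x * Real.cos (ξ * x)) (fun x => g x * Real.cos (ξ * x)) z +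
      commKer A (fun x => f x * Real.sin (ξ * x)) (fun x => g x * Real.sin (ξ * x)) z =
      Real.cos (ξ * (z.1 - z.2)) * commKer A f g z := by
  simp only [commKer, smul_eq_mul, mul_sub ξ, Real.cos_sub]
  ring

lemma integral_cos_gaussianReal {l : ℝ} (hl : 0 ≤ l) (t : ℝ) :
    ∫ ξ, Real.cos (ξ * t) ∂(ProbabilityTheory.gaussianReal 0 (2 * l).toNNReal) =
      Real.exp (-l * t ^ 2) := by
  have h := ProbabilityTheory.charFun_gaussianReal (μ := 0) (v := (2 * l).toNNReal) t
  rw [charFun_apply_real] at h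
  have h1 := congrArg Complex.re h
  have hint : Integrable (fun ξ : ℝ => Complex.exp (t * ξ * Complex.I))
      (ProbabilityTheory.gaussianReal 0 (2 * l).toNNReal) := by
    refine Integrable.of_bound (C := 1) (Continuous.aestronglyMeasurable (by fun_prop))
      (Eventually.of_forall fun ξ => ?_)
    rw [← Complex.ofReal_mul, Complex.norm_exp_ofReal_mul_I]
  have h2 : ∫ ξ : ℝ, (Complex.exp (t * ξ * Complex.I)).re
      ∂(ProbabilityTheory.gaussianReal 0 (2 * l).toNNReal) =
      (∫ ξ : ℝ, Complex.exp (t * ξ * Complex.I)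
      ∂(ProbabilityTheory.gaussianReal 0 (2 * l).toNNReal)).re := integral_re hint
  rw [← h2] at h1
  have h3 : ∀ ξ : ℝ, (Complex.exp (t * ξ * Complex.I)).re = Real.cos (ξ * t) := by
    intro ξ
    rw [← Complex.ofReal_mul, Complex.exp_ofReal_mul_I_re, mul_comm]
  simp_rw [h3] at h1
  rw [h1]
  have h4 : ((t : ℂ) * (0 : ℝ) * Complex.I - ((2 * l).toNNReal : ℂ) * t ^ 2 / 2) =
      ((-l * t ^ 2 : ℝ) : ℂ) := by
    have : ((2 * l).toNNReal : ℂ) = ((2 * l : ℝ) : ℂ) := by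
      rw [← Real.coe_toNNReal (2 * l) (by positivity)]
      simp
    rw [this]
    push_cast
    ring
  rw [h4, Complex.exp_ofReal_re]

section
variable {p q K : ℝ} (hpq : p.HolderConjugate q)
  (hK : ∀ A f g : ℝ → ℝ, IsTest f → IsTest g → (∀ x y, ‖A x - A y‖ ≤ 1 * |x - y|) →
      |∫ z, commKer A f g z| ≤ K * ((∫ x, |f x| ^ p) + ∫ x, |g x| ^ q))
  {A f g : ℝ → ℝ} (hf : IsTest f) (hg : IsTest g) (hA : ∀ x y, ‖A x - A y‖ ≤ 1 * |x - y|)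

include hpq hK hf hg hA in
lemma abs_integral_cos_mul_commKer_le (hK0 : 0 ≤ K) (ξ : ℝ) :
    |∫ z : ℝ × ℝ, Real.cos (ξ * (z.1 - z.2)) * commKer A f g z| ≤
      2 * K * ((∫ x, |f x| ^ p) + ∫ x, |g x| ^ q) := by
  have hcos : ContDiff ℝ 1 fun x => Real.cos (ξ * x) := by fun_prop
  have hsin : ContDiff ℝ 1 fun x => Real.sin (ξ * x) := by fun_prop
  have hint : ∀ {u : ℝ → ℝ}, ContDiff ℝ 1 u →
      Integrable (commKer A (fun x => f x * u x) fun x => g x * u x) := by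
    intro u hu
    obtain ⟨C, L, h1, h2⟩ := (hf.mul_smooth hu).exists_testBound₂ (hg.mul_smooth hu)
    exact integrable_commKer h1 h2 hA
  have hb : ∀ {u : ℝ → ℝ}, ContDiff ℝ 1 u → (∀ x, |u x| ≤ 1) →
      |∫ z, commKer A (fun x => f x * u x) (fun x => g x * u x) z| ≤
        K * ((∫ x, |f x| ^ p) + ∫ x, |g x| ^ q) := by
    intro u hu hu1
    refine (hK A _ _ (hf.mul_smooth hu) (hg.mul_smooth hu) hA).trans ?_
    have hm : ∀ {h : ℝ → ℝ} {r : ℝ}, IsTest h → 0 < r →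
        ∫ x, |h x * u x| ^ r ≤ ∫ x, |h x| ^ r := by
      intro h r hh hr
      refine integral_mono ((hh.mul_smooth hu).integrable_rpow hr) (hh.integrable_rpow hr)
        fun x => ?_
      simp only
      refine Real.rpow_le_rpow (abs_nonneg _) ?_ hr.le
      rw [abs_mul]
      exact mul_le_of_le_one_right (abs_nonneg _) (hu1 x)
    have h1 := hm hf hpq.pos
    have h2 := hm hg hpq.symm.pos
    exact mul_le_mul_of_nonneg_left (add_le_add h1 h2) hK0
  simp_rw [← commKer_cos_add_sin]
  rw [integral_add (hint hcos) (hint hsin)]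
  have h1 := hb hcos fun x => Real.abs_cos_le_one _
  have h2 := hb hsin fun x => Real.abs_sin_le_one _
  refine (abs_add_le _ _).trans ?_
  linarith

-- The Gaussian is the average of `cos(ξ(x - y))` over a centred normal `ξ` of variance `2l`. An
-- average of forms bounded uniformly in `ξ` satisfies the same bound.
include hpq hK hf hg hA in
lemma abs_integral_exp_mul_commKer_le (hK0 : 0 ≤ K) {l : ℝ} (hl : 0 ≤ l) :
    |∫ z : ℝ × ℝ, Real.exp (-l * (z.1 - z.2) ^ 2) * commKer A f g z| ≤
      2 * K * ((∫ x, |f x| ^ p) + ∫ x, |g x| ^ q) := by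
  set γ := ProbabilityTheory.gaussianReal 0 (2 * l).toNNReal with hγ
  obtain ⟨C, L, h1, h2⟩ := hf.exists_testBound₂ hg
  have hi := integrable_commKer h1 h2 hA
  have hprod : Integrable (Function.uncurry fun (ξ : ℝ) (z : ℝ × ℝ) =>
      Real.cos (ξ * (z.1 - z.2)) * commKer A f g z) (γ.prod volume) := by
    have h3 : Integrable (fun w : ℝ × (ℝ × ℝ) => (1 : ℝ) * commKer A f g w.2) (γ.prod volume) :=
      (integrable_const (1 : ℝ)).mul_prod hi
    refine h3.norm.mono' ?_ (Eventually.of_forall fun w => ?_)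
    · refine AEStronglyMeasurable.mul ?_ hi.1.comp_snd
      exact Continuous.aestronglyMeasurable (by fun_prop)
    · simp only [Function.uncurry, norm_mul, norm_one]
      gcongr
      exact Real.abs_cos_le_one _
  have hswap := integral_integral_swap hprod
  have heq : ∀ z : ℝ × ℝ, ∫ ξ, Real.cos (ξ * (z.1 - z.2)) * commKer A f g z ∂γ =
      Real.exp (-l * (z.1 - z.2) ^ 2) * commKer A f g z := by
    intro z
    rw [integral_mul_const, integral_cos_gaussianReal hl]
  simp_rw [heq] at hswap
  rw [← hswap, ← Real.norm_eq_abs]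
  have := norm_integral_le_of_norm_le_const (μ := γ) (f := fun ξ : ℝ => ∫ z : ℝ × ℝ,
    Real.cos (ξ * (z.1 - z.2)) * commKer A f g z) (Eventually.of_forall fun ξ =>
    abs_integral_cos_mul_commKer_le hpq hK hf hg hA hK0 ξ)
  simpa using this

end

section convolution
variable {k u : ℝ → ℝ}

lemma integrable_conv_snd (hk : Integrable k) (hu : Integrable u) :
    Integrable fun z : ℝ × ℝ => k (z.1 - z.2) * u z.2 := by
  have := Integrable.convolution_integrand (ContinuousLinearMap.mul ℝ ℝ) hu hk
    (μ := volume) (ν := volume)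
  refine this.congr (Eventually.of_forall fun z => ?_)
  simp only [ContinuousLinearMap.mul_apply']
  ring

lemma integrable_conv_fst (hk : Integrable k) (hu : Integrable u) :
    Integrable fun z : ℝ × ℝ => k (z.1 - z.2) * u z.1 := by
  have := (integrable_conv_snd hk.comp_neg hu).swap
  refine this.congr (Eventually.of_forall fun z => ?_)
  simp

lemma integral_conv_fst (hk : Integrable k) (hu : Integrable u) :
    ∫ z : ℝ × ℝ, k (z.1 - z.2) * u z.1 = (∫ t, k t) * ∫ x, u x := by
  have h := integrable_conv_fst hk hu
  rw [Measure.volume_eq_prod] at h ⊢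
  rw [integral_prod _ h, ← integral_const_mul]
  congr 1
  funext x
  simp only
  rw [integral_mul_const, integral_sub_left_eq_self]

lemma integral_conv_snd (hk : Integrable k) (hu : Integrable u) :
    ∫ z : ℝ × ℝ, k (z.1 - z.2) * u z.2 = (∫ t, k t) * ∫ x, u x := by
  have h := integral_conv_fst hk.comp_neg hu
  rw [integral_neg_eq_self (f := k) (μ := volume)] at h
  rw [← h, Measure.volume_eq_prod, ← integral_prod_swap]
  simp

end convolution

/-- The indicator function of the truncation region. -/
noncomputable def truncInd (ε t : ℝ) : ℝ := {t : ℝ | ε < |t| ∧ |t| < 1 / ε}.indicator 1 t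

lemma measurable_truncInd (ε : ℝ) : Measurable (truncInd ε) := by
  refine measurable_one.indicator ?_
  exact (measurableSet_lt measurable_const continuous_abs.measurable).inter
    (measurableSet_lt continuous_abs.measurable measurable_const)

lemma truncInd_neg (ε t : ℝ) : truncInd ε (-t) = truncInd ε t := by
  simp [truncInd, Set.indicator]

/-- The kernel controlling the difference between sharp and smooth truncation. -/
noncomputable def truncErr (ε t : ℝ) : ℝ :=
  3 * (ε⁻¹ * Real.exp (-(ε⁻¹ ^ 2) * t ^ 2) + ε * Real.exp (-(ε ^ 2) * t ^ 2))

lemma integrable_truncErr {ε : ℝ} (hε : 0 < ε) : Integrable (truncErr ε) :=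
  (((integrable_exp_neg_mul_sq (by positivity : 0 < ε⁻¹ ^ 2)).const_mul _).add
    ((integrable_exp_neg_mul_sq (by positivity : 0 < ε ^ 2)).const_mul _)).const_mul 3

lemma integral_truncErr {ε : ℝ} (hε : 0 < ε) : ∫ t, truncErr ε t = 6 * √Real.pi := by
  have h : ∀ {c : ℝ}, 0 < c → c * √(Real.pi / c ^ 2) = √Real.pi := by
    intro c hc
    rw [Real.sqrt_div' _ (by positivity), Real.sqrt_sq hc.le]
    field_simp
  unfold truncErr
  rw [integral_const_mul, integral_add
    ((integrable_exp_neg_mul_sq (by positivity : 0 < ε⁻¹ ^ 2)).const_mul _)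
    ((integrable_exp_neg_mul_sq (by positivity : 0 < ε ^ 2)).const_mul _), integral_const_mul,
    integral_const_mul, integral_gaussian, integral_gaussian, h hε, h (inv_pos.mpr hε)]
  ring

/-- In terms of `x = c |t|` the right side is `3 x exp(-x²)`. For `x ≤ 1` it dominates because `1 -
exp(-x²) ≤ x²` and `3 / e > 1`, for `x > 1` trivially. The value of `e` at the jump is left free in
`[0, 1]`. -/
lemma abs_step_sub_gaussian_le {c t : ℝ} (hc : 0 < c) {e : ℝ} (h1 : 1 < c * |t| → e = 1)
    (h2 : c * |t| < 1 → e = 0) (h3 : 0 ≤ e) (h4 : e ≤ 1) :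
    |e - (1 - Real.exp (-(c ^ 2) * t ^ 2))| ≤ |t| * (3 * (c * Real.exp (-(c ^ 2) * t ^ 2))) := by
  set x := c * |t| with hx
  have hx0 : 0 ≤ x := by positivity
  have hxx : -(c ^ 2) * t ^ 2 = -x ^ 2 := by rw [hx, mul_pow, sq_abs]; ring
  have hr : |t| * (3 * (c * Real.exp (-(c ^ 2) * t ^ 2))) = 3 * x * Real.exp (-x ^ 2) := by
    rw [hxx, hx]; ring
  rw [hr, hxx]
  have hE := Real.exp_pos (-x ^ 2)
  have hE1 : 1 - x ^ 2 ≤ Real.exp (-x ^ 2) := by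
    have := Real.add_one_le_exp (-x ^ 2)
    linarith
  have hE2 : Real.exp (-x ^ 2) ≤ 1 := Real.exp_le_one_iff.mpr (by nlinarith)
  have hbig : x ≤ 1 → 1 ≤ 3 * Real.exp (-x ^ 2) := by
    intro hx1
    have h5 : Real.exp (-1) ≤ Real.exp (-x ^ 2) := Real.exp_le_exp.mpr (by nlinarith)
    have h6 : (0.3678794411 : ℝ) < Real.exp (-1) := by
      have := Real.exp_neg_one_gt_d9
      linarith
    linarith
  rcases lt_trichotomy x 1 with hlt | heq | hgt
  · rw [h2 hlt, abs_le]
    have := hbig hlt.le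
    constructor <;> nlinarith
  · have := hbig heq.le
    rw [heq] at this hE1 hE2 hE ⊢
    rw [abs_le]
    constructor <;> nlinarith
  · rw [h1 hgt, sub_sub_cancel, abs_of_pos hE]
    nlinarith

/-- The truncation is a difference of steps at radii `ε` and `1/ε`, each compared with a Gaussian of
its own scale. The factor `|t|` cancels the singularity `|x - y|⁻¹` of the kernel, and the `L¹` norm
of `truncErr ε` does not depend on `ε`. -/
lemma abs_truncInd_sub_gaussian_le {ε : ℝ} (hε : 0 < ε) (hε1 : ε < 1) (t : ℝ) :
    |truncInd ε t - (Real.exp (-(ε ^ 2) * t ^ 2) - Real.exp (-(ε⁻¹ ^ 2) * t ^ 2))| ≤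
      |t| * truncErr ε t := by
  have a1 := abs_step_sub_gaussian_le (c := ε⁻¹) (t := t) (inv_pos.mpr hε)
    (e := if ε < |t| then 1 else 0)
    (fun h => by
      rw [if_pos]
      rwa [← div_eq_inv_mul, lt_div_iff₀ hε, one_mul] at h)
    (fun h => by
      rw [if_neg]
      rw [← div_eq_inv_mul, div_lt_iff₀ hε, one_mul] at h
      exact h.le.not_gt) (by split_ifs <;> norm_num) (by split_ifs <;> norm_num)
  have a2 := abs_step_sub_gaussian_le (c := ε) (t := t) hε (e := if |t| < 1 / ε then 0 else 1)
    (fun h => by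
      rw [if_neg]
      rw [lt_div_iff₀ hε]
      linarith)
    (fun h => by
      rw [if_pos]
      rw [lt_div_iff₀ hε]
      linarith) (by split_ifs <;> norm_num) (by split_ifs <;> norm_num)
  have heq : truncInd ε t = (if ε < |t| then (1 : ℝ) else 0) - if |t| < 1 / ε then 0 else 1 := by
    have h1 : 1 < 1 / ε := by rw [lt_div_iff₀ hε]; linarith
    by_cases b1 : ε < |t| <;> by_cases b2 : |t| < 1 / ε
    · rw [if_pos b1, if_pos b2, truncInd, Set.indicator_of_mem (by exact ⟨b1, b2⟩)]
      simp
    · rw [if_pos b1, if_neg b2, truncInd, Set.indicator_of_notMem (fun h => b2 h.2)]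
      simp
    · rw [if_neg b1, if_pos b2, truncInd, Set.indicator_of_notMem (fun h => b1 h.1)]
      simp
    · linarith
  have hsum : |t| * truncErr ε t =
      |t| * (3 * (ε⁻¹ * Real.exp (-(ε⁻¹ ^ 2) * t ^ 2))) +
      |t| * (3 * (ε * Real.exp (-(ε ^ 2) * t ^ 2))) := by
    rw [truncErr]; ring
  rw [hsum, heq]
  rw [abs_le] at a1 a2 ⊢
  constructor <;> linarith [a1.1, a1.2, a2.1, a2.2]

/-- The truncated commutator estimate on test functions. -/
theorem exists_abs_integral_truncInd_mul_commKer_le {p q : ℝ} (hpq : p.HolderConjugate q) :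
    ∃ K, 0 ≤ K ∧ ∀ (ε : ℝ) (A f g : ℝ → ℝ), 0 < ε → IsTest f → IsTest g →
      (∀ x y, ‖A x - A y‖ ≤ 1 * |x - y|) →
      |∫ z : ℝ × ℝ, truncInd ε (z.1 - z.2) * commKer A f g z| ≤
        K * ((∫ x, |f x| ^ p) + ∫ x, |g x| ^ q) := by
  obtain ⟨K, hK0, hK⟩ := exists_abs_integral_commKer_le hpq
  refine ⟨4 * K + 12 * √Real.pi, by positivity, fun ε A f g hε hf hg hA => ?_⟩
  have hp0 := hpq.pos
  have hq0 := hpq.symm.pos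
  set S := (∫ x, |f x| ^ p) + ∫ x, |g x| ^ q with hS
  have hS0 : 0 ≤ S := add_nonneg (integral_nonneg fun x => by positivity)
    (integral_nonneg fun x => by positivity)
  -- For `ε ≥ 1` the annulus is empty.
  rcases le_or_gt 1 ε with h1 | hε1
  · have h0 : ∀ t, truncInd ε t = 0 := by
      intro t
      refine Set.indicator_of_notMem (fun ht => ?_) _
      have := ht.1.trans ht.2
      rw [lt_div_iff₀ hε] at this
      nlinarith
    simp only [h0, zero_mul, integral_zero, abs_zero]
    positivity
  obtain ⟨C, L, hf', hg'⟩ := hf.exists_testBound₂ hg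
  have hi := integrable_commKer hf' hg' hA
  have b1 := abs_integral_exp_mul_commKer_le hpq hK hf hg hA hK0 (l := ε ^ 2) (by positivity)
  have b2 := abs_integral_exp_mul_commKer_le hpq hK hf hg hA hK0 (l := ε⁻¹ ^ 2) (by positivity)
  have hie : ∀ l : ℝ, 0 ≤ l → Integrable fun z : ℝ × ℝ =>
      Real.exp (-l * (z.1 - z.2) ^ 2) * commKer A f g z := by
    intro l hl
    refine hi.norm.mono' (AEStronglyMeasurable.mul (Continuous.aestronglyMeasurable
      (by fun_prop)) hi.1) (Eventually.of_forall fun z => ?_)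
    rw [norm_mul, Real.norm_of_nonneg (Real.exp_pos _).le]
    refine mul_le_of_le_one_left (norm_nonneg _) (Real.exp_le_one_iff.mpr ?_)
    nlinarith [sq_nonneg (z.1 - z.2)]
  have hit : Integrable fun z : ℝ × ℝ => truncInd ε (z.1 - z.2) * commKer A f g z := by
    have hm : Measurable fun z : ℝ × ℝ => truncInd ε (z.1 - z.2) :=
      (measurable_truncInd ε).comp (by fun_prop)
    refine hi.norm.mono' (hm.aestronglyMeasurable.mul hi.1) (Eventually.of_forall fun z => ?_)
    rw [norm_mul]
    refine mul_le_of_le_one_left (norm_nonneg _) ?_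
    rw [truncInd]
    exact (norm_indicator_le_norm_self _ _).trans (by simp)
  have hif : Integrable fun x => |f x| ^ p := hf.integrable_rpow hp0
  have hig : Integrable fun x => |g x| ^ q := hg.integrable_rpow hq0
  have hk := integrable_truncErr hε
  have i1 := (integrable_conv_snd hk hif).fun_add (integrable_conv_fst hk hig)
  have i2 := (integrable_conv_fst hk hif).fun_add (integrable_conv_snd hk hig)
  -- The error kernel is bounded by `truncErr ε (x - y)` times products of `|f|` and `|g|`. Young's
  -- inequality separates the variables, and each of the four terms integrates to `6 √π` times a
  -- single integral.
  have hdiff : ‖∫ z : ℝ × ℝ, (truncInd ε (z.1 - z.2) * commKer A f g z -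
      (Real.exp (-(ε ^ 2) * (z.1 - z.2) ^ 2) * commKer A f g z -
        Real.exp (-(ε⁻¹ ^ 2) * (z.1 - z.2) ^ 2) * commKer A f g z))‖ ≤
      ∫ z : ℝ × ℝ, (truncErr ε (z.1 - z.2) * |f z.2| ^ p + truncErr ε (z.1 - z.2) * |g z.1| ^ q) +
        (truncErr ε (z.1 - z.2) * |f z.1| ^ p + truncErr ε (z.1 - z.2) * |g z.2| ^ q) := by
    refine norm_integral_le_of_norm_le (i1.fun_add i2) (Eventually.of_forall fun z => ?_)
    rw [← sub_mul, ← sub_mul, norm_mul]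
    have e1 := abs_truncInd_sub_gaussian_le hε hε1 (z.1 - z.2)
    have e2 : ‖commKer A f g z‖ ≤
        (|f z.2| * |g z.1| + |f z.1| * |g z.2|) * (((z.1 - z.2) ^ 2)⁻¹ * |z.1 - z.2|) := by
      rw [commKer, norm_smul, norm_mul, mul_assoc]
      have h1 : ‖f z.2 * g z.1 - f z.1 * g z.2‖ ≤ |f z.2| * |g z.1| + |f z.1| * |g z.2| := by
        refine (norm_sub_le _ _).trans ?_
        rw [norm_mul, norm_mul]
        simp only [Real.norm_eq_abs, le_refl]
      have h2 := hA z.1 z.2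
      rw [one_mul] at h2
      simp only [RCLike.ofReal_real_eq_id, id_eq]
      rw [Real.norm_of_nonneg (by positivity : 0 ≤ ((z.1 - z.2) ^ 2)⁻¹)]
      gcongr
    have e3 : |z.1 - z.2| * (((z.1 - z.2) ^ 2)⁻¹ * |z.1 - z.2|) ≤ 1 := by
      rw [mul_left_comm, ← sq, sq_abs]
      rcases eq_or_ne ((z.1 - z.2) ^ 2) 0 with h0 | h0
      · rw [h0]; simp
      · rw [inv_mul_cancel₀ h0]
    have e4 : |f z.2| * |g z.1| + |f z.1| * |g z.2| ≤
        (|f z.2| ^ p + |g z.1| ^ q) + (|f z.1| ^ p + |g z.2| ^ q) :=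
      add_le_add (mul_le_add_rpow hpq (abs_nonneg _) (abs_nonneg _))
        (mul_le_add_rpow hpq (abs_nonneg _) (abs_nonneg _))
    have hk0 : 0 ≤ truncErr ε (z.1 - z.2) := by rw [truncErr]; positivity
    calc _ ≤ (|z.1 - z.2| * truncErr ε (z.1 - z.2)) * ((|f z.2| * |g z.1| + |f z.1| * |g z.2|) *
          (((z.1 - z.2) ^ 2)⁻¹ * |z.1 - z.2|)) := by gcongr; exact e1
      _ = truncErr ε (z.1 - z.2) * (|f z.2| * |g z.1| + |f z.1| * |g z.2|) *
          (|z.1 - z.2| * (((z.1 - z.2) ^ 2)⁻¹ * |z.1 - z.2|)) := by ring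
      _ ≤ truncErr ε (z.1 - z.2) * ((|f z.2| ^ p + |g z.1| ^ q) + (|f z.1| ^ p + |g z.2| ^ q)) *
          1 := by gcongr
      _ = _ := by ring
  rw [integral_add i1 i2, integral_add (integrable_conv_snd hk hif) (integrable_conv_fst hk hig),
    integral_add (integrable_conv_fst hk hif) (integrable_conv_snd hk hig),
    integral_conv_snd hk hif, integral_conv_snd hk hig, integral_conv_fst hk hif,
    integral_conv_fst hk hig, integral_truncErr hε,
    integral_sub hit ((hie _ (by positivity)).sub' (hie _ (by positivity))),
    integral_sub (hie _ (by positivity)) (hie _ (by positivity)), Real.norm_eq_abs] at hdiff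
  rw [abs_le] at b1 b2 hdiff ⊢
  constructor <;> linarith [b1.1, b1.2, b2.1, b2.2, hdiff.1, hdiff.2]

/-! ### Truncated forms for Banach-valued Lipschitz functions. -/

/-- The integrand of the truncated commutator form. -/
noncomputable def truncKer {𝕜 E : Type*} [RCLike 𝕜] [NormedAddCommGroup E] [NormedSpace 𝕜 E]
    (A : ℝ → E) (ε : ℝ) (f g : ℝ → 𝕜) (z : ℝ × ℝ) : E :=
  (((truncInd ε (z.1 - z.2) * ((z.1 - z.2) ^ 2)⁻¹ : ℝ) : 𝕜) * (f z.2 * g z.1)) • (A z.1 - A z.2)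

/-- The scalar majorant of the truncated kernel. -/
noncomputable def truncBound (ε t : ℝ) : ℝ := truncInd ε t * |t|⁻¹

lemma truncInd_nonneg (ε t : ℝ) : 0 ≤ truncInd ε t :=
  Set.indicator_nonneg (fun _ _ => zero_le_one) t

lemma truncInd_le_one (ε t : ℝ) : truncInd ε t ≤ 1 := by
  rw [truncInd]
  exact Set.indicator_le_self' (fun _ _ => zero_le_one) t

lemma eventually_truncInd_eq_one {t : ℝ} (ht : t ≠ 0) : ∀ᶠ ε : ℝ in 𝓝[>] 0, truncInd ε t = 1 := by
  have hpos : 0 < |t| := abs_pos.mpr ht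
  filter_upwards [Ioo_mem_nhdsGT hpos, Ioo_mem_nhdsGT (inv_pos.mpr hpos)] with ε a b
  refine Set.indicator_of_mem (s := {t : ℝ | ε < |t| ∧ |t| < 1 / ε}) ⟨a.2, ?_⟩ _
  rw [lt_div_iff₀ a.1, mul_comm, ← lt_div_iff₀ hpos, one_div]
  exact b.2

lemma truncBound_nonneg (ε t : ℝ) : 0 ≤ truncBound ε t :=
  mul_nonneg (truncInd_nonneg ε t) (by positivity)

lemma integrable_truncBound {ε : ℝ} (hε : 0 < ε) : Integrable (truncBound ε) := by
  have h : Integrable ((Set.Icc (-(1 / ε)) (1 / ε)).indicator fun _ => ε⁻¹) :=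
    (integrable_indicator_iff measurableSet_Icc).mpr (integrableOn_const (by simp))
  refine h.mono' ((measurable_truncInd ε).mul
    (measurable_inv.comp continuous_abs.measurable)).aestronglyMeasurable
    (Eventually.of_forall fun t => ?_)
  rw [Real.norm_of_nonneg (truncBound_nonneg ε t), truncBound]
  by_cases ht : ε < |t| ∧ |t| < 1 / ε
  · rw [truncInd, Set.indicator_of_mem (by exact ht), Set.indicator_of_mem
      (by exact abs_le.mp ht.2.le)]
    simp only [Pi.one_apply, one_mul]
    exact inv_anti₀ hε ht.1.le
  · rw [truncInd, Set.indicator_of_notMem (by exact ht), zero_mul]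
    exact Set.indicator_nonneg (fun _ _ => by positivity) t

section
variable {𝕜 E : Type*} [RCLike 𝕜] [NormedAddCommGroup E] [NormedSpace 𝕜 E]
  {A : ℝ → E} {f g : ℝ → 𝕜} {M ε p q : ℝ}

lemma norm_truncKer_le (hA : ∀ x y, ‖A x - A y‖ ≤ M * |x - y|) (z : ℝ × ℝ) :
    ‖truncKer A ε f g z‖ ≤ M * (truncBound ε (z.1 - z.2) * (‖f z.2‖ * ‖g z.1‖)) := by
  rw [truncKer, norm_smul, norm_mul, RCLike.norm_ofReal, norm_mul, truncBound, abs_mul,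
    abs_of_nonneg (truncInd_nonneg _ _)]
  have hinv : |((z.1 - z.2) ^ 2)⁻¹| * |z.1 - z.2| = |z.1 - z.2|⁻¹ := by
    rw [abs_inv, abs_pow]
    rcases eq_or_ne |z.1 - z.2| 0 with h0 | h0
    · rw [h0]; simp
    · field_simp
  have h0 := truncInd_nonneg ε (z.1 - z.2)
  calc _ ≤ truncInd ε (z.1 - z.2) * |((z.1 - z.2) ^ 2)⁻¹| * (‖f z.2‖ * ‖g z.1‖) *
        (M * |z.1 - z.2|) := by
        gcongr
        exact hA _ _
    _ = M * (truncInd ε (z.1 - z.2) * (|((z.1 - z.2) ^ 2)⁻¹| * |z.1 - z.2|) *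
        (‖f z.2‖ * ‖g z.1‖)) := by ring
    _ = _ := by rw [hinv]

lemma aestronglyMeasurable_truncKer (hA : ∀ x y, ‖A x - A y‖ ≤ M * |x - y|)
    (hf : AEStronglyMeasurable f volume) (hg : AEStronglyMeasurable g volume) :
    AEStronglyMeasurable (truncKer A ε f g) (volume : Measure (ℝ × ℝ)) := by
  have hAc := continuous_of_lip hA
  have h1 : Measurable fun z : ℝ × ℝ =>
      ((truncInd ε (z.1 - z.2) * ((z.1 - z.2) ^ 2)⁻¹ : ℝ) : 𝕜) :=
    RCLike.measurable_ofReal.comp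
      (((measurable_truncInd ε).comp (by fun_prop)).mul (by fun_prop))
  unfold truncKer
  refine AEStronglyMeasurable.smul (h1.aestronglyMeasurable.mul ?_) ?_
  · exact AEStronglyMeasurable.mul hf.comp_snd hg.comp_fst
  · exact Continuous.aestronglyMeasurable (by fun_prop)

/-- Convolution with the integrable kernel `truncBound ε`. Its norm depends on `ε`; the estimate
serves only to define the truncated form on all of `Lᵖ × Lᵠ` and make it continuous there. -/
lemma integrable_truncMajorant (hε : 0 < ε) (hpq : p.HolderConjugate q)
    (hf' : Integrable fun x => ‖f x‖ ^ p) (hg' : Integrable fun x => ‖g x‖ ^ q)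
    (hf : AEStronglyMeasurable f volume) (hg : AEStronglyMeasurable g volume) :
    Integrable (fun z : ℝ × ℝ => truncBound ε (z.1 - z.2) * (‖f z.2‖ * ‖g z.1‖)) ∧
    ∫ z : ℝ × ℝ, truncBound ε (z.1 - z.2) * (‖f z.2‖ * ‖g z.1‖) ≤
      (∫ t, truncBound ε t) * ((∫ x, ‖f x‖ ^ p) + ∫ x, ‖g x‖ ^ q) := by
  have hk := integrable_truncBound hε
  have i1 := integrable_conv_snd hk hf'
  have i2 := integrable_conv_fst hk hg'
  have hle : ∀ z : ℝ × ℝ, truncBound ε (z.1 - z.2) * (‖f z.2‖ * ‖g z.1‖) ≤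
      truncBound ε (z.1 - z.2) * ‖f z.2‖ ^ p + truncBound ε (z.1 - z.2) * ‖g z.1‖ ^ q := by
    intro z
    rw [← mul_add]
    exact mul_le_mul_of_nonneg_left (mul_le_add_rpow hpq (norm_nonneg _) (norm_nonneg _))
      (truncBound_nonneg _ _)
  have hm : AEStronglyMeasurable (fun z : ℝ × ℝ => truncBound ε (z.1 - z.2) *
      (‖f z.2‖ * ‖g z.1‖)) (volume : Measure (ℝ × ℝ)) := by
    refine AEStronglyMeasurable.mul ?_ (AEStronglyMeasurable.mul hf.norm.comp_snd hg.norm.comp_fst)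
    have : Measurable (truncBound ε) := (measurable_truncInd ε).mul
      (measurable_inv.comp continuous_abs.measurable)
    exact (this.comp (by fun_prop : Measurable fun z : ℝ × ℝ => z.1 - z.2)).aestronglyMeasurable
  have hi : Integrable (fun z : ℝ × ℝ => truncBound ε (z.1 - z.2) * (‖f z.2‖ * ‖g z.1‖)) := by
    refine (i1.fun_add i2).mono' hm (Eventually.of_forall fun z => ?_)
    rw [Real.norm_of_nonneg (mul_nonneg (truncBound_nonneg _ _) (by positivity))]
    exact hle z
  refine ⟨hi, (integral_mono hi (i1.fun_add i2) hle).trans_eq ?_⟩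
  rw [integral_add i1 i2, integral_conv_snd hk hf', integral_conv_fst hk hg', mul_add]

lemma integrable_truncKer (hε : 0 < ε) (hpq : p.HolderConjugate q)
    (hA : ∀ x y, ‖A x - A y‖ ≤ M * |x - y|)
    (hf' : Integrable fun x => ‖f x‖ ^ p) (hg' : Integrable fun x => ‖g x‖ ^ q)
    (hf : AEStronglyMeasurable f volume) (hg : AEStronglyMeasurable g volume) :
    Integrable (truncKer A ε f g) :=
  ((integrable_truncMajorant hε hpq hf' hg' hf hg).1.const_mul M).mono'
    (aestronglyMeasurable_truncKer hA hf hg) (Eventually.of_forall fun z => norm_truncKer_le hA z)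

lemma norm_integral_truncKer_le [NormedSpace ℝ E] (hε : 0 < ε) (hpq : p.HolderConjugate q)
    (hA : ∀ x y, ‖A x - A y‖ ≤ M * |x - y|)
    (hf' : Integrable fun x => ‖f x‖ ^ p) (hg' : Integrable fun x => ‖g x‖ ^ q)
    (hf : AEStronglyMeasurable f volume) (hg : AEStronglyMeasurable g volume) :
    ‖∫ z, truncKer A ε f g z‖ ≤
      M * (∫ t, truncBound ε t) * ((∫ x, ‖f x‖ ^ p) + ∫ x, ‖g x‖ ^ q) := by
  have h := integrable_truncMajorant hε hpq hf' hg' hf hg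
  have hM : 0 ≤ M := by
    have := (norm_nonneg _).trans (hA 1 0)
    simpa using this
  refine (norm_integral_le_of_norm_le (h.1.const_mul M)
    (Eventually.of_forall fun z => norm_truncKer_le hA z)).trans ?_
  rw [integral_const_mul, mul_assoc]
  exact mul_le_mul_of_nonneg_left h.2 hM

lemma IsTest.integrable_truncKer (hf : IsTest f) (hg : IsTest g) (hε : 0 < ε)
    (hA : ∀ x y, ‖A x - A y‖ ≤ M * |x - y|) : Integrable (truncKer A ε f g) :=
  _root_.integrable_truncKer hε (Real.HolderConjugate.two_two) hA
    (hf.integrable_rpow two_pos) (hg.integrable_rpow two_pos)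
    hf.smooth.continuous.aestronglyMeasurable hg.smooth.continuous.aestronglyMeasurable

/-- The truncation is symmetric in `x` and `y`, so symmetrizing produces the antisymmetrized kernel;
this is the source of the factor `1/2` between the two forms. -/
lemma truncKer_add_swap (z : ℝ × ℝ) : truncKer A ε f g z + truncKer A ε f g z.swap =
    (truncInd ε (z.1 - z.2) : 𝕜) • commKer A f g z := by
  simp only [truncKer, commKer, Prod.fst_swap, Prod.snd_swap]
  rw [← neg_sub z.1 z.2, truncInd_neg, neg_sq, ← neg_sub (A z.1) (A z.2), smul_neg, ← sub_eq_add_neg,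
    ← sub_smul, smul_smul]
  congr 1
  push_cast
  ring

lemma two_smul_integral_truncKer [NormedSpace ℝ E] (hf : IsTest f) (hg : IsTest g) (hε : 0 < ε)
    (hA : ∀ x y, ‖A x - A y‖ ≤ M * |x - y|) : (2 : ℝ) • ∫ z, truncKer A ε f g z =
      ∫ z : ℝ × ℝ, (truncInd ε (z.1 - z.2) : 𝕜) • commKer A f g z := by
  have h1 := hf.integrable_truncKer hg hε hA
  have h2 : ∫ z : ℝ × ℝ, truncKer A ε f g z.swap = ∫ z, truncKer A ε f g z :=
    integral_prod_swap (μ := (volume : Measure ℝ)) (ν := (volume : Measure ℝ)) (truncKer A ε f g)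
  have h3 : Integrable fun z : ℝ × ℝ => truncKer A ε f g z.swap := h1.swap
  simp_rw [← truncKer_add_swap]
  rw [integral_add h1 h3, h2, two_smul]

/-- On test functions the truncated forms converge to half of the antisymmetrized form. -/
lemma tendsto_integral_truncKer [NormedSpace ℝ E] (hf : IsTest f) (hg : IsTest g)
    (hA : ∀ x y, ‖A x - A y‖ ≤ M * |x - y|) :
    Tendsto (fun ε => ∫ z, truncKer A ε f g z) (𝓝[>] 0)
      (𝓝 ((2 : ℝ)⁻¹ • ∫ z, commKer A f g z)) := by
  obtain ⟨C, L, hf', hg'⟩ := hf.exists_testBound₂ hg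
  have hi := integrable_commKer hf' hg' hA
  have h1 : Tendsto (fun ε => ∫ z : ℝ × ℝ, (truncInd ε (z.1 - z.2) : 𝕜) • commKer A f g z)
      (𝓝[>] 0) (𝓝 (∫ z, commKer A f g z)) := by
    refine tendsto_integral_filter_of_dominated_convergence _ ?_ ?_ hi.norm ?_
    · refine Eventually.of_forall fun ε => AEStronglyMeasurable.smul ?_ hi.1
      exact (RCLike.measurable_ofReal.comp ((measurable_truncInd ε).comp
        (by fun_prop : Measurable fun z : ℝ × ℝ => z.1 - z.2))).aestronglyMeasurable
    · refine Eventually.of_forall fun ε => Eventually.of_forall fun z => ?_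
      rw [norm_smul, RCLike.norm_ofReal, abs_of_nonneg (truncInd_nonneg _ _)]
      exact mul_le_of_le_one_left (norm_nonneg _) (truncInd_le_one _ _)
    · refine Eventually.of_forall fun z => ?_
      rcases eq_or_ne (z.1 - z.2) 0 with h0 | h0
      · have := sub_eq_zero.mp h0
        simp [commKer, this]
      · refine tendsto_const_nhds.congr' ?_
        filter_upwards [eventually_truncInd_eq_one h0] with ε hε
        rw [hε]
        simp
  have h2 := h1.const_smul (2 : ℝ)⁻¹
  refine h2.congr' ?_
  filter_upwards [self_mem_nhdsWithin] with ε hε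
  rw [← two_smul_integral_truncKer hf hg hε hA, smul_smul]
  norm_num

end

lemma IsTest.re {f : ℝ → ℂ} (hf : IsTest f) : IsTest fun x => (f x).re :=
  ⟨Complex.reCLM.contDiff.comp hf.smooth, hf.supp.comp_left (g := Complex.re) rfl⟩

lemma IsTest.im {f : ℝ → ℂ} (hf : IsTest f) : IsTest fun x => (f x).im :=
  ⟨Complex.imCLM.contDiff.comp hf.smooth, hf.supp.comp_left (g := Complex.im) rfl⟩

/-- The truncated commutator estimate for vector valued `A` and complex test functions. -/
theorem exists_norm_integral_truncKer_le {p q : ℝ} (hpq : p.HolderConjugate q) :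
    ∃ K, 0 ≤ K ∧ ∀ {E : Type*} [NormedAddCommGroup E] [NormedSpace ℂ E] [CompleteSpace E]
      (ε : ℝ) (A : ℝ → E) (f g : ℝ → ℂ), 0 < ε → IsTest f → IsTest g →
      (∀ x y, ‖A x - A y‖ ≤ 1 * |x - y|) →
      ‖∫ z : ℝ × ℝ, truncKer A ε f g z‖ ≤ K * ((∫ x, ‖f x‖ ^ p) + ∫ x, ‖g x‖ ^ q) := by
  obtain ⟨K, hK0, hK⟩ := exists_abs_integral_truncInd_mul_commKer_le hpq
  have hreal : ∀ {E : Type _} [NormedAddCommGroup E] [NormedSpace ℝ E] [CompleteSpace E]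
      (ε : ℝ) (A : ℝ → E) (f g : ℝ → ℝ), 0 < ε → IsTest f → IsTest g →
      (∀ x y, ‖A x - A y‖ ≤ 1 * |x - y|) →
      ‖∫ z : ℝ × ℝ, truncKer A ε f g z‖ ≤ K * ((∫ x, ‖f x‖ ^ p) + ∫ x, ‖g x‖ ^ q) := by
    intro E _ _ _ ε A f g hε hf hg hA
    -- A norming functional `l` of norm at most one turns `A` into a real 1-Lipschitz function, so
    -- the scalar bound holds in every Banach space with the same constant.
    obtain ⟨l, hl1, hl⟩ := exists_dual_vector'' ℝ (∫ z : ℝ × ℝ, truncKer A ε f g z)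
    have hlA : ∀ x y, ‖l (A x) - l (A y)‖ ≤ 1 * |x - y| := by
      intro x y
      rw [← map_sub]
      exact (l.le_of_opNorm_le hl1 _).trans (by simpa using hA x y)
    have h1 := hK ε (fun x => l (A x)) f g hε hf hg hlA
    have h2 := two_smul_integral_truncKer hf hg hε hlA
    have h3 : l (∫ z : ℝ × ℝ, truncKer A ε f g z) =
        ∫ z : ℝ × ℝ, truncKer (fun x => l (A x)) ε f g z := by
      rw [← ContinuousLinearMap.integral_comp_comm _ (hf.integrable_truncKer hg hε hA)]
      congr 1
      funext z
      simp [truncKer]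
    rw [hl] at h3
    simp only [smul_eq_mul, RCLike.ofReal_real_eq_id, id_eq] at h2 h3
    rw [← h2, ← h3, abs_mul, abs_two] at h1
    have h4 : |‖∫ z : ℝ × ℝ, truncKer A ε f g z‖| = ‖∫ z : ℝ × ℝ, truncKer A ε f g z‖ :=
      abs_norm _
    have h5 := norm_nonneg (∫ z : ℝ × ℝ, truncKer A ε f g z)
    simp only [Real.norm_eq_abs] at h1 h4 ⊢
    linarith
  refine ⟨4 * K, by positivity, ?_⟩
  intro E _ _ _ ε A f g hε hf hg hA
  -- Complex `f` and `g` split into four real pairs; factors `i` are moved onto `A`, which stays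
  -- 1-Lipschitz.
  have hIA : ∀ x y, ‖Complex.I • A x - Complex.I • A y‖ ≤ 1 * |x - y| := by
    intro x y
    rw [← smul_sub, norm_smul, Complex.norm_I, one_mul]
    exact hA x y
  have hsplit : ∀ z, truncKer A ε f g z =
      ((truncKer A ε (fun x => (f x).re) (fun x => (g x).re) z -
        truncKer A ε (fun x => (f x).im) (fun x => (g x).im) z) +
        truncKer (fun x => Complex.I • A x) ε (fun x => (f x).re) (fun x => (g x).im) z) +
        truncKer (fun x => Complex.I • A x) ε (fun x => (f x).im) (fun x => (g x).re) z := by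
    intro z
    simp only [truncKer, ← smul_sub]
    rw [← Complex.coe_smul, ← Complex.coe_smul, ← Complex.coe_smul, ← Complex.coe_smul]
    simp only [smul_smul, ← sub_smul, ← add_smul]
    congr 1
    conv_lhs => rw [← Complex.re_add_im (f z.2), ← Complex.re_add_im (g z.1)]
    push_cast
    linear_combination ((truncInd ε (z.1 - z.2) : ℂ) * (((z.1 : ℂ) - z.2) ^ 2)⁻¹ *
      (f z.2).im * (g z.1).im) * Complex.I_sq
  have i1 := hf.re.integrable_truncKer hg.re hε hA
  have i2 := hf.im.integrable_truncKer hg.im hε hA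
  have i3 := hf.re.integrable_truncKer hg.im hε hIA
  have i4 := hf.im.integrable_truncKer hg.re hε hIA
  simp_rw [hsplit]
  rw [integral_add ((i1.sub' i2).fun_add i3) i4, integral_add (i1.sub' i2) i3, integral_sub i1 i2]
  have j1 := hreal ε A _ _ hε hf.re hg.re hA
  have j2 := hreal ε A _ _ hε hf.im hg.im hA
  have j3 := hreal ε _ _ _ hε hf.re hg.im hIA
  have j4 := hreal ε _ _ _ hε hf.im hg.re hIA
  have hmono : ∀ {h : ℝ → ℂ} {r : ℝ}, IsTest h → 0 < r →
      (∫ x, ‖(h x).re‖ ^ r ≤ ∫ x, ‖h x‖ ^ r) ∧ ∫ x, ‖(h x).im‖ ^ r ≤ ∫ x, ‖h x‖ ^ r := by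
    intro h r hh hr
    exact ⟨integral_mono (hh.re.integrable_rpow hr) (hh.integrable_rpow hr) fun x =>
      Real.rpow_le_rpow (norm_nonneg _) (Complex.abs_re_le_norm _) hr.le,
      integral_mono (hh.im.integrable_rpow hr) (hh.integrable_rpow hr) fun x =>
      Real.rpow_le_rpow (norm_nonneg _) (Complex.abs_im_le_norm _) hr.le⟩
  obtain ⟨f1, f2⟩ := hmono hf hpq.pos
  obtain ⟨g1, g2⟩ := hmono hg hpq.symm.pos
  have k1 := mul_le_mul_of_nonneg_left (add_le_add f1 g1) hK0
  have k2 := mul_le_mul_of_nonneg_left (add_le_add f2 g2) hK0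
  have k3 := mul_le_mul_of_nonneg_left (add_le_add f1 g2) hK0
  have k4 := mul_le_mul_of_nonneg_left (add_le_add f2 g1) hK0
  refine (norm_add_le _ _).trans ((add_le_add_left ((norm_add_le _ _).trans
    (add_le_add_left (norm_sub_le _ _) _)) _).trans ?_)
  linarith

/-! ### Extension to Lebesgue spaces by density. -/

section
variable {X Y E : Type*} [NormedAddCommGroup X] [NormedSpace ℂ X] [NormedAddCommGroup Y]
  [NormedSpace ℂ Y] [NormedAddCommGroup E] [NormedSpace ℂ E]

/-- A bilinear map that is bounded on products of unit spheres is bounded. -/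
lemma norm_le_of_norm_le_rpow_add_rpow (β : X →ₗ[ℂ] Y →ₗ[ℂ] E) {K r s : ℝ}
    (h : ∀ x y, ‖β x y‖ ≤ K * (‖x‖ ^ r + ‖y‖ ^ s)) (x : X) (y : Y) :
    ‖β x y‖ ≤ 2 * K * ‖x‖ * ‖y‖ := by
  rcases eq_or_ne x 0 with rfl | hx
  · simp
  rcases eq_or_ne y 0 with rfl | hy
  · simp
  have hx' := norm_pos_iff.mpr hx
  have hy' := norm_pos_iff.mpr hy
  have h1 := h (((‖x‖⁻¹ : ℝ) : ℂ) • x) (((‖y‖⁻¹ : ℝ) : ℂ) • y)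
  have e1 : ‖((‖x‖⁻¹ : ℝ) : ℂ) • x‖ = 1 := by
    rw [norm_smul, Complex.norm_real, norm_inv, norm_norm, inv_mul_cancel₀ hx'.ne']
  have e2 : ‖((‖y‖⁻¹ : ℝ) : ℂ) • y‖ = 1 := by
    rw [norm_smul, Complex.norm_real, norm_inv, norm_norm, inv_mul_cancel₀ hy'.ne']
  rw [e1, e2, Real.one_rpow, Real.one_rpow, map_smul, map_smul, LinearMap.smul_apply, norm_smul,
    norm_smul, Complex.norm_real, Complex.norm_real, norm_inv, norm_inv, norm_norm, norm_norm] at h1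
  have h2 : ‖β x y‖ = ‖x‖ * ‖y‖ * (‖y‖⁻¹ * (‖x‖⁻¹ * ‖β x y‖)) := by field_simp
  rw [h2]
  calc _ ≤ ‖x‖ * ‖y‖ * (K * (1 + 1)) := by gcongr
    _ = _ := by ring

omit [NormedSpace ℂ X] [NormedSpace ℂ E] in
-- Uniform Lipschitz bounds transfer the Cauchy property from a dense set to every point.
lemma exists_tendsto_of_dense [CompleteSpace E] {ι : Type*} {l : Filter ι} [l.NeBot]
    {T : ι → X → E} {C : ℝ} (hsub : ∀ᶠ i in l, ∀ x y, ‖T i x - T i y‖ ≤ C * ‖x - y‖) {D : Set X}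
    (hD : Dense D) (hlim : ∀ x ∈ D, ∃ y, Tendsto (fun i => T i x) l (𝓝 y)) (x : X) :
    ∃ y, Tendsto (fun i => T i x) l (𝓝 y) := by
  rw [← cauchy_map_iff_exists_tendsto, Metric.cauchy_iff]
  refine ⟨inferInstance, fun δ hδ => ?_⟩
  have hη : 0 < δ / (4 * (|C| + 1)) := by positivity
  obtain ⟨x₀, hx₀, hxD⟩ := Metric.dense_iff.mp hD x _ hη
  obtain ⟨y, hy⟩ := hlim x₀ hxD
  rw [Metric.mem_ball, dist_comm, dist_eq_norm] at hx₀
  refine ⟨Metric.ball y (δ / 2), ?_, fun a ha b hb => ?_⟩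
  · rw [mem_map]
    filter_upwards [hsub, Metric.tendsto_nhds.mp hy (δ / 4) (by positivity)] with i h1 h2
    rw [Set.mem_preimage, Metric.mem_ball]
    have h3 : dist (T i x) (T i x₀) < δ / 4 := by
      rw [dist_eq_norm]
      calc _ ≤ C * ‖x - x₀‖ := h1 x x₀
        _ ≤ |C| * ‖x - x₀‖ := by gcongr; exact le_abs_self C
        _ ≤ |C| * (δ / (4 * (|C| + 1))) := by gcongr
        _ < (|C| + 1) * (δ / (4 * (|C| + 1))) := by
          refine mul_lt_mul_of_pos_right (by linarith) hη
        _ = δ / 4 := by field_simp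
    linarith [dist_triangle (T i x) (T i x₀) y]
  · rw [Metric.mem_ball] at ha hb
    linarith [dist_triangle_right a b y]

/-- Uniformly bounded bilinear maps converging on dense sets converge to a bounded bilinear map. -/
lemma exists_bilinear_limit [CompleteSpace E] {ι : Type*} {l : Filter ι} [l.NeBot]
    {β : ι → X →L[ℂ] Y →L[ℂ] E} {C : ℝ} (hb : ∀ᶠ i in l, ∀ x y, ‖β i x y‖ ≤ C * ‖x‖ * ‖y‖)
    {D : Set X} {D' : Set Y} (hD : Dense D) (hD' : Dense D')
    (hlim : ∀ x ∈ D, ∀ y ∈ D', ∃ v, Tendsto (fun i => β i x y) l (𝓝 v)) :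
    ∃ Λ : X →L[ℂ] Y →L[ℂ] E, (∀ x y, Tendsto (fun i => β i x y) l (𝓝 (Λ x y))) ∧
      ∀ x y, ‖Λ x y‖ ≤ C * ‖x‖ * ‖y‖ := by
  have h1 : ∀ y ∈ D', ∀ x, ∃ v, Tendsto (fun i => β i x y) l (𝓝 v) := by
    intro y hy
    refine exists_tendsto_of_dense (C := C * ‖y‖) (hb.mono fun i hi x x' => ?_) hD
      fun x hx => hlim x hx y hy
    rw [← _root_.sub_apply, ← map_sub]
    exact (hi _ _).trans_eq (by ring)
  have h2 : ∀ x y, ∃ v, Tendsto (fun i => β i x y) l (𝓝 v) := by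
    intro x
    refine exists_tendsto_of_dense (C := C * ‖x‖) (hb.mono fun i hi y y' => ?_) hD'
      fun y hy => h1 y hy x
    rw [← map_sub]
    exact hi _ _
  choose L hL using h2
  have hbL : ∀ x y, ‖L x y‖ ≤ C * ‖x‖ * ‖y‖ := fun x y =>
    le_of_tendsto (hL x y).norm (hb.mono fun i hi => hi x y)
  refine ⟨LinearMap.mkContinuous₂ (LinearMap.mk₂ ℂ L ?_ ?_ ?_ ?_) C hbL, hL, hbL⟩
  · intro x x' y
    refine tendsto_nhds_unique (hL _ _) (((hL x y).add (hL x' y)).congr fun i => ?_)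
    simp
  · intro c x y
    refine tendsto_nhds_unique (hL _ _) (((hL x y).const_smul c).congr fun i => ?_)
    simp
  · intro x y y'
    refine tendsto_nhds_unique (hL _ _) (((hL x y).add (hL x y')).congr fun i => ?_)
    simp
  · intro c x y
    refine tendsto_nhds_unique (hL _ _) (((hL x y).const_smul c).congr fun i => ?_)
    simp

end

section
variable {p q : ℝ≥0∞} [Fact (1 ≤ p)] [Fact (1 ≤ q)]

lemma Lp.integrable_norm_rpow (hp : p ≠ ∞) (f : Lp ℂ p (volume : Measure ℝ)) :
    Integrable fun x => ‖f x‖ ^ p.toReal :=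
  (Lp.memLp f).integrable_norm_rpow (one_pos.trans_le Fact.out).ne' hp

lemma Lp.integral_norm_rpow (hp : p ≠ ∞) (f : Lp ℂ p (volume : Measure ℝ)) :
    ∫ x, ‖f x‖ ^ p.toReal = ‖f‖ ^ p.toReal := by
  have hp0 : p ≠ 0 := (one_pos.trans_le (Fact.out : 1 ≤ p)).ne'
  have h0 : 0 ≤ ∫ x, ‖f x‖ ^ p.toReal := integral_nonneg fun x => by positivity
  rw [Lp.norm_def, (Lp.memLp f).eLpNorm_eq_integral_rpow_norm hp0 hp,
    ENNReal.toReal_ofReal (by positivity), ← Real.rpow_mul h0,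
    inv_mul_cancel₀ (ENNReal.toReal_pos hp0 hp).ne', Real.rpow_one]

variable {E : Type*} [NormedAddCommGroup E] [NormedSpace ℂ E] {A : ℝ → E} {ε : ℝ}

lemma truncKer_congr {f f' g g' : ℝ → ℂ} (hf : f =ᵐ[volume] f') (hg : g =ᵐ[volume] g') :
    truncKer A ε f g =ᵐ[(volume : Measure (ℝ × ℝ))] truncKer A ε f' g' := by
  have h1 := (Measure.quasiMeasurePreserving_snd (μ := (volume : Measure ℝ))
    (ν := (volume : Measure ℝ))).ae hf
  have h2 := (Measure.quasiMeasurePreserving_fst (μ := (volume : Measure ℝ))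
    (ν := (volume : Measure ℝ))).ae hg
  rw [← Measure.volume_eq_prod] at h1 h2
  filter_upwards [h1, h2] with z hz1 hz2
  rw [truncKer, truncKer, hz1, hz2]

lemma exists_truncForm (hp : p ≠ ∞) (hq : q ≠ ∞) (hpq : p.toReal.HolderConjugate q.toReal)
    (hε : 0 < ε) (hA : ∀ x y, ‖A x - A y‖ ≤ 1 * |x - y|) :
    ∃ β : Lp ℂ p (volume : Measure ℝ) →L[ℂ] Lp ℂ q (volume : Measure ℝ) →L[ℂ] E,
      ∀ f g, β f g = ∫ z, truncKer A ε f g z := by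
  have hint : ∀ (f : Lp ℂ p (volume : Measure ℝ)) (g : Lp ℂ q (volume : Measure ℝ)),
      Integrable (truncKer A ε f g) := fun f g =>
    integrable_truncKer hε hpq hA (Lp.integrable_norm_rpow hp f) (Lp.integrable_norm_rpow hq g)
      (Lp.aestronglyMeasurable f) (Lp.aestronglyMeasurable g)
  set β : Lp ℂ p (volume : Measure ℝ) →ₗ[ℂ] Lp ℂ q (volume : Measure ℝ) →ₗ[ℂ] E :=
    LinearMap.mk₂ ℂ (fun f g => ∫ z, truncKer A ε f g z) (by
      intro f f' g
      rw [← integral_add (hint f g) (hint f' g),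
        integral_congr_ae (truncKer_congr (Lp.coeFn_add f f') ae_eq_rfl)]
      congr 1
      funext z
      simp only [truncKer, Pi.add_apply, ← add_smul]
      ring_nf) (by
      intro c f g
      rw [← integral_smul, integral_congr_ae (truncKer_congr (Lp.coeFn_smul c f) ae_eq_rfl)]
      congr 1
      funext z
      simp only [truncKer, Pi.smul_apply, smul_smul, smul_eq_mul]
      ring_nf) (by
      intro f g g'
      rw [← integral_add (hint f g) (hint f g'),
        integral_congr_ae (truncKer_congr ae_eq_rfl (Lp.coeFn_add g g'))]
      congr 1
      funext z
      simp only [truncKer, Pi.add_apply, ← add_smul]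
      ring_nf) (by
      intro c f g
      rw [← integral_smul, integral_congr_ae (truncKer_congr ae_eq_rfl (Lp.coeFn_smul c g))]
      congr 1
      funext z
      simp only [truncKer, Pi.smul_apply, smul_smul, smul_eq_mul]
      ring_nf) with hβ
  have hb : ∀ f g, ‖β f g‖ ≤ 1 * (∫ t, truncBound ε t) * (‖f‖ ^ p.toReal + ‖g‖ ^ q.toReal) := by
    intro f g
    rw [← Lp.integral_norm_rpow hp f, ← Lp.integral_norm_rpow hq g]
    exact norm_integral_truncKer_le hε hpq hA (Lp.integrable_norm_rpow hp f)
      (Lp.integrable_norm_rpow hq g) (Lp.aestronglyMeasurable f) (Lp.aestronglyMeasurable g)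
  exact ⟨LinearMap.mkContinuous₂ β _ (norm_le_of_norm_le_rpow_add_rpow β hb), fun f g => rfl⟩

/-- The commutator form with values in a Banach space. -/
theorem exists_commForm (hp : p ≠ ∞) (hq : q ≠ ∞) (hpq : p.toReal.HolderConjugate q.toReal) :
    ∃ C, 0 ≤ C ∧ ∀ {E : Type*} [NormedAddCommGroup E] [NormedSpace ℂ E] [CompleteSpace E]
      (A : ℝ → E), (∀ x y, ‖A x - A y‖ ≤ 1 * |x - y|) →
      ∃ Λ : Lp ℂ p (volume : Measure ℝ) →L[ℂ] Lp ℂ q (volume : Measure ℝ) →L[ℂ] E,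
      (∀ (f : Lp ℂ p (volume : Measure ℝ)) (g : Lp ℂ q (volume : Measure ℝ)),
        Tendsto (fun ε => ∫ z, truncKer A ε f g z) (𝓝[>] 0) (𝓝 (Λ f g))) ∧
      ∀ f g, ‖Λ f g‖ ≤ C * ‖f‖ * ‖g‖ := by
  obtain ⟨K, hK0, hK⟩ := exists_norm_integral_truncKer_le hpq
  refine ⟨2 * K, by positivity, ?_⟩
  intro E _ _ _ A hA
  have hβ : ∀ ε : ℝ, ∃ β : Lp ℂ p (volume : Measure ℝ) →L[ℂ] Lp ℂ q (volume : Measure ℝ) →L[ℂ] E,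
      0 < ε → ∀ f g, β f g = ∫ z, truncKer A ε f g z := by
    intro ε
    by_cases hε : 0 < ε
    · obtain ⟨β, h⟩ := exists_truncForm hp hq hpq hε hA
      exact ⟨β, fun _ => h⟩
    · exact ⟨0, fun h => absurd h hε⟩
  choose β hβ using hβ
  have hDp := MeasureTheory.Lp.dense_hasCompactSupport_contDiff (E := ℝ) (F := ℂ)
    (μ := volume) hp
  have hDq := MeasureTheory.Lp.dense_hasCompactSupport_contDiff (E := ℝ) (F := ℂ)
    (μ := volume) hq
  have htest : ∀ {g : ℝ → ℂ}, HasCompactSupport g → ContDiff ℝ ((⊤ : ℕ∞) : WithTop ℕ∞) g →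
      IsTest g := fun h1 h2 => ⟨h2.of_le (by exact_mod_cast le_top), h1⟩
  have hbound : ∀ ε, 0 < ε → ∀ f g, ‖β ε f g‖ ≤ 2 * K * ‖f‖ * ‖g‖ := by
    intro ε hε
    let β' : Lp ℂ p (volume : Measure ℝ) →ₗ[ℂ] Lp ℂ q (volume : Measure ℝ) →ₗ[ℂ] E :=
      (ContinuousLinearMap.coeLM ℂ).comp (β ε).toLinearMap
    refine norm_le_of_norm_le_rpow_add_rpow β' (r := p.toReal) (s := q.toReal) ?_
    -- The additive bound, uniform in `ε`, is a closed condition because each truncated form is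
    -- continuous. It extends from test functions by density, and homogeneity then makes it a
    -- product bound.
    have hclosed : IsClosed {x : Lp ℂ p (volume : Measure ℝ) × Lp ℂ q (volume : Measure ℝ) |
        ‖β ε x.1 x.2‖ ≤ K * (‖x.1‖ ^ p.toReal + ‖x.2‖ ^ q.toReal)} := by
      refine isClosed_le ?_ ?_
      · exact ((β ε).continuous₂).norm
      · exact continuous_const.mul ((continuous_fst.norm.rpow_const fun _ => Or.inr hpq.pos.le).add
          (continuous_snd.norm.rpow_const fun _ => Or.inr hpq.symm.pos.le))
    have hsub := closure_minimal (s := _ ×ˢ _) (fun x (hx : x ∈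
      {f : Lp ℂ p (volume : Measure ℝ) | ∃ g : ℝ → ℂ, f =ᵐ[volume] g ∧ HasCompactSupport g ∧
        ContDiff ℝ ((⊤ : ℕ∞) : WithTop ℕ∞) g} ×ˢ
      {f : Lp ℂ q (volume : Measure ℝ) | ∃ g : ℝ → ℂ, f =ᵐ[volume] g ∧ HasCompactSupport g ∧
        ContDiff ℝ ((⊤ : ℕ∞) : WithTop ℕ∞) g}) => ?_) hclosed
    · intro f g
      have := hsub ((hDp.prod hDq) (f, g))
      exact this
    · obtain ⟨⟨φ, h1, h2, h3⟩, ψ, h4, h5, h6⟩ := hx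
      rw [Set.mem_ofPred_eq, hβ ε hε, integral_congr_ae (truncKer_congr h1 h4),
        ← Lp.integral_norm_rpow hp, ← Lp.integral_norm_rpow hq,
        integral_congr_ae (h1.mono fun x hx => by simp only [hx] :
          (fun y => ‖x.1 y‖ ^ p.toReal) =ᵐ[volume] fun y => ‖φ y‖ ^ p.toReal),
        integral_congr_ae (h4.mono fun x hx => by simp only [hx] :
          (fun y => ‖x.2 y‖ ^ q.toReal) =ᵐ[volume] fun y => ‖ψ y‖ ^ q.toReal)]
      exact hK ε A φ ψ hε (htest h2 h3) (htest h5 h6) hA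
  have hpos : ∀ᶠ ε : ℝ in 𝓝[>] 0, 0 < ε := self_mem_nhdsWithin
  obtain ⟨Λ, hΛ, hΛb⟩ := exists_bilinear_limit (hpos.mono hbound) hDp hDq (by
    rintro f ⟨φ, h1, h2, h3⟩ g ⟨ψ, h4, h5, h6⟩
    refine ⟨_, (tendsto_integral_truncKer (htest h2 h3) (htest h5 h6) hA).congr' ?_⟩
    filter_upwards [hpos] with ε hε
    rw [hβ ε hε, integral_congr_ae (truncKer_congr h1 h4)])
  exact ⟨Λ, fun f g => (hΛ f g).congr' (hpos.mono fun ε hε => hβ ε hε f g), hΛb⟩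

end

/-! ### Duality pairing and the curve of intervals in `L¹`. -/

/-- The bilinear pairing `(f, g) ↦ ∫ f g`. -/
noncomputable def pairing (p q : ℝ≥0∞) [Fact (1 ≤ p)] [Fact (1 ≤ q)] [p.HolderConjugate q] :
    Lp ℂ p (volume : Measure ℝ) →L[ℂ] Lp ℂ q (volume : Measure ℝ) →L[ℂ] ℂ :=
  (ContinuousLinearMap.mul ℂ ℂ).lpPairing volume p q

section
variable {p q : ℝ≥0∞} [Fact (1 ≤ p)] [Fact (1 ≤ q)] [p.HolderConjugate q]

lemma pairing_apply (f : Lp ℂ p (volume : Measure ℝ)) (g : Lp ℂ q (volume : Measure ℝ)) :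
    pairing p q f g = ∫ x, f x * g x := by
  rw [pairing, ContinuousLinearMap.lpPairing_eq_integral]
  rfl

lemma norm_pairing_le (f : Lp ℂ p (volume : Measure ℝ)) (g : Lp ℂ q (volume : Measure ℝ)) :
    ‖pairing p q f g‖ ≤ ‖f‖ * ‖g‖ := by
  have h0 : pairing p q f g = L1.integral
      ((ContinuousLinearMap.mul ℂ ℂ).holder (p := p) (q := q) 1 f g) := by
    rw [pairing_apply, L1.integral_eq_integral]
    exact (integral_congr_ae ((ContinuousLinearMap.mul ℂ ℂ).coeFn_holder f g)).symm
  rw [h0]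
  refine (L1.norm_integral_le _).trans
    (((ContinuousLinearMap.mul ℂ ℂ).norm_holder_apply_apply_le f g).trans ?_)
  have h := ContinuousLinearMap.opNorm_mul_le ℂ ℂ
  rw [mul_assoc]
  exact mul_le_of_le_one_left (by positivity) h

end

/-- The `L¹`-valued function `x ↦ 1_{(0, x]} - 1_{(x, 0]}`. -/
noncomputable def intervalLp (x : ℝ) : Lp ℂ 1 (volume : Measure ℝ) :=
  indicatorConstLp 1 (measurableSet_Ioc (a := (0 : ℝ)) (b := x)) (by simp) (1 : ℂ) -
    indicatorConstLp 1 (measurableSet_Ioc (a := x) (b := (0 : ℝ))) (by simp) (1 : ℂ)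

lemma intervalLp_coeFn (x : ℝ) : intervalLp x =ᵐ[volume]
    fun t => (Set.Ioc 0 x).indicator (fun _ => (1 : ℂ)) t -
      (Set.Ioc x 0).indicator (fun _ => (1 : ℂ)) t := by
  unfold intervalLp
  refine (Lp.coeFn_sub _ _).trans ?_
  exact indicatorConstLp_coeFn.sub indicatorConstLp_coeFn

lemma indicator_Ioc_sub {x y : ℝ} (h : y ≤ x) (t : ℝ) :
    ((Set.Ioc 0 x).indicator (fun _ => (1 : ℂ)) t - (Set.Ioc x 0).indicator (fun _ => (1 : ℂ)) t) -
      ((Set.Ioc 0 y).indicator (fun _ => (1 : ℂ)) t - (Set.Ioc y 0).indicator (fun _ => (1 : ℂ)) t)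
      = (Set.Ioc y x).indicator (fun _ => (1 : ℂ)) t := by
  simp only [Set.indicator, Set.mem_Ioc, ← not_le]
  by_cases h1 : t ≤ 0 <;> by_cases h2 : t ≤ x <;> by_cases h3 : t ≤ y <;>
    first | exact absurd (h3.trans h) h2 | simp [h1, h2, h3]

lemma intervalLp_sub {x y : ℝ} (h : y ≤ x) : intervalLp x - intervalLp y =
    indicatorConstLp 1 (measurableSet_Ioc (a := y) (b := x)) (by simp) (1 : ℂ) := by
  apply Lp.ext
  refine (Lp.coeFn_sub _ _).trans ?_
  refine ((intervalLp_coeFn x).sub (intervalLp_coeFn y)).trans ?_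
  refine EventuallyEq.trans ?_ indicatorConstLp_coeFn.symm
  exact Eventually.of_forall fun t => indicator_Ioc_sub h t

/-- An increment is, up to sign, the indicator of the interval between `x` and `y`. Hence the curve
is an admissible `L¹`-valued Lipschitz function. -/
lemma norm_intervalLp_sub_le (x y : ℝ) : ‖intervalLp x - intervalLp y‖ ≤ 1 * |x - y| := by
  wlog h : y ≤ x generalizing x y
  · rw [norm_sub_rev, abs_sub_comm]
    exact this y x (le_of_not_ge h)
  rw [intervalLp_sub h, norm_indicatorConstLp one_ne_zero ENNReal.one_ne_top, norm_one, one_mul,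
    one_mul, ENNReal.toReal_one, div_one, Real.rpow_one, Real.volume_real_Ioc_of_le h,
    abs_of_nonneg (sub_nonneg.mpr h)]

lemma pairing_intervalLp_sub {x y : ℝ} (h : y ≤ x) (a : Lp ℂ ∞ (volume : Measure ℝ)) :
    pairing 1 ∞ (intervalLp x - intervalLp y) a = ∫ t in y..x, a t := by
  rw [intervalLp_sub h, pairing_apply, intervalIntegral.integral_of_le h,
    ← integral_indicator measurableSet_Ioc]
  refine integral_congr_ae ?_
  filter_upwards [indicatorConstLp_coeFn (p := 1) (hs := measurableSet_Ioc (a := y) (b := x))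
      (hμs := by simp) (c := (1 : ℂ)) (μ := volume)] with t ht
  rw [ht]
  by_cases hm : t ∈ Set.Ioc y x <;> simp [hm]

/-- Lipschitz functions are absolutely continuous, so the fundamental theorem holds with the almost
everywhere derivative. -/
lemma integral_eq_sub_of_lipschitz {B b : ℝ → ℝ} (hB : ∃ K, LipschitzWith K B)
    (hb : ∀ᵐ x : ℝ, HasDerivAt B (b x) x) (x y : ℝ) : ∫ t in y..x, b t = B x - B y := by
  obtain ⟨K, hK⟩ := hB
  have h := (hK.lipschitzOnWith (s := Set.uIcc y x)).absolutelyContinuousOnInterval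
  rw [← h.integral_deriv_eq_sub]
  refine intervalIntegral.integral_congr_ae ?_
  filter_upwards [hb] with t ht _ using ht.deriv.symm

/-- A Lipschitz primitive of `a` is obtained by pairing `a` with intervals. -/
lemma IsLipschitzPrimitive.pairing_sub {A : ℝ → ℂ} {a : Lp ℂ ∞ (volume : Measure ℝ)}
    (h : IsLipschitzPrimitive A a) (x y : ℝ) :
    pairing 1 ∞ (intervalLp x - intervalLp y) a = A x - A y := by
  wlog hxy : y ≤ x generalizing x y
  · have := this y x (le_of_not_ge hxy)
    rw [← neg_sub, map_neg, neg_apply, this, neg_sub]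
  obtain ⟨⟨K, hK⟩, hd⟩ := h
  rw [pairing_intervalLp_sub hxy]
  have hint : IntervalIntegrable a volume y x := by
    rw [intervalIntegrable_iff_integrableOn_Ioc_of_le hxy]
    have : Fact (volume (Set.Ioc y x) < ∞) := ⟨by simp⟩
    exact ((Lp.memLp a).restrict _).integrable (le_top)
  have h1 := integral_eq_sub_of_lipschitz (B := fun x => (A x).re) (b := fun x => (a x).re)
    ⟨_, Complex.reCLM.lipschitz.comp hK⟩ (hd.mono fun x hx => hx.complex_re) x y
  have h2 := integral_eq_sub_of_lipschitz (B := fun x => (A x).im) (b := fun x => (a x).im)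
    ⟨_, Complex.imCLM.lipschitz.comp hK⟩ (hd.mono fun x hx => hx.complex_im) x y
  have h3 := Complex.reCLM.intervalIntegral_comp_comm hint
  have h4 := Complex.imCLM.intervalIntegral_comp_comm hint
  simp only [Complex.reCLM_apply, Complex.imCLM_apply] at h3 h4
  apply Complex.ext
  · rw [← h3, h1, Complex.sub_re]
  · rw [← h4, h2, Complex.sub_im]

/-! ### Converse of Hölder's inequality and representation of functionals. -/

section
variable {p q : ℝ≥0∞}

/-- The truncations used to test membership in `Lᵖ` by duality. -/
def levelBox (h : ℝ → ℂ) (n : ℕ) : Set ℝ := {x | ‖h x‖ ≤ n} ∩ Set.Icc (-(n : ℝ)) n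

lemma measurableSet_levelBox {h : ℝ → ℂ} (hm : Measurable h) (n : ℕ) :
    MeasurableSet (levelBox h n) :=
  (measurableSet_le hm.norm measurable_const).inter measurableSet_Icc

lemma levelBox_mono (h : ℝ → ℂ) : Monotone (levelBox h) := by
  intro m n hmn x hx
  have : (m : ℝ) ≤ n := by exact_mod_cast hmn
  exact ⟨le_trans hx.1 this, by linarith [hx.2.1], by linarith [hx.2.2]⟩

lemma eventually_mem_levelBox (h : ℝ → ℂ) (x : ℝ) : ∀ᶠ n in atTop, x ∈ levelBox h n := by
  filter_upwards [tendsto_natCast_atTop_atTop.eventually_ge_atTop ‖h x‖,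
    tendsto_natCast_atTop_atTop.eventually_ge_atTop |x|] with n h1 h2
  exact ⟨h1, abs_le.mp h2⟩

lemma memLp_indicator_levelBox {h u : ℝ → ℂ} (hm : Measurable h) (hu : Measurable u) {n : ℕ} {C : ℝ}
    (hC : ∀ x ∈ levelBox h n, ‖u x‖ ≤ C) (r : ℝ≥0∞) :
    MemLp ((levelBox h n).indicator u) r volume := by
  have hs := measurableSet_levelBox hm n
  have hfin : volume (levelBox h n) < ∞ :=
    (measure_mono Set.inter_subset_right).trans_lt (by simp)
  rw [memLp_indicator_iff_restrict hs]
  have : Fact (volume (levelBox h n) < ∞) := ⟨hfin⟩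
  exact MemLp.of_bound hu.aestronglyMeasurable C (ae_restrict_of_forall_mem hs hC)

/-- Cancelling `I^(1/q)` requires `I` finite; this is why the converse of Hölder's inequality is
tested on `levelBox` truncations. -/
lemma le_rpow_of_le_mul_rpow {p q I B : ℝ} (hpq : p.HolderConjugate q) (hI : 0 ≤ I) (hB : 0 ≤ B)
    (h : I ≤ B * I ^ q⁻¹) : I ≤ B ^ p := by
  rcases hI.eq_or_lt with h0 | hpos
  · rw [← h0]; positivity
  have h1 : I ^ p⁻¹ ≤ B := by
    have e : I = I ^ p⁻¹ * I ^ q⁻¹ := by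
      rw [← Real.rpow_add hpos, hpq.inv_add_inv_eq_one, Real.rpow_one]
    rw [e] at h
    exact le_of_mul_le_mul_right (by rwa [← e] at h ⊢) (Real.rpow_pos_of_pos hpos _)
  calc I = (I ^ p⁻¹) ^ p := by
        rw [← Real.rpow_mul hI, inv_mul_cancel₀ hpq.ne_zero, Real.rpow_one]
    _ ≤ B ^ p := Real.rpow_le_rpow (by positivity) h1 hpq.nonneg

/-- The converse of Hölder's inequality. -/
lemma eLpNorm_le_of_forall_integral_le (hp0 : p ≠ 0) (hp : p ≠ ∞) (hq0 : q ≠ 0) (hq : q ≠ ∞)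
    (hpq : p.toReal.HolderConjugate q.toReal) {h : ℝ → ℂ} (hm : Measurable h) {B : ℝ} (hB : 0 ≤ B)
    (H : ∀ g : ℝ → ℂ, MemLp g q volume → MemLp g 2 volume →
      ‖∫ x, h x * g x‖ ≤ B * (eLpNorm g q volume).toReal) :
    eLpNorm h p volume ≤ ENNReal.ofReal B := by
  have hP0 := hpq.pos
  have hP1 : 0 < p.toReal - 1 := hpq.sub_one_pos
  set P := p.toReal with hP
  set Q := q.toReal with hQ
  have hbound : ∀ n : ℕ, ∫⁻ x, (levelBox h n).indicator (fun x => ‖h x‖ₑ ^ P) x ≤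
      ENNReal.ofReal (B ^ P) := by
    intro n
    set s := levelBox h n with hs
    have hsm := measurableSet_levelBox hm n
    have hfin : volume s < ∞ := (measure_mono Set.inter_subset_right).trans_lt (by simp)
    -- The extremal function in Hölder's inequality: `h u = |h|^P` and `|u|^Q = |h|^P`.
    set u : ℝ → ℂ := fun x => starRingEnd ℂ (h x) * ((‖h x‖ ^ (P - 2) : ℝ) : ℂ) with hu
    have hun : ∀ x, ‖u x‖ = ‖h x‖ ^ (P - 1) := by
      intro x
      rw [hu, norm_mul, RCLike.norm_conj, Complex.norm_real, Real.norm_of_nonneg (by positivity)]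
      rcases eq_or_ne ‖h x‖ 0 with h0 | h0
      · rw [h0, zero_mul, Real.zero_rpow hP1.ne']
      · have hpos : 0 < ‖h x‖ := lt_of_le_of_ne (norm_nonneg _) h0.symm
        rw [← Real.rpow_one_add' hpos.le (by linarith)]
        congr 1
        ring
    have hum : Measurable u := by
      have h1 : Measurable fun x => ((‖h x‖ ^ (P - 2) : ℝ) : ℂ) :=
        Complex.measurable_ofReal.comp (hm.norm.pow_const _)
      exact (Complex.continuous_conj.measurable.comp hm).mul h1
    have hub : ∀ x ∈ s, ‖u x‖ ≤ (n : ℝ) ^ (P - 1) := by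
      intro x hx
      rw [hun]
      exact Real.rpow_le_rpow (norm_nonneg _) hx.1 hP1.le
    have hg : ∀ r, MemLp (s.indicator u) r volume := memLp_indicator_levelBox hm hum hub
    have hprod : ∀ x, h x * s.indicator u x = ((s.indicator (fun x => ‖h x‖ ^ P) x : ℝ) : ℂ) := by
      intro x
      by_cases hx : x ∈ s
      · rw [Set.indicator_of_mem hx, Set.indicator_of_mem hx, hu]
        simp only
        rw [← mul_assoc, Complex.mul_conj, Complex.normSq_eq_norm_sq, ← Complex.ofReal_mul]
        congr 1
        rcases eq_or_ne ‖h x‖ 0 with h0 | h0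
        · rw [h0, Real.zero_rpow hP0.ne']; simp
        · have hpos : 0 < ‖h x‖ := lt_of_le_of_ne (norm_nonneg _) h0.symm
          rw [← Real.rpow_natCast, ← Real.rpow_add hpos]
          congr 1
          push_cast
          ring
      · rw [Set.indicator_of_notMem hx, Set.indicator_of_notMem hx]; simp
    have hnq : ∀ x, ‖s.indicator u x‖ ^ Q = s.indicator (fun x => ‖h x‖ ^ P) x := by
      intro x
      by_cases hx : x ∈ s
      · rw [Set.indicator_of_mem hx, Set.indicator_of_mem hx, hun, ← Real.rpow_mul (norm_nonneg _)]
        congr 1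
        have := hpq.sub_one_mul_conj
        exact this
      · rw [Set.indicator_of_notMem hx, Set.indicator_of_notMem hx, norm_zero,
          Real.zero_rpow hpq.symm.ne_zero]
    set I := ∫ x, s.indicator (fun x => ‖h x‖ ^ P) x with hI
    have hI0 : 0 ≤ I := integral_nonneg fun x => Set.indicator_nonneg (fun _ _ => by positivity) x
    have h1 := H _ (hg q) (hg 2)
    simp_rw [hprod] at h1
    rw [integral_complex_ofReal, Complex.norm_real, Real.norm_of_nonneg hI0,
      (hg q).eLpNorm_eq_integral_rpow_norm hq0 hq] at h1
    simp_rw [← hQ, hnq] at h1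
    rw [ENNReal.toReal_ofReal (by positivity)] at h1
    have h2 := le_rpow_of_le_mul_rpow hpq hI0 hB h1
    have hint : Integrable (s.indicator fun x => ‖h x‖ ^ P) := by
      rw [integrable_indicator_iff hsm]
      refine Measure.integrableOn_of_bounded (M := (n : ℝ) ^ P) hfin.ne
        (hm.norm.pow_const _).aestronglyMeasurable (ae_restrict_of_forall_mem hsm fun x hx => ?_)
      rw [Real.norm_of_nonneg (by positivity)]
      exact Real.rpow_le_rpow (norm_nonneg _) hx.1 hP0.le
    have h3 := ofReal_integral_eq_lintegral_ofReal hint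
      (Eventually.of_forall fun x => Set.indicator_nonneg (fun _ _ => by positivity) x)
    have h4 : ∀ x, ENNReal.ofReal (s.indicator (fun x => ‖h x‖ ^ P) x) =
        s.indicator (fun x => ‖h x‖ₑ ^ P) x := by
      intro x
      by_cases hx : x ∈ s
      · rw [Set.indicator_of_mem hx, Set.indicator_of_mem hx,
          ← ENNReal.ofReal_rpow_of_nonneg (norm_nonneg _) hP0.le, ofReal_norm]
      · rw [Set.indicator_of_notMem hx, Set.indicator_of_notMem hx, ENNReal.ofReal_zero]
    simp_rw [h4] at h3
    rw [← h3]
    exact ENNReal.ofReal_le_ofReal h2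
  have hlim := lintegral_tendsto_of_tendsto_of_monotone (μ := volume)
    (f := fun n x => (levelBox h n).indicator (fun x => ‖h x‖ₑ ^ P) x) (F := fun x => ‖h x‖ₑ ^ P)
    (fun n => ((hm.enorm.pow_const _).indicator (measurableSet_levelBox hm n)).aemeasurable)
    (Eventually.of_forall fun x m n hmn =>
      Set.indicator_le_indicator_of_subset (levelBox_mono h hmn) (fun _ => zero_le) x)
    (Eventually.of_forall fun x => tendsto_const_nhds.congr' (by
      filter_upwards [eventually_mem_levelBox h x] with n hn
      rw [Set.indicator_of_mem hn]))
  have hle := le_of_tendsto hlim (Eventually.of_forall hbound)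
  rw [eLpNorm_eq_lintegral_rpow_enorm_toReal hp0 hp, ← hP]
  calc _ ≤ (ENNReal.ofReal (B ^ P)) ^ (1 / P) := by gcongr
    _ = ENNReal.ofReal B := by
      rw [ENNReal.ofReal_rpow_of_nonneg (by positivity) (by positivity), ← Real.rpow_mul hB,
        mul_one_div_cancel hP0.ne', Real.rpow_one]

end

section
variable {p q : ℝ≥0∞} [Fact (1 ≤ p)] [Fact (1 ≤ q)] [p.HolderConjugate q]

lemma norm_le_norm_pairing (hp : p ≠ ∞) (hq : q ≠ ∞)
    (hpq : p.toReal.HolderConjugate q.toReal) (h : Lp ℂ p (volume : Measure ℝ)) :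
    ‖h‖ ≤ ‖pairing p q h‖ := by
  rw [Lp.norm_def]
  refine ENNReal.toReal_le_of_le_ofReal (norm_nonneg _) ?_
  refine eLpNorm_le_of_forall_integral_le (one_pos.trans_le Fact.out).ne' hp
    (one_pos.trans_le Fact.out).ne' hq hpq (Lp.stronglyMeasurable h).measurable (norm_nonneg _) ?_
  intro g hg _
  have h1 := (pairing p q h).le_opNorm hg.toLp
  rw [pairing_apply, Lp.norm_toLp] at h1
  rwa [integral_congr_ae (g := fun x => h x * g x)
    (hg.coeFn_toLp.mono fun x hx => by simp only [hx])] at h1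

/-- By the converse of Hölder's inequality the embedding of `Lᵖ` into the dual of `Lᵠ` does not
shrink norms. It is therefore injective with closed range, which gives uniqueness of `T` and the
density argument for its existence. -/
lemma antilipschitz_pairing (hp : p ≠ ∞) (hq : q ≠ ∞)
    (hpq : p.toReal.HolderConjugate q.toReal) : AntilipschitzWith 1 (pairing p q) :=
  AddMonoidHomClass.antilipschitz_of_bound _ fun h => by
    simpa using norm_le_norm_pairing hp hq hpq h

/-- A functional on `Lᵠ` that is bounded in the `L²` norm is given by a function in `Lᵖ`. -/
lemma mem_range_pairing (hp : p ≠ ∞) (hq : q ≠ ∞) (hpq : p.toReal.HolderConjugate q.toReal)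
    (φ : StrongDual ℂ (Lp ℂ q (volume : Measure ℝ))) (ψ : StrongDual ℂ (Lp ℂ 2 (volume : Measure ℝ)))
    (hφ : ∀ (g : ℝ → ℂ) (hg : MemLp g q volume) (hg2 : MemLp g 2 volume),
      φ hg.toLp = ψ hg2.toLp) : φ ∈ Set.range (pairing p q) := by
  -- The Hilbert space representation supplies a candidate; its conjugate turns the inner product
  -- into the bilinear pairing.
  set k := (InnerProductSpace.toDual ℂ (Lp ℂ 2 (volume : Measure ℝ))).symm ψ with hk
  set h : ℝ → ℂ := fun x => starRingEnd ℂ (k x) with hh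
  have hm : Measurable h := Complex.continuous_conj.measurable.comp
    (Lp.stronglyMeasurable k).measurable
  have hψ : ∀ (g : ℝ → ℂ) (hg : MemLp g 2 volume), ψ hg.toLp = ∫ x, h x * g x := by
    intro g hg
    have h1 : inner ℂ k hg.toLp = ψ hg.toLp := InnerProductSpace.toDual_symm_apply
    rw [← h1, L2.inner_def]
    refine integral_congr_ae (hg.coeFn_toLp.mono fun x hx => ?_)
    simp only [hx, RCLike.inner_apply, hh]
    ring
  have hB : eLpNorm h p volume ≤ ENNReal.ofReal ‖φ‖ := by
    refine eLpNorm_le_of_forall_integral_le (one_pos.trans_le Fact.out).ne' hp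
      (one_pos.trans_le Fact.out).ne' hq hpq hm (norm_nonneg _) fun g hg hg2 => ?_
    rw [← hψ g hg2, ← hφ g hg hg2, ← Lp.norm_toLp g hg]
    exact φ.le_opNorm _
  have hmem : MemLp h p volume :=
    ⟨hm.aestronglyMeasurable, hB.trans_lt ENNReal.ofReal_lt_top⟩
  refine ⟨hmem.toLp, ?_⟩
  have hD := MeasureTheory.Lp.dense_hasCompactSupport_contDiff (E := ℝ) (F := ℂ)
    (μ := volume) hq
  refine ContinuousLinearMap.ext fun g => ?_
  refine congrFun (Continuous.ext_on hD (pairing p q hmem.toLp).continuous φ.continuous ?_) g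
  rintro g ⟨u, h1, h2, h3⟩
  have hu : ∀ r, MemLp u r volume := fun r => h3.continuous.memLp_of_hasCompactSupport h2
  have hg : g = (hu q).toLp := Lp.ext (h1.trans (hu q).coeFn_toLp.symm)
  rw [hg, hφ u (hu q) (hu 2), hψ, pairing_apply]
  refine integral_congr_ae ?_
  filter_upwards [hmem.coeFn_toLp, (hu q).coeFn_toLp] with x e1 e2
  rw [e1, e2]

end

/-! ### Construction of the operators. -/

section
variable {p q : ℝ≥0∞} [Fact (1 ≤ p)] [Fact (1 ≤ q)] [p.HolderConjugate q]

/-- The commutator operator and its adjoint form. -/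
theorem exists_commutator_operators (hp : p ≠ ∞) (hq : q ≠ ∞)
    (hpq : p.toReal.HolderConjugate q.toReal) :
    ∃ (C : ℝ)
      (T : Lp ℂ ∞ (volume : Measure ℝ) →L[ℂ] Lp ℂ p (volume : Measure ℝ) →L[ℂ]
        Lp ℂ p (volume : Measure ℝ))
      (S : Lp ℂ p (volume : Measure ℝ) →L[ℂ] Lp ℂ q (volume : Measure ℝ) →L[ℂ]
        Lp ℂ 1 (volume : Measure ℝ)),
      (∀ (f : Lp ℂ p (volume : Measure ℝ)) (g : Lp ℂ q (volume : Measure ℝ)),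
        Tendsto (fun ε => ∫ z, truncKer intervalLp ε f g z) (𝓝[>] 0) (𝓝 (S f g))) ∧
      (∀ a f g, pairing p q (T a f) g = pairing 1 ∞ (S f g) a) ∧
      (∀ f g, ‖S f g‖ ≤ C * ‖f‖ * ‖g‖) ∧ ∀ a f, ‖T a f‖ ≤ C * ‖a‖ * ‖f‖ := by
  obtain ⟨C, hC0, hΛ⟩ := exists_commForm hp hq hpq
  obtain ⟨S, hS, hSb⟩ := hΛ intervalLp norm_intervalLp_sub_le
  have h22 : (2 : ℝ≥0∞).toReal.HolderConjugate (2 : ℝ≥0∞).toReal := by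
    simpa using Real.HolderConjugate.two_two
  obtain ⟨C₂, -, hΛ₂⟩ := exists_commForm (p := 2) (q := 2) (by simp) (by simp) h22
  -- The same form for exponent two supplies the `L²` bound needed to represent the functionals.
  obtain ⟨S₂, hS₂, -⟩ := hΛ₂ intervalLp norm_intervalLp_sub_le
  have hanti := antilipschitz_pairing (p := p) (q := q) hp hq hpq
  have hclosed : IsClosed (Set.range (pairing p q)) :=
    hanti.isClosed_range (pairing p q).uniformContinuous
  -- The range of the pairing is closed and the functional depends continuously on `f`, so test
  -- functions `f` suffice. These also lie in `L²`.
  have hrange : ∀ a f, ((pairing 1 ∞).flip a).comp (S f) ∈ Set.range (pairing p q) := by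
    intro a
    have hcont : Continuous fun f => ((pairing 1 ∞).flip a).comp (S f) :=
      (ContinuousLinearMap.compL ℂ _ _ _ ((pairing 1 ∞).flip a)).continuous.comp S.continuous
    have hD := MeasureTheory.Lp.dense_hasCompactSupport_contDiff (E := ℝ) (F := ℂ)
      (μ := volume) hp
    intro f
    change f ∈ (fun f => ((pairing 1 ∞).flip a).comp (S f)) ⁻¹' Set.range (pairing p q)
    refine closure_minimal ?_ (hclosed.preimage hcont) (hD f)
    rintro f ⟨u, h1, h2, h3⟩
    have hu : MemLp u 2 volume := h3.continuous.memLp_of_hasCompactSupport h2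
    refine mem_range_pairing hp hq hpq _ (((pairing 1 ∞).flip a).comp (S₂ hu.toLp)) ?_
    intro g hg hg2
    simp only [ContinuousLinearMap.comp_apply]
    congr 1
    -- Both sides are limits of the same truncated integrals, so the constructions for exponents `p`
    -- and `2` agree.
    refine tendsto_nhds_unique (hS f hg.toLp) ((hS₂ hu.toLp hg2.toLp).congr fun ε => ?_)
    refine integral_congr_ae (truncKer_congr ?_ ?_)
    · exact hu.coeFn_toLp.trans h1.symm
    · exact hg2.coeFn_toLp.trans hg.coeFn_toLp.symm
  choose T hT using hrange
  have hTg : ∀ a f g, pairing p q (T a f) g = pairing 1 ∞ (S f g) a := by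
    intro a f g
    rw [hT]
    rfl
  have hinj := hanti.injective
  have hTb : ∀ a f, ‖T a f‖ ≤ C * ‖a‖ * ‖f‖ := by
    intro a f
    refine (norm_le_norm_pairing hp hq hpq _).trans
      (ContinuousLinearMap.opNorm_le_bound _ (by positivity) fun g => ?_)
    rw [hTg]
    calc _ ≤ ‖S f g‖ * ‖a‖ := norm_pairing_le _ _
      _ ≤ (C * ‖f‖ * ‖g‖) * ‖a‖ := by
        gcongr
        exact hSb f g
      _ = _ := by ring
  refine ⟨C, LinearMap.mkContinuous₂ (LinearMap.mk₂ ℂ T ?_ ?_ ?_ ?_) C hTb, S, hS, hTg, hSb, hTb⟩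
  all_goals
    intros
    refine hinj (ContinuousLinearMap.ext fun g => ?_)
    simp only [map_add, map_smul, add_apply, smul_apply, hTg]

end

/-! ### Identification with the pointwise principal value. -/

lemma commutatorTrunc_eq (A f : ℝ → ℂ) (x ε : ℝ) :
    commutatorTrunc A f x ε = ∫ y, truncKer A ε f (fun _ => (1 : ℂ)) (x, y) := by
  have hm : MeasurableSet {y : ℝ | ε < |x - y| ∧ |x - y| < 1 / ε} :=
    ((measurableSet_lt measurable_const continuous_abs.measurable).inter
      (measurableSet_lt continuous_abs.measurable measurable_const)).preimage
      (by fun_prop : Measurable fun y : ℝ => x - y)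
  rw [commutatorTrunc, ← integral_indicator hm]
  congr 1
  funext y
  simp only [truncKer, truncInd, Set.indicator]
  by_cases h : ε < |x - y| ∧ |x - y| < 1 / ε
  · rw [if_pos (by exact h), if_pos (by exact h)]
    simp
    ring
  · rw [if_neg (by exact h), if_neg (by exact h)]
    simp

lemma truncKer_indicator (A f : ℝ → ℂ) (ε : ℝ) (G : Set ℝ) (x y : ℝ) :
    truncKer A ε f (G.indicator fun _ => (1 : ℂ)) (x, y) =
      G.indicator (fun _ => (1 : ℂ)) x * truncKer A ε f (fun _ => (1 : ℂ)) (x, y) := by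
  simp only [truncKer, smul_eq_mul]
  ring

lemma IsLipschitzPrimitive.exists_bound {A a : ℝ → ℂ} (h : IsLipschitzPrimitive A a) :
    ∃ M, ∀ x y, ‖A x - A y‖ ≤ M * |x - y| := by
  obtain ⟨⟨K, hK⟩, -⟩ := h
  refine ⟨K, fun x y => ?_⟩
  have := hK.dist_le_mul x y
  rwa [dist_eq_norm, Real.dist_eq] at this

section
variable {p q : ℝ≥0∞} [Fact (1 ≤ p)] [Fact (1 ≤ q)] [p.HolderConjugate q]

omit [Fact (1 ≤ q)] [p.HolderConjugate q] in
/-- Integrals of the truncated commutator over sets of finite measure. -/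
lemma setIntegral_commutatorTrunc (hp : p ≠ ∞) (hpq : p.toReal.HolderConjugate q.toReal)
    {A : ℝ → ℂ} {M : ℝ} (hA : ∀ x y, ‖A x - A y‖ ≤ M * |x - y|)
    (f : Lp ℂ p (volume : Measure ℝ)) {G : Set ℝ} (hG : MeasurableSet G) (hG' : volume G ≠ ∞)
    {ε : ℝ} (hε : 0 < ε) :
    ∫ x in G, commutatorTrunc A f x ε =
      ∫ z, truncKer A ε f (indicatorConstLp q hG hG' (1 : ℂ)) z := by
  have hind : (indicatorConstLp q hG hG' (1 : ℂ) : ℝ → ℂ) =ᵐ[volume]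
    G.indicator fun _ => (1 : ℂ) := indicatorConstLp_coeFn
  rw [integral_congr_ae (truncKer_congr ae_eq_rfl hind)]
  have hmeas : AEStronglyMeasurable (G.indicator fun _ => (1 : ℂ)) volume :=
    (measurable_const.indicator hG).aestronglyMeasurable
  have hint1 : Integrable fun x => ‖G.indicator (fun _ => (1 : ℂ)) x‖ ^ q.toReal := by
    have h1 : Integrable (G.indicator fun _ => (1 : ℝ)) :=
      (integrable_indicator_iff hG).mpr (integrableOn_const hG')
    refine h1.congr (Eventually.of_forall fun x => ?_)
    by_cases hx : x ∈ G <;> simp [hx, hpq.symm.ne_zero]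
  have hi := integrable_truncKer hε hpq hA (Lp.integrable_norm_rpow hp f) hint1
    (Lp.aestronglyMeasurable f) hmeas
  rw [Measure.volume_eq_prod] at hi ⊢
  rw [integral_prod _ hi, ← integral_indicator hG]
  congr 1
  funext x
  simp_rw [truncKer_indicator, integral_const_mul, ← commutatorTrunc_eq]
  by_cases hx : x ∈ G <;> simp [hx]

lemma aestronglyMeasurable_commutatorTrunc {A : ℝ → ℂ} {M : ℝ}
    (hA : ∀ x y, ‖A x - A y‖ ≤ M * |x - y|) {f : ℝ → ℂ} (hf : AEStronglyMeasurable f volume)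
    (ε : ℝ) : AEStronglyMeasurable (fun x => commutatorTrunc A f x ε) volume := by
  simp_rw [commutatorTrunc_eq]
  have h := aestronglyMeasurable_truncKer (ε := ε) hA hf
    (aestronglyMeasurable_const (b := (1 : ℂ)))
  rw [Measure.volume_eq_prod] at h
  exact h.integral_prod_right'

/-- Testing against the indicator of `G` turns convergence of the forms into convergence of set
integrals: pairing the `L¹`-valued kernel with `a` gives the kernel of `A`, and the continuous
functional passes through the integral and the limit. -/
lemma tendsto_setIntegral_commutatorTrunc (hp : p ≠ ∞)
    (hpq : p.toReal.HolderConjugate q.toReal) {A : ℝ → ℂ} {a : Lp ℂ ∞ (volume : Measure ℝ)}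
    (hA : IsLipschitzPrimitive A a) {f h : Lp ℂ p (volume : Measure ℝ)}
    {s : Lp ℂ q (volume : Measure ℝ) → Lp ℂ 1 (volume : Measure ℝ)}
    (hs : ∀ g : Lp ℂ q (volume : Measure ℝ), Tendsto (fun ε => ∫ z, truncKer intervalLp ε f g z) (𝓝[>] 0) (𝓝 (s g)))
    (hh : ∀ g, pairing p q h g = pairing 1 ∞ (s g) a) {G : Set ℝ} (hG : MeasurableSet G)
    (hG' : volume G ≠ ∞) :
    Tendsto (fun ε => ∫ x in G, commutatorTrunc A f x ε) (𝓝[>] 0) (𝓝 (∫ x in G, h x)) := by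
  obtain ⟨M, hM⟩ := hA.exists_bound
  set g := indicatorConstLp q hG hG' (1 : ℂ) with hg
  have h1 : ∫ x in G, h x = pairing 1 ∞ (s g) a := by
    rw [← hh, pairing_apply, ← integral_indicator hG]
    refine integral_congr_ae ?_
    filter_upwards [indicatorConstLp_coeFn (p := q) (hs := hG) (hμs := hG') (c := (1 : ℂ))]
      with x hx
    rw [hg, hx]
    by_cases hm : x ∈ G <;> simp [hm]
  rw [h1]
  have h2 := (((pairing 1 ∞).flip a).continuous.tendsto _).comp (hs g)
  refine h2.congr' ?_
  filter_upwards [self_mem_nhdsWithin] with ε hε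
  rw [setIntegral_commutatorTrunc (q := q) hp hpq hM f hG hG' hε, Function.comp_apply]
  have hq : q ≠ ∞ := by
    rintro rfl
    exact hpq.symm.ne_zero rfl
  have hi := integrable_truncKer hε hpq norm_intervalLp_sub_le (Lp.integrable_norm_rpow hp f)
    (Lp.integrable_norm_rpow hq g) (Lp.aestronglyMeasurable f) (Lp.aestronglyMeasurable g)
  rw [← ContinuousLinearMap.integral_comp_comm _ hi]
  congr 1
  funext z
  rw [truncKer, truncKer, map_smul, ContinuousLinearMap.flip_apply, hA.pairing_sub]

end

/-- A sequence converging weakly on sets of finite measure has the right pointwise limits. -/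
lemma ae_eq_of_tendsto_setIntegral {c : ℕ → ℝ → ℂ} (hc : ∀ n, AEStronglyMeasurable (c n) volume)
    {h : ℝ → ℂ} (hh : LocallyIntegrable h)
    (hlim : ∀ G : Set ℝ, MeasurableSet G → volume G ≠ ∞ →
      Tendsto (fun n => ∫ x in G, c n x) atTop (𝓝 (∫ x in G, h x))) :
    ∀ᵐ x, ∀ l, Tendsto (fun n => c n x) atTop (𝓝 l) → h x = l := by
  set d : ℕ → ℝ → ℂ := fun n => (hc n).mk (c n) with hd
  have hdm : ∀ n, Measurable (d n) := fun n => (hc n).stronglyMeasurable_mk.measurable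
  have hcd : ∀ᵐ x, ∀ n, c n x = d n x := ae_all_iff.mpr fun n => (hc n).ae_eq_mk
  set Z : Set ℝ := {x | ∃ l, Tendsto (fun n => d n x) atTop (𝓝 l)} with hZ
  have hZm : MeasurableSet Z := measurableSet_exists_tendsto hdm
  obtain ⟨D, hDm, hD⟩ : ∃ D : ℝ → ℂ, Measurable D ∧
      ∀ x ∈ Z, Tendsto (fun n => d n x) atTop (𝓝 (D x)) := by
    have h1 : ∀ x, ∃ l, Tendsto (fun n => Z.indicator (d n) x) atTop (𝓝 l) := by
      intro x
      by_cases hx : x ∈ Z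
      · obtain ⟨l, hl⟩ := id hx
        exact ⟨l, hl.congr fun n => by rw [Set.indicator_of_mem hx]⟩
      · exact ⟨0, tendsto_const_nhds.congr fun n => by rw [Set.indicator_of_notMem hx]⟩
    choose D hD using h1
    refine ⟨D, measurable_of_tendsto_metrizable (fun n => (hdm n).indicator hZm)
      (tendsto_pi_nhds.mpr hD), fun x hx => (hD x).congr fun n => by
        rw [Set.indicator_of_mem hx]⟩
  -- On `E k` the sequence converges and is bounded by `k`, and the measure is finite, so dominated
  -- convergence identifies the pointwise limit with `h`. A convergent sequence is bounded, so these
  -- sets exhaust `Z`.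
  set E : ℕ → Set ℝ := fun k => (Z ∩ {x | ∀ n, ‖d n x‖ ≤ k}) ∩ Set.Icc (-(k : ℝ)) k with hE
  have hEm : ∀ k, MeasurableSet (E k) := by
    intro k
    refine (hZm.inter ?_).inter measurableSet_Icc
    have : {x | ∀ n, ‖d n x‖ ≤ k} = ⋂ n, {x | ‖d n x‖ ≤ k} := by ext; simp
    rw [this]
    exact MeasurableSet.iInter fun n => measurableSet_le (hdm n).norm measurable_const
  have hEfin : ∀ k, volume (E k) ≠ ∞ := fun k =>
    ((measure_mono Set.inter_subset_right).trans_lt (by simp)).ne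
  have hEeq : ∀ k, ∀ᵐ x, x ∈ E k → h x = D x := by
    intro k
    rw [← ae_restrict_iff' (hEm k)]
    have hfin : Fact (volume (E k) < ∞) := ⟨(hEfin k).lt_top⟩
    have hDb : ∀ x ∈ E k, ‖D x‖ ≤ k := fun x hx =>
      le_of_tendsto (hD x hx.1.1).norm (Eventually.of_forall fun n => hx.1.2 n)
    refine Integrable.ae_eq_of_forall_setIntegral_eq h D ?_ ?_ ?_
    · exact (hh.integrableOn_isCompact isCompact_Icc).mono_set Set.inter_subset_right
    · exact Measure.integrableOn_of_bounded (hEfin k) hDm.aestronglyMeasurable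
        (ae_restrict_of_forall_mem (hEm k) hDb)
    · intro G hG _
      rw [Measure.restrict_restrict hG]
      have hGE := hG.inter (hEm k)
      have hGfin : volume (G ∩ E k) ≠ ∞ :=
        ((measure_mono Set.inter_subset_right).trans_lt (hEfin k).lt_top).ne
      refine tendsto_nhds_unique (hlim _ hGE hGfin) ?_
      have heq : ∀ n, ∫ x in G ∩ E k, c n x = ∫ x in G ∩ E k, d n x := fun n =>
        integral_congr_ae (ae_restrict_of_ae (hcd.mono fun x hx => hx n))
      simp_rw [heq]
      refine tendsto_integral_of_dominated_convergence (fun _ => (k : ℝ))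
        (fun n => (hdm n).aestronglyMeasurable) (integrableOn_const hGfin) (fun n => ?_) ?_
      · exact ae_restrict_of_forall_mem hGE fun x hx => hx.2.1.2 n
      · exact ae_restrict_of_forall_mem hGE fun x hx => hD x hx.2.1.1
  filter_upwards [hcd, ae_all_iff.mpr hEeq] with x hx hxE l hl
  have hl' : Tendsto (fun n => d n x) atTop (𝓝 l) := hl.congr hx
  have hxZ : x ∈ Z := ⟨l, hl'⟩
  obtain ⟨B, hB⟩ := hl'.norm.bddAbove_range
  obtain ⟨k, hk⟩ := exists_nat_ge (max B |x|)
  have hxk : x ∈ E k := ⟨⟨hxZ, fun n => (hB ⟨n, rfl⟩).trans ((le_max_left _ _).trans hk)⟩,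
    abs_le.mp ((le_max_right _ _).trans hk)⟩
  rw [hxE k hxk]
  exact tendsto_nhds_unique (hD x hxZ) hl'

/-! ### Existence of the principal value for Schwartz data. -/

lemma SchwartzMap.exists_norm_le (f : 𝓢(ℝ, ℂ)) : ∃ C, ∀ x, ‖f x‖ ≤ C :=
  ⟨_, fun x => SchwartzMap.norm_le_seminorm ℝ f x⟩

lemma SchwartzMap.exists_norm_sub_le (f : 𝓢(ℝ, ℂ)) :
    ∃ L, 0 ≤ L ∧ ∀ x y, ‖f x - f y‖ ≤ L * |x - y| := by
  obtain ⟨L, hL⟩ := (SchwartzMap.derivCLM ℝ ℂ f).exists_norm_le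
  refine ⟨L, (norm_nonneg _).trans (hL 0), fun x y => ?_⟩
  have := Convex.norm_image_sub_le_of_norm_hasDerivWithin_le (f := f) (f' := deriv f)
    (C := L) (s := Set.univ) (x := y) (y := x)
    (fun t _ => f.differentiableAt.hasDerivAt.hasDerivWithinAt)
    (fun t _ => by simpa using hL t) convex_univ (Set.mem_univ _) (Set.mem_univ _)
  simpa using this

/-- The mean value inequality for `s ↦ A(x + s) + A(x - s)`, whose derivative `a(x + s) - a(x - s)`
is at most `2 L |s|`. -/
lemma norm_second_difference_le {A a : ℝ → ℂ} (hA : ∀ x, HasDerivAt A (a x) x) {L : ℝ}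
    (hL : ∀ x y, ‖a x - a y‖ ≤ L * |x - y|) (x t : ℝ) :
    ‖(A (x + t) - A x) - (A x - A (x - t))‖ ≤ 2 * L * t ^ 2 := by
  have hL0 : 0 ≤ L := by
    have := (norm_nonneg _).trans (hL 1 0)
    simpa using this
  have hd : ∀ s : ℝ, HasDerivAt (fun s => A (x + s) + A (x - s)) (a (x + s) - a (x - s)) s := by
    intro s
    have h1 := (hA (x + s)).comp_const_add x s
    have h2 := (hA (x - s)).comp_const_sub x s
    simpa [sub_eq_add_neg] using h1.fun_add h2
  have h := Convex.norm_image_sub_le_of_norm_hasDerivWithin_le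
    (f := fun s => A (x + s) + A (x - s)) (f' := fun s => a (x + s) - a (x - s))
    (C := L * (2 * |t|)) (s := Set.uIcc 0 t) (x := 0) (y := t)
    (fun s _ => (hd s).hasDerivWithinAt)
    (fun s hs => (hL _ _).trans (by
      have h1 : |s| ≤ |t| := by
        have := Set.abs_sub_left_of_mem_uIcc hs
        simpa using this
      have h2 : x + s - (x - s) = 2 * s := by ring
      rw [h2, abs_mul, abs_two]
      gcongr)) (convex_uIcc 0 t) Set.left_mem_uIcc Set.right_mem_uIcc
  simp only [add_zero, sub_zero, Real.norm_eq_abs] at h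
  calc _ = ‖A (x + t) + A (x - t) - (A x + A x)‖ := by congr 1; ring
    _ ≤ L * (2 * |t|) * |t| := h
    _ = 2 * L * (|t| * |t|) := by ring
    _ = _ := by rw [abs_mul_abs_self, sq]

lemma commutatorTrunc_eq_integral (A f : ℝ → ℂ) (x ε : ℝ) : commutatorTrunc A f x ε =
    ∫ t, (truncInd ε t : ℂ) * ((A x - A (x - t)) / (t : ℂ) ^ 2 * f (x - t)) := by
  rw [commutatorTrunc_eq, ← integral_sub_left_eq_self _ volume x]
  congr 1
  funext t
  simp only [truncKer, sub_sub_cancel, smul_eq_mul]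
  change (((truncInd ε t * (t ^ 2)⁻¹ : ℝ) : ℂ) * (f (x - t) * 1)) * (A x - A (x - t)) = _
  push_cast
  ring

/-- For Schwartz data the principal value exists everywhere. -/
theorem exists_hasCommutatorPV (a f : 𝓢(ℝ, ℂ)) {A : ℝ → ℂ} (hA : ∀ x, HasDerivAt A (a x) x)
    (x : ℝ) : ∃ l, HasCommutatorPV A f x l := by
  obtain ⟨M, hM⟩ := a.exists_norm_le
  obtain ⟨L, hL0, hL⟩ := a.exists_norm_sub_le
  obtain ⟨B, hB⟩ := f.exists_norm_le
  obtain ⟨K, hK0, hK⟩ := f.exists_norm_sub_le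
  have hM0 : 0 ≤ M := (norm_nonneg _).trans (hM 0)
  have hB0 : 0 ≤ B := (norm_nonneg _).trans (hB 0)
  have hAlip : ∀ x y, ‖A x - A y‖ ≤ M * |x - y| := by
    intro x y
    have := Convex.norm_image_sub_le_of_norm_hasDerivWithin_le (f := A) (f' := a)
      (C := M) (s := Set.univ) (x := y) (y := x) (fun t _ => (hA t).hasDerivWithinAt)
      (fun t _ => hM t) convex_univ (Set.mem_univ _) (Set.mem_univ _)
    simpa using this
  have hAc : Continuous A := continuous_of_lip hAlip
  have hfc : Continuous f := f.continuous
  have hfi : Integrable f := f.integrable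
  set φ : ℝ → ℂ := fun t => (A x - A (x - t)) / (t : ℂ) ^ 2 * f (x - t) with hφ
  have hφm : Measurable φ := by
    have h1 : Measurable fun t : ℝ => (t : ℂ) ^ 2 := by fun_prop
    have h2 : Measurable fun t : ℝ => A x - A (x - t) :=
      Continuous.measurable (by fun_prop)
    have h3 : Measurable fun t : ℝ => f (x - t) := Continuous.measurable (by fun_prop)
    exact (h2.div h1).mul h3
  have hφb : ∀ t, ‖φ t‖ ≤ M * |t|⁻¹ * ‖f (x - t)‖ := by
    intro t
    rw [hφ, norm_mul, norm_div, norm_pow, Complex.norm_real, Real.norm_eq_abs]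
    have h1 := hAlip x (x - t)
    rw [sub_sub_cancel] at h1
    rcases eq_or_ne t 0 with rfl | ht
    · simp
    have ht' : 0 < |t| := abs_pos.mpr ht
    gcongr
    rw [div_le_iff₀ (by positivity)]
    calc _ ≤ M * |t| := h1
      _ = _ := by field_simp
  -- The truncation region is symmetric in `t`, so only the even part of the integrand matters;
  -- unlike `φ`, it is bounded near `0`.
  set ψ : ℝ → ℂ := fun t => φ t + φ (-t) with hψ
  have hψm : Measurable ψ := hφm.add (hφm.comp measurable_neg)
  have hfi1 : Integrable fun t => f (x - t) := hfi.comp_sub_left x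
  have hfi2 : Integrable fun t => f (x + t) := hfi.comp_add_left x
  have hsmall : ∀ t, t ≠ 0 → ‖ψ t‖ ≤ 2 * M * K + 2 * L * B := by
    intro t ht
    have ht' : 0 < |t| := abs_pos.mpr ht
    have htc : (t : ℂ) ≠ 0 := by exact_mod_cast ht
    -- The numerator splits into a product of two first differences and a second difference of `A`;
    -- both are of order `t²` and offset the denominator.
    have heq : ψ t = ((A x - A (x - t)) * (f (x - t) - f (x + t)) -
        ((A (x + t) - A x) - (A x - A (x - t))) * f (x + t)) / (t : ℂ) ^ 2 := by
      simp only [hψ, hφ, sub_neg_eq_add]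
      push_cast
      field_simp
      ring
    have h1 := hAlip x (x - t)
    have h2 := hK (x - t) (x + t)
    rw [sub_sub_cancel] at h1
    rw [show x - t - (x + t) = -(2 * t) by ring, abs_neg, abs_mul, abs_two] at h2
    have h3 := norm_second_difference_le hA hL x t
    rw [heq, norm_div, norm_pow, Complex.norm_real, Real.norm_eq_abs, div_le_iff₀ (by positivity)]
    calc _ ≤ ‖A x - A (x - t)‖ * ‖f (x - t) - f (x + t)‖ +
          ‖(A (x + t) - A x) - (A x - A (x - t))‖ * ‖f (x + t)‖ := by
          refine (norm_sub_le _ _).trans_eq ?_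
          rw [norm_mul, norm_mul]
      _ ≤ (M * |t|) * (K * (2 * |t|)) + (2 * L * t ^ 2) * B := by
          gcongr
          exact hB _
      _ = _ := by rw [sq_abs]; linear_combination (2 * M * K) * sq_abs t
  have hlarge : ∀ t, 1 ≤ |t| → ‖ψ t‖ ≤ M * (‖f (x - t)‖ + ‖f (x + t)‖) := by
    intro t ht
    have h1 := hφb t
    have h2 := hφb (-t)
    rw [abs_neg, sub_neg_eq_add] at h2
    have h3 : |t|⁻¹ ≤ 1 := inv_le_one_of_one_le₀ ht
    have h4 : M * |t|⁻¹ ≤ M := mul_le_of_le_one_right hM0 h3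
    have h5 := mul_le_mul_of_nonneg_right h4 (norm_nonneg (f (x - t)))
    have h6 := mul_le_mul_of_nonneg_right h4 (norm_nonneg (f (x + t)))
    refine (norm_add_le _ _).trans ?_
    linarith
  have hψi : Integrable ψ := by
    have h1 : Integrable ((Set.Icc (-1 : ℝ) 1).indicator fun _ => 2 * M * K + 2 * L * B) :=
      (integrable_indicator_iff measurableSet_Icc).mpr (integrableOn_const (by simp))
    have h2 := (hfi1.norm.fun_add hfi2.norm).const_mul M
    refine (h1.fun_add h2).mono' hψm.aestronglyMeasurable ?_
    have hne : ∀ᵐ t : ℝ, t ≠ 0 := by simp [ae_iff]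
    filter_upwards [hne] with t ht
    rcases le_or_gt |t| 1 with h | h
    · rw [Set.indicator_of_mem (by exact abs_le.mp h)]
      have := hsmall t ht
      have : 0 ≤ M * (‖f (x - t)‖ + ‖f (x + t)‖) := by positivity
      linarith
    · have hm : t ∉ Set.Icc (-1 : ℝ) 1 := fun hm => h.not_ge (abs_le.mpr hm)
      rw [Set.indicator_of_notMem hm, zero_add]
      exact hlarge t h.le
  have hsym : ∀ ε : ℝ, 0 < ε →
      commutatorTrunc A f x ε = 2⁻¹ * ∫ t, (truncInd ε t : ℂ) * ψ t := by
    intro ε hε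
    have hi : Integrable fun t => (truncInd ε t : ℂ) * φ t := by
      refine (hfi1.norm.const_mul (M * ε⁻¹)).mono' ?_ (Eventually.of_forall fun t => ?_)
      · exact ((Complex.measurable_ofReal.comp (measurable_truncInd ε)).mul
          hφm).aestronglyMeasurable
      · rw [norm_mul, Complex.norm_real, Real.norm_of_nonneg (truncInd_nonneg _ _)]
        by_cases ht : ε < |t| ∧ |t| < 1 / ε
        · calc _ ≤ 1 * (M * |t|⁻¹ * ‖f (x - t)‖) := by
                gcongr
                · exact truncInd_le_one _ _
                · exact hφb t
            _ ≤ 1 * (M * ε⁻¹ * ‖f (x - t)‖) := by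
                gcongr
                exact ht.1.le
            _ = _ := one_mul _
        · rw [truncInd, Set.indicator_of_notMem (by exact ht), zero_mul]
          positivity
    have h1 := integral_neg_eq_self (fun t => (truncInd ε t : ℂ) * φ t) volume
    have hi' : Integrable fun t => (truncInd ε (-t) : ℂ) * φ (-t) := hi.comp_neg
    have h2 : ∀ t, (truncInd ε t : ℂ) * ψ t =
        (truncInd ε t : ℂ) * φ t + (truncInd ε (-t) : ℂ) * φ (-t) := by
      intro t
      rw [truncInd_neg]
      ring
    simp_rw [h2]
    rw [integral_add hi hi', h1, commutatorTrunc_eq_integral]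
    ring
  have hlim : Tendsto (fun ε => ∫ t, (truncInd ε t : ℂ) * ψ t) (𝓝[>] 0) (𝓝 (∫ t, ψ t)) := by
    refine tendsto_integral_filter_of_dominated_convergence _ ?_ ?_ hψi.norm ?_
    · exact Eventually.of_forall fun ε => ((Complex.measurable_ofReal.comp
        (measurable_truncInd ε)).mul hψm).aestronglyMeasurable
    · refine Eventually.of_forall fun ε => Eventually.of_forall fun t => ?_
      rw [norm_mul, Complex.norm_real, Real.norm_of_nonneg (truncInd_nonneg _ _)]
      exact mul_le_of_le_one_left (norm_nonneg _) (truncInd_le_one _ _)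
    · have hne : ∀ᵐ t : ℝ, t ≠ 0 := by simp [ae_iff]
      filter_upwards [hne] with t ht
      refine tendsto_const_nhds.congr' ?_
      filter_upwards [eventually_truncInd_eq_one ht] with ε hε
      rw [hε]
      simp
  refine ⟨2⁻¹ * ∫ t, ψ t, (hlim.const_mul _).congr' ?_⟩
  filter_upwards [self_mem_nhdsWithin] with ε hε
  exact (hsym ε hε).symm

/-! ### The theorem. -/

theorem theorem1p1 (p q : ℝ≥0∞) [Fact (1 ≤ p)] [Fact (1 ≤ q)]
    (hp : 1 < p) (hp_top : p < ∞) (hpq : p.HolderConjugate q) :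
    ∃ (C : ℝ)
      (T : Lp ℂ ∞ (volume : Measure ℝ) →L[ℂ] Lp ℂ p (volume : Measure ℝ) →L[ℂ]
        Lp ℂ p (volume : Measure ℝ))
      (S : Lp ℂ p (volume : Measure ℝ) →L[ℂ] Lp ℂ q (volume : Measure ℝ) →L[ℂ]
        Lp ℂ 1 (volume : Measure ℝ)),
      -- for Schwartz data the principal value exists at every point
      (∀ (a f : 𝓢(ℝ, ℂ)) (A : ℝ → ℂ), (∀ x, HasDerivAt A (a x) x) →
        ∀ x, ∃ l, HasCommutatorPV A f x l) ∧
      -- `T a` extends the principal value operator: it agrees with it wherever the limit exists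
      (∀ (a : Lp ℂ ∞ (volume : Measure ℝ)) (A : ℝ → ℂ), IsLipschitzPrimitive A a →
        ∀ f : Lp ℂ p (volume : Measure ℝ), ∀ᵐ x : ℝ, ∀ l, HasCommutatorPV A f x l → T a f x = l) ∧
      -- `S` is the adjoint in the variable `a`, and it determines `T`
      (∀ (a : Lp ℂ ∞ (volume : Measure ℝ)) (f h : Lp ℂ p (volume : Measure ℝ)),
        h = T a f ↔ ∀ g : Lp ℂ q (volume : Measure ℝ), ∫ x, h x * g x = ∫ x, S f g x * a x) ∧
      -- the estimates
      (∀ f g, ‖S f g‖ ≤ C * ‖f‖ * ‖g‖) ∧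
      (∀ a f, ‖T a f‖ ≤ C * ‖a‖ * ‖f‖) := by
  have hp' : 1 < p.toReal := by
    rw [← ENNReal.toReal_one]
    exact (ENNReal.toReal_lt_toReal ENNReal.one_ne_top hp_top.ne).mpr hp
  have hR : p.toReal.HolderConjugate q.toReal := ENNReal.HolderConjugate.toReal hp'
  have hq : q ≠ ∞ := by
    rintro rfl
    exact hR.symm.ne_zero rfl
  obtain ⟨C, T, S, hS, hT, hSb, hTb⟩ := exists_commutator_operators hp_top.ne hq hR
  refine ⟨C, T, S, fun a f A hA x => exists_hasCommutatorPV a f hA x, ?_, ?_, hSb, hTb⟩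
  · intro a A hA f
    obtain ⟨M, hM⟩ := hA.exists_bound
    -- One fixed sequence tending to `0` from above suffices: a limit along `ε` is also the limit
    -- along the sequence, and the exceptional null set is then that of a countable family.
    obtain ⟨u, -, hu0, hu⟩ := exists_seq_strictAnti_tendsto (0 : ℝ)
    have hu' : Tendsto u atTop (𝓝[>] 0) :=
      tendsto_nhdsWithin_iff.mpr ⟨hu, Eventually.of_forall hu0⟩
    have h := ae_eq_of_tendsto_setIntegral
      (c := fun n x => commutatorTrunc A f x (u n)) (h := T a f)
      (fun n => aestronglyMeasurable_commutatorTrunc hM (Lp.aestronglyMeasurable f) (u n))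
      ((Lp.memLp (T a f)).locallyIntegrable Fact.out)
      (fun G hG hG' => (tendsto_setIntegral_commutatorTrunc (q := q) hp_top.ne hR hA (hS f)
        (hT a f) hG hG').comp hu')
    filter_upwards [h] with x hx l hl
    exact hx l (hl.comp hu')
  · intro a f h
    constructor
    · rintro rfl g
      rw [← pairing_apply, hT, pairing_apply]
    · intro hh
      -- Uniqueness is injectivity of the pairing.
      refine (antilipschitz_pairing (p := p) (q := q) hp_top.ne hq hR).injective
        (ContinuousLinearMap.ext fun g => ?_)
      rw [hT, pairing_apply, hh g, pairing_apply]
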